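/- Let $L\in\mathbb{R}^{M\times M}$, $v\in\mathbb{R}^M$ with $\|v\|=1$ (Euclidean norm), $h>0$, $\delta>0$, $\tau:=h/\delta$, and let $k\ge 0$, $m\ge 1$ be integers. Let $\varphi_0(z)=e^z$, $\varphi_{j+1}(z)=(\varphi_j(z)-1/j!)/z$ (entire functions), $Z:=(I-\delta L)^{-1}$ and $f_k(z):=\varphi_k(\tau(1-1/z))$. The Arnoldi process for $Z$ started at $v_1=v$ produces vectors $v_1,v_2,\dots$ by orthogonalising $Zv_j$ against $v_1,\dots,v_j$ and normalising; put $h_{i,j}:=v_i^{T}Zv_j$, $V_m:=[v_1,\dots,v_m]$, $H_m:=(h_{i,j})_{1\le i,j\le m}$, and assume that the process does not terminate before step $m$, i.e. $h_{i+1,i}\neq 0$ for $1\le i<m$. Let $$E_{k,m}:=\varphi_k(hL)v-V_m f_k(H_m)e_1$$ be the error of the $m$-th restricted-denominator (RD) rational Arnoldi approximation. Let $F(L):=\{x^HLx/x^Hx:\ x\in\mathbb{C}^M\setminus\{0\}\}$ be the numerical range of $L$ and, for $0\le\theta<\pi/2$, let $S_\theta:=\{0\}\cup\{\lambda\in\mathbb{C}\setminus\{0\}:\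 |\arg(-\lambda)|\le\theta\}$. Further let $$L_n^{(\alpha)}(x)=\sum_{j=0}^n(-1)^j\binom{n+\alpha}{n-j}\frac{x^j}{j!},\qquad c_j(\theta):=\bigl(1+\sqrt{2(1-\cos\theta)}\bigr)^j,$$ $$C_{k,m}(\tau,\theta):=\frac{(m-1)!}{(m+k)!}\sum_{j=0}^{m-1}\bigl|L^{(k)}_{m-1-j}(\tau)\bigr|\,c_j(\theta),\qquad C'_{k,m}(\theta):=\frac{(m-1)!}{(m+k)!}\sum_{j=0}^{m-1}\binom{m+k-j-1}{k}c_j(\theta).$$ There is an absolute constant $K$ with $2\le K\le 11.08$ such that, for all such data, if $F(L)\subset S_\theta$ with $0\le\theta<\pi/3$, then $$\|E_{k,m}\|\le K\,\frac{e^{\tau(\cos\theta-\frac12)-m-k-1}}{\tau^{m+k}}\Bigl(\frac{2(m+k+1)}{2\cos\theta-1}\Bigr)^{m+k+1}C_{k,m}(\tau,\theta)\prod_{i=1}^m h_{i+1,i}$$ $$\le K\,\frac{e^{\tau\cos\theta-m-k-1}}{\tau^{m+k}}\Bigl(\frac{2(m+k+1)}{2\cos\theta-1}\Bigr)^{m+k+1}C'_{k,m}(\theta)\prod_{i=1}^m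 h_{i+1,i}.$$ If $L$ is symmetric, both inequalities also hold with $K$ replaced by $1$. -/

import Mathlib

open scoped Nat Matrix

noncomputable section

namespace RDArnoldi

/-- The function `φ_k`, given by its (everywhere convergent) Taylor series
`φ_k(a) = ∑ aⁿ / (n + k)!`, evaluated at an element `a` of a real algebra: a number or a square
matrix. That this is the family `φ_0 = exp`, `φ_{k+1}(a) = (φ_k(a) - 1 / k!) / a` is proved in
`phi_zero`, `mul_phi_succ`, `phi_succ_complex`, `phi_zero_matrix` and `mul_phi_succ_matrix`. -/
def phi {A : Type*} [Ring A] [Algebra ℝ A] [TopologicalSpace A] (k : ℕ) (a : A) : A :=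
  ∑' n : ℕ, (((n + k)! : ℝ))⁻¹ • a ^ n

theorem summable_phi {A : Type*} [NormedRing A] [NormedAlgebra ℝ A] [CompleteSpace A]
    (k : ℕ) (a : A) : Summable fun n : ℕ => (((n + k)! : ℝ))⁻¹ • a ^ n := by
  have h := NormedSpace.norm_expSeries_summable' (𝕂 := ℝ) a
  refine Summable.of_norm (h.of_nonneg_of_le (fun _ => norm_nonneg _) fun n => ?_)
  rw [norm_smul, norm_smul]
  refine mul_le_mul_of_nonneg_right ?_ (norm_nonneg _)
  rw [norm_inv, norm_inv, Real.norm_natCast, Real.norm_natCast]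
  refine inv_anti₀ (by exact_mod_cast Nat.factorial_pos n) ?_
  exact_mod_cast Nat.factorial_le (Nat.le_add_right n k)

theorem phi_zero {A : Type*} [NormedRing A] [NormedAlgebra ℝ A] (a : A) :
    phi 0 a = NormedSpace.exp a := by
  rw [NormedSpace.exp_eq_tsum ℝ]
  rfl

theorem mul_phi_succ {A : Type*} [NormedRing A] [NormedAlgebra ℝ A] [CompleteSpace A]
    (k : ℕ) (a : A) : a * phi (k + 1) a = phi k a - ((k ! : ℝ))⁻¹ • (1 : A) := by
  unfold phi
  rw [(summable_phi k a).tsum_eq_zero_add, ← (summable_phi (k + 1) a).tsum_mul_left]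
  simp only [pow_zero, zero_add, add_sub_cancel_left]
  refine tsum_congr fun n => ?_
  rw [mul_smul_comm, pow_succ', show n + (k + 1) = n + 1 + k by ring]

theorem phi_succ_complex (k : ℕ) (z : ℂ) (hz : z ≠ 0) :
    phi (k + 1) z = (phi k z - 1 / (k ! : ℂ)) / z := by
  rw [eq_div_iff hz, mul_comm, mul_phi_succ]
  simp

theorem phi_zero_matrix {m : ℕ} (B : Matrix (Fin m) (Fin m) ℝ) :
    phi 0 B = NormedSpace.exp B := by
  let _ : NormedRing (Matrix (Fin m) (Fin m) ℝ) := Matrix.linftyOpNormedRing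
  let _ : NormedAlgebra ℝ (Matrix (Fin m) (Fin m) ℝ) := Matrix.linftyOpNormedAlgebra
  exact phi_zero B

theorem mul_phi_succ_matrix {m : ℕ} (k : ℕ) (B : Matrix (Fin m) (Fin m) ℝ) :
    B * phi (k + 1) B = phi k B - ((k ! : ℝ))⁻¹ • (1 : Matrix (Fin m) (Fin m) ℝ) := by
  let _ : NormedRing (Matrix (Fin m) (Fin m) ℝ) := Matrix.linftyOpNormedRing
  let _ : NormedAlgebra ℝ (Matrix (Fin m) (Fin m) ℝ) := Matrix.linftyOpNormedAlgebra
  exact mul_phi_succ k B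

/-- The numerical range `{xᴴ L x / xᴴ x : x ∈ ℂᴹ, x ≠ 0}` of a real matrix. -/
def numericalRange {M : ℕ} (L : Matrix (Fin M) (Fin M) ℝ) : Set ℂ :=
  {z | ∃ x : Fin M → ℂ, x ≠ 0 ∧
    z = (star x ⬝ᵥ (L.map (fun t : ℝ => (t : ℂ)) *ᵥ x)) / (star x ⬝ᵥ x)}

/-- The closed sector of semiangle `θ` around the negative real axis, with vertex `0`
(the vertex belongs to it, since `Complex.arg 0 = 0`). -/
def sector (θ : ℝ) : Set ℂ :=
  {z | |Complex.arg (-z)| ≤ θ}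

/-- The shifted and inverted matrix `Z = (I - δ L)⁻¹`. -/
def shiftInv {M : ℕ} (δ : ℝ) (L : Matrix (Fin M) (Fin M) ℝ) : Matrix (Fin M) (Fin M) ℝ :=
  (1 - δ • L)⁻¹

/-- The vectors produced by the Arnoldi process for `Z` started at the unit vector `v`, numbered
from `0`: the vector `Z v_n` is orthogonalised against `v_0, …, v_n` and normalised. -/
def arnoldiVec {M : ℕ} (Z : Matrix (Fin M) (Fin M) ℝ) (v : EuclideanSpace ℝ (Fin M)) :
    ℕ → EuclideanSpace ℝ (Fin M)
  | 0 => v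
  | n + 1 =>
    let u := Matrix.toEuclideanLin Z (arnoldiVec Z v n)
    let w := u - ∑ i : Fin (n + 1), inner ℝ (arnoldiVec Z v i) u • arnoldiVec Z v i
    ‖w‖⁻¹ • w

/-- The Arnoldi coefficients `v_iᵀ Z v_j`, with the vectors numbered from `0`. -/
def arnoldiCoeff {M : ℕ} (Z : Matrix (Fin M) (Fin M) ℝ) (v : EuclideanSpace ℝ (Fin M))
    (i j : ℕ) : ℝ :=
  inner ℝ (arnoldiVec Z v i) (Matrix.toEuclideanLin Z (arnoldiVec Z v j))

/-- The `m × m` upper Hessenberg matrix `H_m` of the Arnoldi process. -/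
def arnoldiH {M : ℕ} (Z : Matrix (Fin M) (Fin M) ℝ) (v : EuclideanSpace ℝ (Fin M)) (m : ℕ) :
    Matrix (Fin m) (Fin m) ℝ :=
  Matrix.of fun i j => arnoldiCoeff Z v i j

/-- The `M × m` matrix `V_m` whose columns are the first `m` Arnoldi vectors. -/
def arnoldiV {M : ℕ} (Z : Matrix (Fin M) (Fin M) ℝ) (v : EuclideanSpace ℝ (Fin M)) (m : ℕ) :
    Matrix (Fin M) (Fin m) ℝ :=
  Matrix.of fun i j => arnoldiVec Z v j i

/-- The product of the first `m` subdiagonal coefficients: `h_{2,1} h_{3,2} ⋯ h_{m+1,m}` when the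
vectors are numbered from `1`. -/
def subdiagProd {M : ℕ} (Z : Matrix (Fin M) (Fin M) ℝ) (v : EuclideanSpace ℝ (Fin M)) (m : ℕ) :
    ℝ :=
  ∏ i ∈ Finset.range m, arnoldiCoeff Z v (i + 1) i

/-- The Arnoldi process does not terminate before step `m`: the coefficients
`h_{2,1}, …, h_{m,m-1}` (vectors numbered from `1`) do not vanish. -/
def NoBreakdown {M : ℕ} (Z : Matrix (Fin M) (Fin M) ℝ) (v : EuclideanSpace ℝ (Fin M)) (m : ℕ) :
    Prop :=
  ∀ i : ℕ, i + 1 < m → arnoldiCoeff Z v (i + 1) i ≠ 0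

/-- The function `f_k(z) = φ_k(τ (1 - 1 / z))` evaluated at an invertible matrix. -/
def fMat {m : ℕ} (k : ℕ) (τ : ℝ) (B : Matrix (Fin m) (Fin m) ℝ) : Matrix (Fin m) (Fin m) ℝ :=
  phi k (τ • (1 - B⁻¹))

/-- The exact vector `φ_k(hL) v`. -/
def exactVec {M : ℕ} (k : ℕ) (h : ℝ) (L : Matrix (Fin M) (Fin M) ℝ)
    (v : EuclideanSpace ℝ (Fin M)) : EuclideanSpace ℝ (Fin M) :=
  Matrix.toEuclideanLin (phi k (h • L)) v

/-- The `m`-th restricted-denominator rational Arnoldi approximation `V_m f_k(H_m) e_1`. -/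
def approxVec {M : ℕ} (k : ℕ) (h δ : ℝ) (L : Matrix (Fin M) (Fin M) ℝ)
    (v : EuclideanSpace ℝ (Fin M)) (m : ℕ) : EuclideanSpace ℝ (Fin M) :=
  WithLp.toLp 2 (arnoldiV (shiftInv δ L) v m *ᵥ
    (fMat k (h / δ) (arnoldiH (shiftInv δ L) v m) *ᵥ
      fun i : Fin m => if (i : ℕ) = 0 then (1 : ℝ) else 0))

/-- The generalized Laguerre polynomial `L_n^{(α)}`, for a natural number `α`. -/
def laguerre (n α : ℕ) (x : ℝ) : ℝ :=
  ∑ j ∈ Finset.range (n + 1), (-1) ^ j * ((n + α).choose (n - j) : ℝ) * (x ^ j / (j ! : ℝ))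

/-- `c_j(θ) = (1 + √(2 (1 - cos θ)))ʲ`. -/
def cCoeff (j : ℕ) (θ : ℝ) : ℝ :=
  (1 + √(2 * (1 - Real.cos θ))) ^ j

/-- `C_{k,m}(τ, θ)`. -/
def bigC (k m : ℕ) (τ θ : ℝ) : ℝ :=
  ((m - 1)! : ℝ) / ((m + k)! : ℝ) *
    ∑ j ∈ Finset.range m, |laguerre (m - 1 - j) k τ| * cCoeff j θ

/-- `C'_{k,m}(θ)`. -/
def bigC' (k m : ℕ) (θ : ℝ) : ℝ :=
  ((m - 1)! : ℝ) / ((m + k)! : ℝ) *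
    ∑ j ∈ Finset.range m, ((m + k - j - 1).choose k : ℝ) * cCoeff j θ

/-- The first (sharper) error bound. -/
def bound₁ (K : ℝ) (k m : ℕ) (τ θ P : ℝ) : ℝ :=
  K * (Real.exp (τ * (Real.cos θ - 1 / 2) - m - k - 1) / τ ^ (m + k)) *
    (2 * (m + k + 1) / (2 * Real.cos θ - 1)) ^ (m + k + 1) * bigC k m τ θ * P

/-- The second (coarser) error bound. -/
def bound₂ (K : ℝ) (k m : ℕ) (τ θ P : ℝ) : ℝ :=
  K * (Real.exp (τ * Real.cos θ - m - k - 1) / τ ^ (m + k)) *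
    (2 * (m + k + 1) / (2 * Real.cos θ - 1)) ^ (m + k + 1) * bigC' k m θ * P

end RDArnoldi

end

/-! ### Density of diagonalizable matrices. -/

noncomputable section
namespace RDArnoldi
open Polynomial Filter Topology

/-! Put A = -δL, so that Z = (1 + A)⁻¹, hL = -τA and φ_k(hL) = f(Z) with f(z) = φ_k(τ(1 - 1/z)). Let
χ be the characteristic polynomial of H_m and p the Hermite interpolant of f at the roots of χ, so
that f = p + χg with g holomorphic. Then f(H_m) = p(H_m). Since deg p < m, the Krylov relations give
V_m p(H_m) e₁ = p(Z)v (`aeval_mulVec_eq`). Since χ is monic and annihilates H_m, the vector χ(Z)v is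
the product of the subdiagonal entries times v_{m+1} (`charpoly_mulVec_eq`). So the error is
g(Z)χ(Z)v, and it remains to bound g and then g(Z).

Size of g. The sector condition passes from A to H_m⁻¹ - 1 (`IsSectorial.compression`), so the nodes
lie in a lens, the image of a shifted sector under z ↦ 1/z, which is convex. Multiplying by (τ(z -
1))^k turns f, up to a polynomial, into z^k e^{τ(1 - 1/z)}. Thus τ^k g is an interpolation remainder
of this function with k extra nodes at 1, and it is controlled by the derivative of order m + k
(`norm_interpolation_error_le`). A Rodrigues formula expresses that derivative through
L_{m-1}^{(k+1)}(τ/z) (`iterate_deriv_expInv`). The addition and multiplication theorems for Laguerre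
polynomials reduce it to |L_n(x)| ≤ e^{x/2} for x > 0, which follows from the orthogonality norm of
the Charlier polynomials (`abs_laguerre_zero_le`). This yields C_{k,m}, and the same inequality
compares C_{k,m} with C'_{k,m}.

Size of g(Z). For symmetric L the spectral theorem gives ‖g(Z)‖ ≤ sup |g|, hence K = 1. In general a
Crouzeix–Palencia argument shows that a sector of semiangle below π/3 is a 4-spectral set
(`norm_fc_le`): f(A) plus the adjoint of (Cf)(A) has norm at most 2, where Cf is the Cauchy
transform of the conjugate of f along the boundary of a slightly smaller sector. Rotating the
contours to the positive half line extends Cf to the original sector, with |Cf| ≤ 4. An extremal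
argument then bounds the constant by 4.

The functional calculus is used only for diagonalizable matrices. A is perturbed to such a matrix,
which requires a wider angle θ' > θ and a shift s < 1. The perturbation tends to zero first, for
fixed θ' and s; then θ' → θ and s → 1. -/

/-- A matrix of eigenvectors exhibits `A` as similar to a diagonal matrix. -/
def IsDiagonalizedBy {n : ℕ} (A P : Matrix (Fin n) (Fin n) ℂ) (d : Fin n → ℂ) : Prop :=
  IsUnit P.det ∧ A = P * Matrix.diagonal d * P⁻¹

theorem exists_isDiagonalizedBy_of_separable {n : ℕ} (A : Matrix (Fin n) (Fin n) ℂ)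
    (h : A.charpoly.Separable) : ∃ P d, IsDiagonalizedBy A P d := by
  have hcard : A.charpoly.roots.toFinset.card = n := by
    rw [Multiset.toFinset_card_of_nodup (nodup_roots h),
      splits_iff_card_roots.mp (IsAlgClosed.splits _), Matrix.charpoly_natDegree_eq_dim,
      Fintype.card_fin]
  let e : Fin n ≃ A.charpoly.roots.toFinset := (Fintype.equivFinOfCardEq (by simpa using hcard)).symm
  let d : Fin n → ℂ := fun i => e i
  have hd : Function.Injective d := Subtype.val_injective.comp e.injective
  have hev : ∀ i, Module.End.HasEigenvalue (Matrix.toLin' A) (d i) := fun i => by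
    have h1 : d i ∈ A.charpoly.roots := Multiset.mem_toFinset.mp (e i).2
    rw [Module.End.hasEigenvalue_iff_mem_spectrum, Matrix.spectrum_toLin',
      Matrix.mem_spectrum_iff_isRoot_charpoly]
    exact isRoot_of_mem_roots h1
  choose v hv using fun i => (hev i).exists_hasEigenvector
  have hli := Module.End.eigenvectors_linearIndependent' (Matrix.toLin' A) d hd v hv
  let P : Matrix (Fin n) (Fin n) ℂ := Matrix.of fun i j => v j i
  have hP : IsUnit P := by
    rw [← Matrix.linearIndependent_cols_iff_isUnit]
    exact hli
  have hPd : IsUnit P.det := (Matrix.isUnit_iff_isUnit_det P).mp hP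
  refine ⟨P, d, hPd, ?_⟩
  have hAP : A * P = P * Matrix.diagonal d := by
    ext i j
    have := congrFun (hv j).apply_eq_smul i
    rw [Matrix.mul_diagonal]
    simp only [Matrix.toLin'_apply, Pi.smul_apply, smul_eq_mul] at this
    rw [mul_comm (P i j)]
    exact this
  rw [← hAP, Matrix.mul_assoc, Matrix.mul_nonsing_inv _ hPd, Matrix.mul_one]

/-- Diagonalizable matrices are dense along suitable lines. -/
theorem exists_direction_diagonalizable {n : ℕ} (A : Matrix (Fin n) (Fin n) ℂ) :
    ∃ D : Matrix (Fin n) (Fin n) ℂ, ∀ᶠ t in 𝓝[≠] (0 : ℂ),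
      ∃ P d, IsDiagonalizedBy (A + t • D) P d := by
  let D₀ : Matrix (Fin n) (Fin n) ℂ := Matrix.diagonal fun i => ((i : ℕ) : ℂ)
  let B : Matrix (Fin n) (Fin n) ℂ[X] := A.map C + (X : ℂ[X]) • (D₀ - A).map C
  have hB : ∀ t : ℂ, (B.map (evalRingHom t)) = A + t • (D₀ - A) := fun t => by
    ext i j; simp [B]
  -- The degrees n and n - 1 are prescribed so that the resultant commutes with evaluation in t. Up
  -- to sign r(t) is the discriminant of the characteristic polynomial on the line from A at t = 0
  -- to diag(0, …, n - 1) at t = 1.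
  let r : ℂ[X] := resultant B.charpoly (derivative B.charpoly) n (n - 1)
  have hdeg : ∀ t : ℂ, r.eval t = resultant (A + t • (D₀ - A)).charpoly
      (derivative (A + t • (D₀ - A)).charpoly) := fun t => by
    have h1 : (A + t • (D₀ - A)).charpoly.natDegree = n := by
      rw [Matrix.charpoly_natDegree_eq_dim, Fintype.card_fin]
    rw [natDegree_derivative, h1, ← hB t, Matrix.charpoly_map, derivative_map, resultant_map_map]
    simp [r]
  have hsep : ∀ t : ℂ, r.eval t ≠ 0 → (A + t • (D₀ - A)).charpoly.Separable := fun t ht => by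
    rw [hdeg, Ne, resultant_eq_zero_iff] at ht
    have := (Matrix.charpoly_monic (A + t • (D₀ - A))).ne_zero
    rw [separable_def]
    tauto
  have hr1 : r.eval 1 ≠ 0 := by
    rw [hdeg, Ne, resultant_eq_zero_iff, not_and_not_right]
    intro _
    rw [← separable_def, one_smul, add_sub_cancel, Matrix.charpoly_diagonal, separable_prod_X_sub_C_iff]
    intro i j hij
    exact Fin.ext (by simpa using hij)
  have hr : r ≠ 0 := fun h => hr1 (by rw [h, eval_zero])
  refine ⟨D₀ - A, ?_⟩
  -- As r(1) ≠ 0, r has finitely many zeros. Possibly r(0) = 0, hence the punctured neighbourhood.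
  have hfin : ({x | r.IsRoot x}).Finite := Polynomial.finite_setOfPred_isRoot hr
  have : ∀ᶠ t in 𝓝[≠] (0 : ℂ), t ∉ {x | r.IsRoot x} := by
    have := hfin.isClosed.isOpen_compl
    have h2 := (hfin.sdiff (t := {0})).isClosed.isOpen_compl.mem_nhds
      (show (0:ℂ) ∈ ({x | r.IsRoot x} \ {0})ᶜ by simp)
    filter_upwards [mem_nhdsWithin_of_mem_nhds h2, self_mem_nhdsWithin] with t ht ht0 htr
    exact ht ⟨htr, ht0⟩
  filter_upwards [this] with t ht
  exact exists_isDiagonalizedBy_of_separable _ (hsep t ht)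

end RDArnoldi
end

/-! ### Identities for Laguerre polynomials. -/

noncomputable section
namespace RDArnoldi
open Finset

/-- The generalized Laguerre polynomial as a function of a complex variable. -/
def lag (n α : ℕ) (x : ℂ) : ℂ :=
  ∑ j ∈ range (n + 1), (-1) ^ j * ((n + α).choose (α + j) : ℂ) * (x ^ j / (j ! : ℂ))

theorem ofReal_laguerre (n α : ℕ) (x : ℝ) : ((laguerre n α x : ℝ) : ℂ) = lag n α x := by
  unfold laguerre lag
  push_cast
  refine sum_congr rfl fun j hj => ?_
  rw [← Nat.choose_symm_of_eq_add (show n + α = (n - j) + (α + j) by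
    have := mem_range.mp hj; omega)]

/-- With the binomial written as `(n + α).choose (α + j)` the terms with j > n vanish by themselves,
so sums of different lengths can be brought to a common range. -/
theorem lag_eq_sum_range {n α N : ℕ} (h : n + 1 ≤ N) (x : ℂ) :
    lag n α x = ∑ j ∈ range N, (-1) ^ j * ((n + α).choose (α + j) : ℂ) * (x ^ j / (j ! : ℂ)) := by
  refine sum_subset (range_subset_range.mpr h) fun j _ hj => ?_
  rw [Nat.choose_eq_zero_of_lt (by simp at hj; omega)]
  simp

theorem hasDerivAt_lag (n α : ℕ) (x : ℂ) :
    HasDerivAt (lag n α)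
      (∑ j ∈ range (n + 1), (-1) ^ j * ((n + α).choose (α + j) : ℂ) *
        (j * x ^ (j - 1) / (j ! : ℂ))) x := by
  unfold lag
  refine HasDerivAt.fun_sum fun j _ => ?_
  exact ((hasDerivAt_pow j x).div_const _).const_mul _

theorem lag_recurrence_coeff (n α j : ℕ) :
    ((n + α + 1 : ℂ) + j) * ((n + α).choose (α + j)) + (j : ℂ) * ((n + α).choose (α + j - 1)) =
      (n + 1) * ((n + 1 + α).choose (α + j)) := by
  have h1 : ((n + α + 1 : ℂ)) * ((n + α).choose (α + j)) =
      ((n : ℂ) + 1 - j) * ((n + 1 + α).choose (α + j)) := by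
    rcases le_or_gt (α + j) (n + α + 1) with h | h
    · have := Nat.choose_mul_succ_eq (n + α) (α + j)
      have h2 : ((n + α + 1 - (α + j) : ℕ) : ℂ) = (n : ℂ) + 1 - j := by
        push_cast [Nat.cast_sub h]; ring
      rw [← h2, show n + 1 + α = n + α + 1 by ring]
      have h3 : (((n + α).choose (α + j) * (n + α + 1) : ℕ) : ℂ) =
        ((n + α + 1).choose (α + j) * (n + α + 1 - (α + j)) : ℕ) := by rw [this]
      push_cast only [Nat.cast_mul] at h3
      rw [mul_comm _ ((n + α + 1 : ℕ) : ℂ), mul_comm _ ((n + α + 1 - (α + j) : ℕ) : ℂ)] at h3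
      rw [← h3]; push_cast; ring
    · rw [Nat.choose_eq_zero_of_lt (by omega), Nat.choose_eq_zero_of_lt (by omega)]; simp
  rcases Nat.eq_zero_or_pos j with rfl | hj
  · have := h1
    push_cast at this ⊢
    linear_combination this
  · have h4 : (n + 1 + α).choose (α + j) = (n + α).choose (α + j - 1) + (n + α).choose (α + j) := by
      have h5 := Nat.choose_succ_succ (n + α) (α + j - 1)
      rwa [show (n + α).succ = n + 1 + α by omega, show (α + j - 1).succ = α + j by omega] at h5
    have h5 : ((n + 1 + α).choose (α + j) : ℂ) = (n + α).choose (α + j - 1) + (n + α).choose (α + j) := by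
      rw [h4]; push_cast; rfl
    linear_combination h1 + (-j : ℂ) * h5

/-- Comparison of coefficients. This is the induction step of the Rodrigues formula: it raises n by
one under differentiation in `hasDerivAt_laguerre_exp_inv`. -/
theorem lag_recurrence (n α : ℕ) (x : ℂ) :
    (n + α + 1 - x) * lag n α x + x * deriv (lag n α) x = (n + 1) * lag (n + 1) α x := by
  rw [(hasDerivAt_lag n α x).deriv]
  have hx : x * lag n α x = ∑ j ∈ range (n + 2), -((-1) ^ j * (j : ℂ) *
      ((n + α).choose (α + j - 1)) * (x ^ j / (j ! : ℂ))) := by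
    rw [sum_range_succ', lag, mul_sum]
    simp only [Nat.cast_zero, mul_zero, zero_mul, neg_zero, add_zero]
    refine sum_congr rfl fun j _ => ?_
    rw [show α + (j + 1) - 1 = α + j by omega, Nat.factorial_succ]
    have := Nat.factorial_ne_zero j
    have h2 : (j : ℂ) + 1 ≠ 0 := by exact_mod_cast Nat.succ_ne_zero j
    push_cast
    field_simp
    ring
  have hd : x * (∑ j ∈ range (n + 1), (-1) ^ j * ((n + α).choose (α + j) : ℂ) *
        (j * x ^ (j - 1) / (j ! : ℂ))) = ∑ j ∈ range (n + 2),
        (-1) ^ j * (j * ((n + α).choose (α + j) : ℂ)) * (x ^ j / (j ! : ℂ)) := by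
    rw [sum_range_succ _ (n + 1), Nat.choose_eq_zero_of_lt (show n + α < α + (n + 1) by omega), mul_sum]
    simp only [Nat.cast_zero, mul_zero, zero_mul, add_zero]
    refine sum_congr rfl fun j _ => ?_
    rcases Nat.eq_zero_or_pos j with rfl | hj
    · simp
    · obtain ⟨i, rfl⟩ : ∃ i, j = i + 1 := ⟨j - 1, by omega⟩
      rw [Nat.add_sub_cancel]; ring
  rw [hd, sub_mul, hx, lag_eq_sum_range (N := n + 2) (by omega) x,
    lag_eq_sum_range (n := n + 1) (N := n + 2) le_rfl x, mul_sum, mul_sum, ← sum_sub_distrib,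
    ← sum_add_distrib]
  refine sum_congr rfl fun j _ => ?_
  linear_combination ((-1) ^ j * (x ^ j / (j ! : ℂ))) * lag_recurrence_coeff n α j

/-- Sort the (p + q + 1)-element subsets of an ordered set of N + 1 elements by the position i of
the element having p chosen ones before it and q after it. The formal proof is induction on N with
Pascal's rule. -/
theorem sum_antidiagonal_choose_mul_choose (N p q : ℕ) :
    ∑ ij ∈ antidiagonal N, ij.1.choose p * ij.2.choose q = (N + 1).choose (p + q + 1) := by
  induction N generalizing p with
  | zero => rcases p with _ | p <;> rcases q with _ | q <;> simp [Nat.choose_eq_zero_of_lt]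
  | succ N ih =>
    rw [Nat.antidiagonal_succ, sum_cons, sum_map]
    rcases p with _ | p
    · have := ih 0
      simp only [Nat.choose_zero_right, one_mul, zero_add, Function.Embedding.prodMap,
        Function.Embedding.coeFn_mk, Prod.map, Nat.choose_succ_succ (N + 1) q] at this ⊢
      simp [this]
    · simp only [Nat.choose_zero_succ, zero_mul, zero_add, Function.Embedding.prodMap,
        Function.Embedding.coeFn_mk, Prod.map, Nat.succ_eq_add_one, Nat.choose_succ_succ _ p,
        add_mul, sum_add_distrib, Function.Embedding.refl_apply]
      rw [ih p, ih (p + 1), show p + 1 + q + 1 = (p + q + 1) + 1 by ring, Nat.choose_succ_succ (N + 1)]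

theorem sum_range_choose_mul_choose (n k a b : ℕ) :
    ∑ j ∈ range (n + 1), (n - j + k).choose (k + a) * j.choose b =
      (n + k + 1).choose (k + a + b + 1) := by
  rw [← sum_antidiagonal_choose_mul_choose, ← Nat.sum_antidiagonal_swap,
    Nat.sum_antidiagonal_eq_sum_range_succ_mk]
  refine (sum_congr rfl fun j hj => ?_).trans
    (sum_subset (range_subset_range.mpr (show n + 1 ≤ (n + k).succ by omega)) fun j hj hj' => ?_)
  · simp only [mem_range] at hj
    simp only [Prod.swap, show n - j + k = n + k - j by omega]
  · simp only [mem_range] at hj hj'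
    simp only [Prod.swap]
    rw [Nat.choose_eq_zero_of_lt (by omega), zero_mul]

/-- Both sides are the sum of the monomials `t a b`. On the right the sum over j is the dual
Vandermonde identity; on the left the binomial theorem gives the same terms over a + b ≤ n, and the
binomial in `t` vanishes beyond that triangle. -/
theorem lag_add (n k : ℕ) (x y : ℂ) :
    lag n (k + 1) (x + y) = ∑ j ∈ range (n + 1), lag (n - j) k x * lag j 0 y := by
  let t : ℕ → ℕ → ℂ := fun a b => (-1) ^ (a + b) * ((n + k + 1).choose (k + a + b + 1) : ℂ) *
    (x ^ a / (a ! : ℂ)) * (y ^ b / (b ! : ℂ))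
  have hR : ∑ j ∈ range (n + 1), lag (n - j) k x * lag j 0 y =
      ∑ a ∈ range (n + 1), ∑ b ∈ range (n + 1), t a b := by
    have : ∀ j ∈ range (n + 1), lag (n - j) k x * lag j 0 y =
        ∑ a ∈ range (n + 1), ∑ b ∈ range (n + 1), ((-1) ^ (a + b) *
          (((n - j + k).choose (k + a) * j.choose b : ℕ) : ℂ)) *
          (x ^ a / (a ! : ℂ)) * (y ^ b / (b ! : ℂ)) := fun j hj => by
      simp only [mem_range] at hj
      rw [lag_eq_sum_range (N := n + 1) (by omega), lag_eq_sum_range (N := n + 1) (by omega),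
        sum_mul_sum]
      refine sum_congr rfl fun a _ => sum_congr rfl fun b _ => ?_
      push_cast
      simp only [zero_add, add_zero]
      ring
    rw [sum_congr rfl this, sum_comm]
    refine sum_congr rfl fun a _ => ?_
    rw [sum_comm]
    refine sum_congr rfl fun b _ => ?_
    rw [← sum_mul, ← sum_mul, ← mul_sum, ← Nat.cast_sum, sum_range_choose_mul_choose]
  have hL : lag n (k + 1) (x + y) = ∑ p ∈ range (n + 1), ∑ ab ∈ antidiagonal p, t ab.1 ab.2 := by
    unfold lag
    refine sum_congr rfl fun p _ => ?_
    rw [(Commute.all x y).add_pow', sum_div, mul_sum]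
    refine sum_congr rfl fun ab hab => ?_
    have hp := HasAntidiagonal.mem_antidiagonal.mp hab
    have h1 := Nat.add_choose_mul_factorial_mul_factorial ab.1 ab.2
    rw [hp, Nat.choose_symm_of_eq_add (by omega : p = ab.2 + ab.1)] at h1
    have h2 : ((p.choose ab.1 : ℕ) : ℂ) * (ab.1 ! : ℂ) * (ab.2 ! : ℂ) = (p ! : ℂ) := by
      exact_mod_cast h1
    have e1 := Nat.factorial_ne_zero ab.1
    have e2 := Nat.factorial_ne_zero ab.2
    have e3 := Nat.factorial_ne_zero p
    simp only [t, hp, nsmul_eq_mul, show n + (k + 1) = n + k + 1 by ring,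
      show k + ab.1 + ab.2 + 1 = k + 1 + p by omega]
    have h3 : ((p.choose ab.1 : ℕ) : ℂ) / (p ! : ℂ) = 1 / ((ab.1 ! : ℂ) * (ab.2 ! : ℂ)) := by
      have e1' : (ab.1 ! : ℂ) ≠ 0 := by exact_mod_cast e1
      have e2' : (ab.2 ! : ℂ) ≠ 0 := by exact_mod_cast e2
      have e3' : (p ! : ℂ) ≠ 0 := by exact_mod_cast e3
      rw [div_eq_div_iff e3' (mul_ne_zero e1' e2')]
      linear_combination h2
    calc _ = (-1) ^ p * ((n + k + 1).choose (k + 1 + p) : ℂ) * (x ^ ab.1 * y ^ ab.2) *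
          (((p.choose ab.1 : ℕ) : ℂ) / (p ! : ℂ)) := by ring
      _ = _ := by rw [h3]; ring
  rw [hL, hR, ← sum_product', sum_sigma']
  have hmap : ∑ s ∈ (range (n + 1)).sigma fun p => antidiagonal p, t s.2.1 s.2.2 =
      ∑ ab ∈ (range (n + 1) ×ˢ range (n + 1)).filter (fun ab => ab.1 + ab.2 < n + 1),
        t ab.1 ab.2 := by
    refine sum_bij' (fun s _ => s.2) (fun ab _ => ⟨ab.1 + ab.2, ab⟩) ?_ ?_ ?_ ?_ ?_
    · rintro ⟨p, a, b⟩ h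
      simp only [mem_sigma, mem_range, HasAntidiagonal.mem_antidiagonal, mem_filter, mem_product] at h ⊢
      omega
    · rintro ⟨a, b⟩ h
      simp only [mem_sigma, mem_range, HasAntidiagonal.mem_antidiagonal, mem_filter, mem_product] at h ⊢
      exact ⟨h.2, trivial⟩
    · rintro ⟨p, a, b⟩ h
      simp only [mem_sigma, mem_range, HasAntidiagonal.mem_antidiagonal] at h ⊢
      obtain ⟨_, rfl⟩ := h
      rfl
    · intros; rfl
    · intros; rfl
  rw [hmap, sum_filter]
  refine sum_congr rfl fun ab _ => ?_
  split_ifs with h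
  · rfl
  · simp only [t]
    rw [Nat.choose_eq_zero_of_lt (by omega)]
    simp

theorem lag_zero_right (j : ℕ) : lag j 0 0 = 1 := by
  unfold lag
  rw [sum_eq_single 0] <;> simp +contextual

theorem lag_succ_eq_sum (n k : ℕ) (x : ℂ) :
    lag n (k + 1) x = ∑ j ∈ range (n + 1), lag (n - j) k x := by
  rw [← add_zero x, lag_add]
  simp [lag_zero_right]

/-- The coefficient of x^j reduces to the binomial expansion of (c + (1 - c))^{n-j} after rewriting
C(n,i)C(i,j) = C(n,j)C(n-j,i-j). -/
theorem lag_mul (n : ℕ) (c x : ℂ) :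
    lag n 0 (c * x) =
      ∑ i ∈ range (n + 1), (n.choose i : ℂ) * c ^ i * (1 - c) ^ (n - i) * lag i 0 x := by
  have : ∀ i ∈ range (n + 1), (n.choose i : ℂ) * c ^ i * (1 - c) ^ (n - i) * lag i 0 x =
      ∑ j ∈ range (n + 1), ((n.choose i * i.choose j : ℕ) : ℂ) * c ^ i * (1 - c) ^ (n - i) *
        ((-1) ^ j * (x ^ j / (j ! : ℂ))) := fun i hi => by
    simp only [mem_range] at hi
    rw [lag_eq_sum_range (N := n + 1) (by omega), mul_sum]
    refine sum_congr rfl fun j _ => ?_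
    push_cast
    simp only [zero_add, add_zero]
    ring
  rw [sum_congr rfl this, sum_comm, lag]
  refine sum_congr rfl fun j hj => ?_
  simp only [mem_range] at hj
  rw [← sum_mul]
  have key : ∑ i ∈ range (n + 1), ((n.choose i * i.choose j : ℕ) : ℂ) * c ^ i * (1 - c) ^ (n - i) =
      (n.choose j : ℂ) * c ^ j := by
    rw [← sum_subset (s₁ := Ico j (n + 1)) (fun i => by simp) (fun i hi hi' => by
      simp only [mem_range, mem_Ico] at hi hi'
      rw [Nat.choose_eq_zero_of_lt (show i < j by omega)]; simp),
      sum_Ico_eq_sum_range]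
    have hb : (1 : ℂ) = ∑ i ∈ range (n - j + 1), c ^ i * (1 - c) ^ (n - j - i) *
        ((n - j).choose i : ℂ) := by
      rw [← add_pow]; simp
    rw [show n + 1 - j = n - j + 1 by omega]
    conv_rhs => rw [← mul_one (_ * _), hb, mul_sum]
    refine sum_congr rfl fun i hi => ?_
    simp only [mem_range] at hi
    rw [Nat.choose_mul (Nat.le_add_right j i), show j + i - j = i by omega,
      show n - (j + i) = n - j - i by omega, pow_add]
    push_cast
    ring
  rw [key]
  simp only [zero_add, add_zero]
  rw [mul_pow]
  ring

end RDArnoldi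
end

/-! ### Charlier polynomials and the bound |L_n(x)| ≤ e^{x/2}. -/

noncomputable section
namespace RDArnoldi
open Finset

/-- Sequences of at most exponential growth. -/
def ExpBounded (f : ℕ → ℝ) : Prop := ∃ C R : ℝ, 0 ≤ C ∧ 1 ≤ R ∧ ∀ m, |f m| ≤ C * R ^ m

/-- Multiplication by `m / x` after a shift: the adjoint of the forward shift with respect to the
Poisson weights `x ^ m / m !`. -/
def poissonShift (x : ℝ) : Module.End ℝ (ℕ → ℝ) where
  toFun g m := m / x * g (m - 1)
  map_add' f g := by ext m; simp [mul_add]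
  map_smul' c g := by ext m; simp; ring

/-- The Charlier polynomials, normalized by `charlier 0 = 1` and the raising operator. -/
def charlier (x : ℝ) (n : ℕ) : ℕ → ℝ := ((poissonShift x - 1) ^ n) fun _ => 1

theorem charlier_succ (x : ℝ) (n m : ℕ) :
    charlier x (n + 1) m = m / x * charlier x n (m - 1) - charlier x n m := by
  simp only [charlier, pow_succ', Module.End.mul_apply]
  rfl

namespace ExpBounded

theorem mul {f g : ℕ → ℝ} (hf : ExpBounded f) (hg : ExpBounded g) :
    ExpBounded fun m => f m * g m := by
  obtain ⟨C, R, hC, hR, h⟩ := hf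
  obtain ⟨C', R', hC', hR', h'⟩ := hg
  refine ⟨C * C', R * R', by positivity, one_le_mul_of_one_le_of_one_le hR hR', fun m => ?_⟩
  rw [abs_mul, mul_pow, mul_mul_mul_comm]
  exact mul_le_mul (h m) (h' m) (abs_nonneg _) (by positivity)

theorem sub {f g : ℕ → ℝ} (hf : ExpBounded f) (hg : ExpBounded g) :
    ExpBounded fun m => f m - g m := by
  obtain ⟨C, R, hC, hR, h⟩ := hf
  obtain ⟨C', R', hC', hR', h'⟩ := hg
  refine ⟨C + C', R * R', by positivity, one_le_mul_of_one_le_of_one_le hR hR', fun m => ?_⟩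
  refine (abs_sub _ _).trans ?_
  rw [add_mul, mul_pow]
  have h1 : (1:ℝ) ≤ R ^ m := one_le_pow₀ hR
  have h2 : (1:ℝ) ≤ R' ^ m := one_le_pow₀ hR'
  refine add_le_add ((h m).trans ?_) ((h' m).trans ?_)
  · exact mul_le_mul_of_nonneg_left (le_mul_of_one_le_right (by positivity) h2) hC
  · exact mul_le_mul_of_nonneg_left (le_mul_of_one_le_left (by positivity) h1) hC'

theorem shift {f : ℕ → ℝ} (hf : ExpBounded f) : ExpBounded fun m => f (m + 1) := by
  obtain ⟨C, R, hC, hR, h⟩ := hf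
  refine ⟨C * R, R, by positivity, hR, fun m => (h _).trans (le_of_eq ?_)⟩
  ring

theorem raise {f : ℕ → ℝ} {x : ℝ} (hx : 0 < x) (hf : ExpBounded f) :
    ExpBounded fun m => m / x * f (m - 1) := by
  obtain ⟨C, R, hC, hR, h⟩ := hf
  refine ⟨C / x, 2 * R, by positivity, by linarith, fun m => ?_⟩
  rw [abs_mul, abs_of_nonneg (by positivity : (0:ℝ) ≤ m / x), mul_pow]
  have h1 : (m : ℝ) ≤ 2 ^ m := by exact_mod_cast Nat.lt_two_pow_self.le
  have h2 : |f (m - 1)| ≤ C * R ^ m :=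
    (h _).trans (mul_le_mul_of_nonneg_left (pow_le_pow_right₀ hR (by omega)) hC)
  calc (m : ℝ) / x * |f (m - 1)| ≤ 2 ^ m / x * (C * R ^ m) := by gcongr
    _ = _ := by ring

theorem summable {f : ℕ → ℝ} {x : ℝ} (hx : 0 < x) (hf : ExpBounded f) :
    Summable fun m : ℕ => x ^ m / m ! * f m := by
  obtain ⟨C, R, hC, hR, h⟩ := hf
  refine Summable.of_norm_bounded (g := fun m : ℕ => C * ((x * R) ^ m / m !))
    ((Real.summable_pow_div_factorial _).mul_left C) fun m => ?_
  rw [Real.norm_eq_abs, abs_mul, abs_of_nonneg (by positivity : (0:ℝ) ≤ x ^ m / m !), mul_pow]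
  calc x ^ m / m ! * |f m| ≤ x ^ m / m ! * (C * R ^ m) := by gcongr; exact h m
    _ = _ := by ring

end ExpBounded

/-- Exponential growth is dominated by 1/m!, so every Poisson sum below converges. -/
theorem expBounded_charlier {x : ℝ} (hx : 0 < x) (n : ℕ) : ExpBounded (charlier x n) := by
  induction n with
  | zero => exact ⟨1, 1, by norm_num, le_rfl, fun m => by simp [charlier]⟩
  | succ n ih =>
    have := (ih.raise hx).sub ih
    simpa only [← charlier_succ] using this

/-- The lowering rule. With the raising operator adjoint to the forward difference, it yields the
norms by induction. -/
theorem charlier_forward_diff (x : ℝ) (n m : ℕ) :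
    charlier x (n + 1) (m + 1) - charlier x (n + 1) m = (n + 1) / x * charlier x n m := by
  induction n generalizing m with
  | zero =>
    rw [charlier_succ, charlier_succ]
    simp [charlier]
    ring
  | succ n ih =>
    rw [charlier_succ, charlier_succ x (n + 1) m]
    have h1 := ih m
    rcases m with _ | m
    · simp only [zero_add, Nat.sub_self, Nat.cast_zero, zero_div, zero_mul, zero_sub] at h1 ⊢
      push_cast
      have : charlier x (n + 1) 1 = (n + 1) / x * charlier x n 0 + charlier x (n + 1) 0 := by
        linear_combination h1
      have h3 := charlier_succ x n 0
      simp only [Nat.cast_zero, zero_div, zero_mul, zero_sub] at h3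
      rw [this, h3]; ring
    · have h2 := ih m
      have h3 := charlier_succ x n (m + 1)
      simp only [Nat.add_sub_cancel] at h1 h2 h3 ⊢
      push_cast at h1 h2 h3 ⊢
      linear_combination (-1 : ℝ) * h1 + ((m : ℝ) + 1) / x * h2 + (-(n + 1 : ℝ) / x) * h3

/-- Summation by parts: shift the index in the first sum. The boundary term m = 0 carries the factor
m/x = 0, so the truncated value of m - 1 there is harmless. -/
theorem tsum_raise_mul {x : ℝ} (hx : 0 < x) {g h : ℕ → ℝ} (hg : ExpBounded g) (hh : ExpBounded h) :
    ∑' m : ℕ, x ^ m / m ! * ((m / x * g (m - 1) - g m) * h m) =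
      ∑' m : ℕ, x ^ m / m ! * (g m * (h (m + 1) - h m)) := by
  have e1 : ∑' m : ℕ, x ^ m / m ! * ((m / x * g (m - 1)) * h m) =
      ∑' m : ℕ, x ^ m / m ! * (g m * h (m + 1)) := by
    rw [(((hg.raise hx).mul hh).summable hx).tsum_eq_zero_add]
    simp only [Nat.cast_zero, zero_div, zero_mul, mul_zero, zero_add, Nat.add_sub_cancel]
    refine tsum_congr fun m => ?_
    rw [Nat.factorial_succ]
    push_cast
    field_simp
    ring
  simp only [sub_mul, mul_sub]
  rw [(((hg.raise hx).mul hh).summable hx).tsum_sub ((hg.mul hh).summable hx),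
    ((hg.mul hh.shift).summable hx).tsum_sub ((hg.mul hh).summable hx), e1]

theorem tsum_charlier_sq {x : ℝ} (hx : 0 < x) (n : ℕ) :
    ∑' m : ℕ, x ^ m / m ! * (charlier x n m * charlier x n m) = n ! / x ^ n * Real.exp x := by
  induction n with
  | zero =>
    simp [charlier, Real.exp_eq_exp_ℝ, NormedSpace.exp_eq_tsum_div]
  | succ n ih =>
    have h1 : ∑' m : ℕ, x ^ m / m ! * (charlier x (n + 1) m * charlier x (n + 1) m) =
        ∑' m : ℕ, x ^ m / m ! *
          ((m / x * charlier x n (m - 1) - charlier x n m) * charlier x (n + 1) m) :=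
      tsum_congr fun m => by rw [← charlier_succ]
    rw [h1, tsum_raise_mul hx (expBounded_charlier hx n) (expBounded_charlier hx (n + 1))]
    have h2 : ∀ m : ℕ, x ^ m / m ! * (charlier x n m *
        (charlier x (n + 1) (m + 1) - charlier x (n + 1) m)) =
        (n + 1) / x * (x ^ m / m ! * (charlier x n m * charlier x n m)) := fun m => by
      rw [charlier_forward_diff]; ring
    rw [tsum_congr h2, tsum_mul_left, ih, Nat.factorial_succ]
    push_cast
    field_simp
    ring

theorem poissonShift_pow_one (x : ℝ) (k m : ℕ) :
    ((poissonShift x ^ k) fun _ => 1) m = (m.descFactorial k : ℝ) / x ^ k := by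
  induction k generalizing m with
  | zero => simp
  | succ k ih =>
    rw [pow_succ', Module.End.mul_apply]
    change (m : ℝ) / x * _ = _
    rw [ih]
    rcases m with _ | m
    · simp
    · rw [Nat.succ_descFactorial_succ, Nat.add_sub_cancel]
      push_cast
      ring

/-- Applied to `poissonShift x`, it turns the operator definition of `charlier` into an explicit
finite sum. -/
theorem sub_one_pow_eq_sum {R : Type*} [Ring R] [Algebra ℝ R] (T : R) (n : ℕ) :
    (T - 1) ^ n = ∑ k ∈ range (n + 1), ((n.choose k : ℝ) * (-1) ^ (n - k)) • T ^ k := by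
  rw [sub_eq_add_neg, (Commute.neg_one_right T).add_pow]
  refine sum_congr rfl fun k _ => ?_
  rw [Algebra.smul_def, mul_assoc, Algebra.commutes]
  congr 1
  rw [← map_natCast (algebraMap ℝ R), ← map_one (algebraMap ℝ R), ← map_neg, ← map_pow, ← map_mul,
    mul_comm]

theorem charlier_diagonal {x : ℝ} (hx : 0 < x) (n : ℕ) :
    charlier x n n = n ! / x ^ n * laguerre n 0 x := by
  have h1 : charlier x n n = ∑ k ∈ range (n + 1),
      (n.choose k : ℝ) * (-1) ^ (n - k) * ((n.descFactorial k : ℝ) / x ^ k) := by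
    rw [charlier, show (poissonShift x - 1) ^ n = _ from sub_one_pow_eq_sum _ n]
    simp only [LinearMap.sum_apply, Finset.sum_apply]
    refine sum_congr rfl fun k _ => ?_
    rw [LinearMap.smul_apply, Pi.smul_apply, poissonShift_pow_one, smul_eq_mul]
  rw [h1, ← sum_range_reflect, laguerre, mul_sum]
  refine sum_congr rfl fun j hj => ?_
  simp only [mem_range] at hj
  have hj' : j ≤ n := by omega
  rw [show n + 1 - 1 - j = n - j by omega, Nat.sub_sub_self hj', Nat.add_zero]
  have h2 : (n.descFactorial (n - j) : ℝ) = n ! / j ! := by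
    rw [eq_div_iff (by positivity)]
    have := Nat.factorial_mul_descFactorial (Nat.sub_le n j)
    rw [Nat.sub_sub_self hj'] at this
    rw [mul_comm]; exact_mod_cast this
  have h5 : x ^ n = x ^ (n - j) * x ^ j := by rw [← pow_add, Nat.sub_add_cancel hj']
  rw [h2, h5, Nat.choose_symm hj']
  field_simp

/-- The Poisson-weighted sum of squares of C_n equals (n!/xⁿ)eˣ. Retaining only m = n, where C_n(n)
= (n!/xⁿ)L_n(x), leaves L_n(x)² ≤ eˣ. -/
theorem abs_laguerre_zero_le {x : ℝ} (hx : 0 < x) (n : ℕ) :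
    |laguerre n 0 x| ≤ Real.exp (x / 2) := by
  have h1 : x ^ n / n ! * (charlier x n n * charlier x n n) ≤ n ! / x ^ n * Real.exp x := by
    rw [← tsum_charlier_sq hx n]
    refine (((expBounded_charlier hx n).mul (expBounded_charlier hx n)).summable hx).le_tsum n
      fun m _ => mul_nonneg (by positivity) (mul_self_nonneg _)
  rw [charlier_diagonal hx] at h1
  have h2 : x ^ n / n ! * (n ! / x ^ n * laguerre n 0 x * (n ! / x ^ n * laguerre n 0 x)) =
      n ! / x ^ n * laguerre n 0 x ^ 2 := by
    field_simp
  rw [h2, mul_le_mul_iff_right₀ (by positivity)] at h1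
  refine abs_le_of_sq_le_sq ?_ (by positivity)
  rwa [← Real.exp_nat_mul, show ((2 : ℕ) : ℝ) * (x / 2) = x by push_cast; ring]

theorem abs_laguerre_le {x : ℝ} (hx : 0 < x) (n k : ℕ) :
    |laguerre n k x| ≤ ((n + k).choose k : ℝ) * Real.exp (x / 2) := by
  induction k generalizing n with
  | zero => simpa using abs_laguerre_zero_le hx n
  | succ k ih =>
    have h1 : laguerre n (k + 1) x = ∑ j ∈ range (n + 1), laguerre (n - j) k x := by
      have := lag_succ_eq_sum n k x
      simp only [← ofReal_laguerre] at this
      exact_mod_cast this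
    rw [h1]
    refine (abs_sum_le_sum_abs _ _).trans ((sum_le_sum fun j _ => ih (n - j)).trans (le_of_eq ?_))
    rw [← sum_mul]
    congr 1
    have := sum_range_choose_mul_choose n k 0 0
    simp only [Nat.choose_zero_right, mul_one, add_zero] at this
    rw [show n + (k + 1) = n + k + 1 by ring]
    exact_mod_cast this

/-- The multiplication theorem reduces L_n(cr) to values L_i(r) at a positive argument; for |c| = 1
the binomial weights add up to (1 + |1 - c|)ⁿ. This is the source of the coefficients c_j(θ). -/
theorem norm_lag_zero_le {r : ℝ} (hr : 0 < r) (n : ℕ) {c : ℂ} (hc : ‖c‖ = 1) :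
    ‖lag n 0 (c * r)‖ ≤ (1 + ‖1 - c‖) ^ n * Real.exp (r / 2) := by
  rw [lag_mul, add_pow, sum_mul]
  refine (norm_sum_le _ _).trans (sum_le_sum fun i _ => ?_)
  rw [norm_mul, norm_mul, norm_mul, norm_pow, norm_pow, hc, one_pow, Complex.norm_natCast,
    ← ofReal_laguerre, Complex.norm_real, Real.norm_eq_abs, mul_one, one_mul,
    mul_comm ((n.choose i : ℕ) : ℝ)]
  exact mul_le_mul_of_nonneg_left (abs_laguerre_zero_le hr i) (by positivity)

end RDArnoldi
end

/-! ### Hermite interpolation remainders and a Rodrigues formula. -/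

noncomputable section
namespace RDArnoldi
open Polynomial Set

/-- The monic polynomial with the given roots. -/
def nodal (s : Multiset ℂ) : ℂ[X] := (s.map fun a => X - C a).prod

theorem nodal_cons (a : ℂ) (s : Multiset ℂ) : nodal (a ::ₘ s) = (X - C a) * nodal s := by
  simp [nodal]

theorem nodal_add (s t : Multiset ℂ) : nodal (s + t) = nodal s * nodal t := by
  simp [nodal]

theorem degree_nodal (s : Multiset ℂ) : (nodal s).degree = s.card := by
  rw [nodal, degree_multiset_prod]
  simp

/-- Newton's scheme: each node replaces g by its divided slope `dslope g a`, which remains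
holomorphic, also at repeated nodes. -/
theorem exists_newton_interpolation {U : Set ℂ} (hU : IsOpen U) {f : ℂ → ℂ}
    (hf : DifferentiableOn ℂ f U) (s : Multiset ℂ) (hs : ∀ a ∈ s, a ∈ U) :
    ∃ (R : ℂ[X]) (g : ℂ → ℂ), R.degree < s.card ∧ DifferentiableOn ℂ g U ∧
      ∀ z, f z = R.eval z + (nodal s).eval z * g z := by
  induction s using Multiset.induction with
  | empty => exact ⟨0, f, by simp, hf, fun z => by simp [nodal]⟩
  | cons a s ih =>
    obtain ⟨R, g, hR, hg, h⟩ := ih fun b hb => hs b (Multiset.mem_cons_of_mem hb)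
    refine ⟨R + nodal s * C (g a), dslope g a, ?_, ?_, fun z => ?_⟩
    · rw [Multiset.card_cons]
      refine (degree_add_le _ _).trans_lt (max_lt (hR.trans (by exact_mod_cast Nat.lt_succ_self _)) ?_)
      refine (degree_mul_le _ _).trans_lt ?_
      rw [degree_nodal]
      refine (add_le_add_right degree_C_le _).trans_lt ?_
      rw [add_zero]; exact_mod_cast Nat.lt_succ_self _
    · exact (Complex.differentiableOn_dslope (hU.mem_nhds (hs a (Multiset.mem_cons_self a s)))).mpr hg
    · have := sub_smul_dslope g a z
      rw [smul_eq_mul] at this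
      rw [h z, nodal_cons]
      simp only [eval_add, eval_mul, eval_sub, eval_X, eval_C]
      linear_combination (-(nodal s).eval z) * this

theorem differentiableOn_iterate_deriv {U : Set ℂ} (hU : IsOpen U) {f : ℂ → ℂ}
    (hf : DifferentiableOn ℂ f U) (n : ℕ) : DifferentiableOn ℂ (deriv^[n] f) U := by
  induction n with
  | zero => exact hf
  | succ n ih => rw [Function.iterate_succ_apply']; exact ih.deriv hU

theorem eqOn_iterate_deriv {U : Set ℂ} (hU : IsOpen U) {f g : ℂ → ℂ} (h : EqOn f g U) (n : ℕ) :
    EqOn (deriv^[n] f) (deriv^[n] g) U := by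
  induction n with
  | zero => exact h
  | succ n ih =>
    intro z hz
    rw [Function.iterate_succ_apply', Function.iterate_succ_apply']
    exact (ih.eventuallyEq_of_mem (hU.mem_nhds hz)).deriv_eq

/-- Leibniz's rule for a linear factor; only two terms survive. -/
theorem iterate_deriv_const_add_linear_mul {U : Set ℂ} (hU : IsOpen U) {f : ℂ → ℂ}
    (hf : DifferentiableOn ℂ f U) (a c : ℂ) (n : ℕ) :
    EqOn (deriv^[n + 1] fun z => c + (z - a) * f z)
      (fun z => (z - a) * deriv^[n + 1] f z + (n + 1) * deriv^[n] f z) U := by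
  have hd : ∀ n, ∀ z ∈ U, HasDerivAt (deriv^[n] f) (deriv^[n + 1] f z) z := fun n z hz => by
    rw [Function.iterate_succ_apply']
    exact ((differentiableOn_iterate_deriv hU hf n).differentiableAt (hU.mem_nhds hz)).hasDerivAt
  induction n with
  | zero =>
    intro z hz
    have := (((hasDerivAt_id z).sub_const a).mul (hd 0 z hz)).const_add c
    rw [zero_add, Function.iterate_one]
    refine this.deriv.trans ?_
    simp; ring
  | succ n ih =>
    intro z hz
    rw [Function.iterate_succ_apply', (ih.eventuallyEq_of_mem (hU.mem_nhds hz)).deriv_eq]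
    have := (((hasDerivAt_id z).sub_const a).mul (hd (n + 1) z hz)).add
      ((hd n z hz).const_mul ((n : ℂ) + 1))
    refine this.deriv.trans ?_
    simp; ring

/-- Along the segment from a to z, the derivative of t^{n+1} f(a + t(z - a)) is t^n times the
bounded expression; integrate from 0 to 1. -/
theorem norm_le_of_norm_euler_le {U : Set ℂ} (hU : IsOpen U) (hc : Convex ℝ U) {f : ℂ → ℂ}
    (hf : DifferentiableOn ℂ f U) {a : ℂ} (ha : a ∈ U) {M : ℝ} (n : ℕ)
    (h : ∀ z ∈ U, ‖(z - a) * deriv f z + (n + 1) * f z‖ ≤ (n + 1) * M) :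
    ∀ z ∈ U, ‖f z‖ ≤ M := by
  intro z hz
  have hmem : ∀ t ∈ Icc (0 : ℝ) 1, a + t * (z - a) ∈ U := fun t ht => by
    have := hc.add_smul_sub_mem ha hz ht
    simpa using this
  let u : ℝ → ℂ := fun t => (t : ℂ) ^ (n + 1) * f (a + t * (z - a))
  have hu : ∀ t ∈ Icc (0 : ℝ) 1, HasDerivAt u ((t : ℂ) ^ n * ((a + t * (z - a) - a) *
      deriv f (a + t * (z - a)) + (n + 1) * f (a + t * (z - a)))) t := fun t ht => by
    have h1 := (hf.differentiableAt (hU.mem_nhds (hmem t ht))).hasDerivAt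
    have h2 : HasDerivAt (fun t : ℝ => a + (t : ℂ) * (z - a)) (1 * (z - a)) t :=
      ((Complex.ofRealCLM.hasDerivAt (x := t)).mul_const (z - a)).const_add a
    have h3 := h1.comp t h2
    have h4 : HasDerivAt (fun t : ℝ => (t : ℂ) ^ (n + 1)) (((n + 1 : ℕ) : ℂ) * (t : ℂ) ^ n * 1) t :=
      (Complex.ofRealCLM.hasDerivAt (x := t)).pow (n + 1)
    refine (h4.mul h3).congr_deriv ?_
    simp only [Function.comp_apply]
    push_cast; ring
  have hb := image_norm_le_of_norm_deriv_right_le_deriv_boundary (f := u) (a := 0) (b := 1)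
    (f' := fun t => ((t : ℂ) ^ n * ((a + t * (z - a) - a) *
      deriv f (a + t * (z - a)) + (n + 1) * f (a + t * (z - a)))))
    (B := fun t => M * t ^ (n + 1)) (B' := fun t => M * ((n + 1 : ℕ) * t ^ n))
    (fun t ht => (hu t ht).continuousAt.continuousWithinAt)
    (fun t ht => (hu t ⟨ht.1, ht.2.le⟩).hasDerivWithinAt) (by simp [u])
    (fun t => by simpa using (hasDerivAt_pow (n + 1) t).const_mul M)
    (fun t ht => by
      rw [norm_mul, norm_pow, Complex.norm_real, Real.norm_of_nonneg ht.1]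
      have := h _ (hmem t ⟨ht.1, ht.2.le⟩)
      calc t ^ n * _ ≤ t ^ n * ((n + 1) * M) := by gcongr; exact pow_nonneg ht.1 _
        _ = _ := by push_cast; ring) (right_mem_Icc.mpr zero_le_one)
  simpa [u] using hb

/-- The error term in Hermite interpolation is bounded by the highest derivative. -/
theorem norm_interpolation_error_le {U : Set ℂ} (hU : IsOpen U) (hc : Convex ℝ U) {g : ℂ → ℂ}
    (hg : DifferentiableOn ℂ g U) (s : Multiset ℂ) (hs : ∀ a ∈ s, a ∈ U) (R : ℂ[X])
    (hR : R.degree < s.card) {M : ℝ}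
    (hM : ∀ z ∈ U, ‖deriv^[s.card] (fun z => R.eval z + (nodal s).eval z * g z) z‖ ≤ s.card ! * M) :
    ∀ z ∈ U, ‖g z‖ ≤ M := by
  induction s using Multiset.induction generalizing R with
  | empty =>
    have : R = 0 := by simpa using hR
    subst this
    simpa [nodal] using hM
  | cons a s ih =>
    rw [Multiset.card_cons] at hM hR
    have ha := hs a (Multiset.mem_cons_self a s)
    have hR' : R = C (R.eval a) + (X - C a) * (R /ₘ (X - C a)) := by
      rw [← modByMonic_X_sub_C_eq_C_eval, modByMonic_add_div]
    let F : ℂ → ℂ := fun z => (R /ₘ (X - C a)).eval z + (nodal s).eval z * g z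
    have hF : DifferentiableOn ℂ F U :=
      (Polynomial.differentiable _).differentiableOn.add
        ((Polynomial.differentiable _).differentiableOn.mul hg)
    have hfun : (fun z => R.eval z + (nodal (a ::ₘ s)).eval z * g z) =
        fun z => R.eval a + (z - a) * F z := by
      funext z
      conv_lhs => rw [hR']
      simp only [F, nodal_cons, eval_add, eval_mul, eval_sub, eval_X, eval_C]
      ring
    refine ih (fun b hb => hs b (Multiset.mem_cons_of_mem hb)) (R /ₘ (X - C a)) ?_ ?_
    · rcases eq_or_ne (R /ₘ (X - C a)) 0 with h0 | h0
      · rw [h0, degree_zero]; exact WithBot.bot_lt_coe _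
      · have h1 : (X - C a).degree ≤ R.degree := by
          by_contra! hlt
          exact h0 ((divByMonic_eq_zero_iff (monic_X_sub_C a)).mpr hlt)
        have h2 := degree_add_divByMonic (monic_X_sub_C a) h1
        rw [degree_X_sub_C, degree_eq_natDegree h0] at h2
        rw [← h2] at hR
        rw [degree_eq_natDegree h0]
        norm_cast at hR ⊢
        omega
    -- F has one node fewer. Leibniz's rule turns the bound for the derivative of order n + 1 of
    -- f(a) + (z - a)F into the hypothesis of `norm_le_of_norm_euler_le` for the n-th derivative of
    -- F, and (n + 1)! = (n + 1) n! supplies the right constant.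
    · have hH := differentiableOn_iterate_deriv hU hF s.card
      refine norm_le_of_norm_euler_le hU hc hH ha s.card fun z hz => ?_
      have := hM z hz
      rw [hfun, iterate_deriv_const_add_linear_mul hU hF a _ _ hz, Function.iterate_succ_apply',
        Nat.factorial_succ] at this
      push_cast at this
      rwa [mul_assoc] at this

/-- `z ^ k e^{τ (1 - 1 / z)}`. -/
def expInv (k : ℕ) (τ : ℝ) (z : ℂ) : ℂ := z ^ k * Complex.exp (τ * (1 - z⁻¹))

theorem hasDerivAt_exp_inv (τ : ℝ) {z : ℂ} (hz : z ≠ 0) :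
    HasDerivAt (fun z : ℂ => Complex.exp (τ * (1 - z⁻¹)))
      (τ * z⁻¹ ^ 2 * Complex.exp (τ * (1 - z⁻¹))) z := by
  have := (((hasDerivAt_inv hz).const_sub 1).const_mul (τ : ℂ)).cexp
  refine this.congr_deriv ?_
  rw [inv_pow]; ring

theorem hasDerivAt_inv_pow (n : ℕ) {z : ℂ} (hz : z ≠ 0) :
    HasDerivAt (fun z : ℂ => z⁻¹ ^ n) (-(n : ℂ) * z⁻¹ ^ (n + 1)) z := by
  have := (hasDerivAt_inv hz).pow n
  refine this.congr_deriv ?_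
  rcases n with _ | n
  · simp
  · rw [Nat.add_sub_cancel, ← inv_pow]; ring

theorem iterate_deriv_expInv_succ (k : ℕ) (τ : ℝ) :
    EqOn (deriv^[k + 1] (expInv k τ))
      (fun z => (τ : ℂ) ^ (k + 1) * (z⁻¹ ^ (k + 2) * Complex.exp (τ * (1 - z⁻¹)))) {0}ᶜ := by
  have hU : IsOpen ({0}ᶜ : Set ℂ) := isOpen_compl_singleton
  induction k with
  | zero =>
    intro z hz
    have : expInv 0 τ = fun z => Complex.exp (τ * (1 - z⁻¹)) := by funext z; simp [expInv]
    simp only [zero_add, Function.iterate_one, this, (hasDerivAt_exp_inv τ hz).deriv]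
    ring
  | succ k ih =>
    -- Writing z^{k+1}e^{…} as z times the previous function lets Leibniz's rule express the next
    -- derivative through the one already known.
    have h1 : expInv (k + 1) τ = fun z => 0 + (z - 0) * expInv k τ z := by
      funext z; simp only [expInv]; ring
    have hd : DifferentiableOn ℂ (expInv k τ) {0}ᶜ := fun z hz =>
      ((differentiableAt_id.pow k).mul (hasDerivAt_exp_inv τ hz).differentiableAt).differentiableWithinAt
    intro z hz
    have hz0 : z ≠ 0 := hz
    rw [h1, iterate_deriv_const_add_linear_mul hU hd 0 0 (k + 1) hz]
    dsimp only
    rw [Function.iterate_succ_apply', (ih.eventuallyEq_of_mem (hU.mem_nhds hz)).deriv_eq]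
    have h2 : HasDerivAt (fun z => (τ : ℂ) ^ (k + 1) * (z⁻¹ ^ (k + 2) * Complex.exp (τ * (1 - z⁻¹))))
      _ z := ((hasDerivAt_inv_pow (k + 2) hz0).mul (hasDerivAt_exp_inv τ hz0)).const_mul _
    rw [ih hz, h2.deriv]
    have hzw : z * z⁻¹ = 1 := mul_inv_cancel₀ hz0
    push_cast
    linear_combination (τ : ℂ) ^ (k + 1) * Complex.exp (τ * (1 - z⁻¹)) *
      (-(k + 2 : ℂ) * z⁻¹ ^ (k + 2) + τ * z⁻¹ ^ (k + 3)) * hzw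

theorem hasDerivAt_laguerre_exp_inv (n k : ℕ) (τ : ℝ) {z : ℂ} (hz : z ≠ 0) :
    HasDerivAt (fun z : ℂ => z⁻¹ ^ (n + k + 2) *
        (lag n (k + 1) (τ * z⁻¹) * Complex.exp (τ * (1 - z⁻¹))))
      (-(n + 1 : ℂ) * (z⁻¹ ^ (n + 1 + k + 2) *
        (lag (n + 1) (k + 1) (τ * z⁻¹) * Complex.exp (τ * (1 - z⁻¹))))) z := by
  have h1 : HasDerivAt (fun z : ℂ => lag n (k + 1) (τ * z⁻¹))
      (deriv (lag n (k + 1)) (τ * z⁻¹) * (τ * (-(z ^ 2)⁻¹))) z :=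
    HasDerivAt.comp z (hasDerivAt_lag n (k + 1) _).differentiableAt.hasDerivAt
      ((hasDerivAt_inv hz).const_mul (τ : ℂ))
  have := (hasDerivAt_inv_pow (n + k + 2) hz).mul (h1.mul (hasDerivAt_exp_inv τ hz))
  refine this.congr_deriv ?_
  have h2 := lag_recurrence n (k + 1) (τ * z⁻¹)
  push_cast at h2 ⊢
  rw [← inv_pow]
  simp only [Pi.mul_apply]
  linear_combination (-(z⁻¹ ^ (n + k + 3) * Complex.exp (τ * (1 - z⁻¹)))) * h2

/-- The first k + 1 derivatives remove the factor z^k; each further one raises the degree of the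
Laguerre polynomial by one. -/
theorem iterate_deriv_expInv (n k : ℕ) (τ : ℝ) :
    EqOn (deriv^[n + (k + 1)] (expInv k τ))
      (fun z => (τ : ℂ) ^ (k + 1) * (-1) ^ n * n ! * (z⁻¹ ^ (n + k + 2) *
        (lag n (k + 1) (τ * z⁻¹) * Complex.exp (τ * (1 - z⁻¹))))) {0}ᶜ := by
  have hU : IsOpen ({0}ᶜ : Set ℂ) := isOpen_compl_singleton
  induction n with
  | zero =>
    intro z hz
    rw [zero_add, iterate_deriv_expInv_succ k τ hz]
    simp [lag]
  | succ n ih =>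
    intro z hz
    rw [show n + 1 + (k + 1) = (n + (k + 1)) + 1 by ring, Function.iterate_succ_apply',
      (ih.eventuallyEq_of_mem (hU.mem_nhds hz)).deriv_eq,
      ((hasDerivAt_laguerre_exp_inv n k τ hz).const_mul _).deriv, Nat.factorial_succ]
    push_cast
    ring

end RDArnoldi
end

/-! ### Sectors, lenses and the bound for divided differences. -/

noncomputable section
namespace RDArnoldi
open Polynomial Set

/-- The open sector of semiangle `θ` around the positive real axis. -/
def wedge (θ : ℝ) : Set ℂ := {u | |u.im| * Real.cos θ < u.re * Real.sin θ}

/-- The image of `s + wedge θ` under inversion: the intersection of two discs. -/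
def lens (s θ : ℝ) : Set ℂ :=
  {z | |z.im| * Real.cos θ < (z.re - s * (z.re ^ 2 + z.im ^ 2)) * Real.sin θ}

theorem isOpen_wedge (θ : ℝ) : IsOpen (wedge θ) :=
  isOpen_lt (by fun_prop) (by fun_prop)

theorem isOpen_lens (s θ : ℝ) : IsOpen (lens s θ) :=
  isOpen_lt (by fun_prop) (by fun_prop)

/-- |Im z| and |z|² are convex functions of z. Convexity is what permits the segment argument for
the interpolation remainder. -/
theorem convex_lens {s θ : ℝ} (hs : 0 ≤ s) (hc : 0 ≤ Real.cos θ) (hsin : 0 ≤ Real.sin θ) :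
    Convex ℝ (lens s θ) := by
  intro x hx y hy a b ha hb hab
  simp only [lens, mem_ofPred_eq, Complex.add_im, Complex.add_re, Complex.real_smul,
    Complex.mul_re, Complex.mul_im, Complex.ofReal_re, Complex.ofReal_im, zero_mul, sub_zero,
    add_zero] at hx hy ⊢
  have h1 : |a * x.im + b * y.im| ≤ a * |x.im| + b * |y.im| := by
    refine (abs_add_le _ _).trans (le_of_eq ?_)
    rw [abs_mul, abs_mul, abs_of_nonneg ha, abs_of_nonneg hb]
  have h2 : (a * x.re + b * y.re) ^ 2 + (a * x.im + b * y.im) ^ 2 ≤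
      a * (x.re ^ 2 + x.im ^ 2) + b * (y.re ^ 2 + y.im ^ 2) := by
    have hb' : b = 1 - a := by linarith
    subst hb'
    nlinarith [mul_nonneg (mul_nonneg ha hb) (sq_nonneg (x.re - y.re)),
      mul_nonneg (mul_nonneg ha hb) (sq_nonneg (x.im - y.im))]
  have h3 : a * (|x.im| * Real.cos θ) + b * (|y.im| * Real.cos θ) <
      a * ((x.re - s * (x.re ^ 2 + x.im ^ 2)) * Real.sin θ) +
      b * ((y.re - s * (y.re ^ 2 + y.im ^ 2)) * Real.sin θ) := by
    rcases ha.eq_or_lt with rfl | ha'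
    · have : b = 1 := by linarith
      subst this; simpa using hy
    · exact add_lt_add_of_lt_of_le (mul_lt_mul_of_pos_left hx ha')
        (mul_le_mul_of_nonneg_left hy.le hb)
  have h4 := mul_le_mul_of_nonneg_right h1 hc
  have h5 := mul_le_mul_of_nonneg_right (mul_le_mul_of_nonneg_left h2 hs) hsin
  linarith

theorem zero_notMem_lens (s θ : ℝ) : (0 : ℂ) ∉ lens s θ := by simp [lens]

theorem ne_zero_of_mem_lens {s θ : ℝ} {z : ℂ} (hz : z ∈ lens s θ) : z ≠ 0 := by
  rintro rfl; exact zero_notMem_lens s θ hz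

theorem inv_mem_lens_iff {s θ : ℝ} {w : ℂ} (hw : w ≠ 0) : w⁻¹ ∈ lens s θ ↔ w - s ∈ wedge θ := by
  have h : 0 < Complex.normSq w := Complex.normSq_pos.mpr hw
  have hn : w.re ^ 2 + w.im ^ 2 = Complex.normSq w := by rw [Complex.normSq_apply]; ring
  simp only [lens, wedge, mem_ofPred_eq, Complex.inv_re, Complex.inv_im, Complex.sub_re,
    Complex.sub_im, Complex.ofReal_re, Complex.ofReal_im, sub_zero, abs_div, abs_neg, abs_of_pos h]
  rw [show (w.re / Complex.normSq w) ^ 2 + (-w.im / Complex.normSq w) ^ 2 =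
    (w.re ^ 2 + w.im ^ 2) / Complex.normSq w ^ 2 by ring, hn]
  rw [show |w.im| / Complex.normSq w * Real.cos θ = |w.im| * Real.cos θ / Complex.normSq w by ring,
    show (w.re / Complex.normSq w - s * (Complex.normSq w / Complex.normSq w ^ 2)) * Real.sin θ =
      (w.re - s) * Real.sin θ / Complex.normSq w by field_simp]
  exact div_lt_div_iff_of_pos_right h

theorem re_pos_of_mem_wedge {θ : ℝ} (hc : 0 ≤ Real.cos θ) (hsin : 0 ≤ Real.sin θ) {u : ℂ}
    (hu : u ∈ wedge θ) : 0 < u.re := by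
  have h1 : 0 < u.re * Real.sin θ := (by positivity : 0 ≤ |u.im| * Real.cos θ).trans_lt hu
  exact pos_of_mul_pos_left h1 hsin

theorem norm_mul_cos_lt_re {θ : ℝ} (hc : 0 ≤ Real.cos θ) (hsin : 0 ≤ Real.sin θ) {u : ℂ}
    (hu : u ∈ wedge θ) : ‖u‖ * Real.cos θ < u.re := by
  have h0 := re_pos_of_mem_wedge hc hsin hu
  have h1 : (|u.im| * Real.cos θ) ^ 2 < (u.re * Real.sin θ) ^ 2 :=
    pow_lt_pow_left₀ hu (by positivity) (by norm_num)
  refine lt_of_pow_lt_pow_left₀ 2 h0.le ?_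
  rw [mul_pow, sq_abs, mul_pow] at h1
  rw [mul_pow, Complex.sq_norm, Complex.normSq_apply]
  nlinarith [Real.sin_sq_add_cos_sq θ]

/-- The maximum of `y ^ N e^{-a y}`. -/
theorem pow_mul_exp_neg_le {y a : ℝ} (hy : 0 ≤ y) (ha : 0 < a) {N : ℕ} (hN : 0 < N) :
    y ^ N * Real.exp (-(a * y)) ≤ (N / a) ^ N * Real.exp (-N) := by
  have hN' : (0 : ℝ) < N := by exact_mod_cast hN
  have h1 : a * y / N ≤ Real.exp (a * y / N - 1) := by
    have := Real.add_one_le_exp (a * y / N - 1); linarith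
  have h2 : (a * y / N) ^ N ≤ Real.exp (a * y / N - 1) ^ N := pow_le_pow_left₀ (by positivity) h1 N
  rw [← Real.exp_nat_mul, show (N : ℝ) * (a * y / N - 1) = a * y - N by field_simp] at h2
  have h3 : y ^ N = (N / a) ^ N * (a * y / N) ^ N := by
    rw [← mul_pow]; congr 1; field_simp
  rw [h3, mul_assoc]
  refine mul_le_mul_of_nonneg_left ?_ (by positivity)
  calc _ ≤ Real.exp (a * y - N) * Real.exp (-(a * y)) := by gcongr
    _ = _ := by rw [← Real.exp_add]; ring_nf

/-- The bound for the divided differences of `f_k` on `lens s θ`. -/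
def lensBound (k m : ℕ) (τ θ s : ℝ) : ℝ :=
  τ * Real.exp (τ * (1 - s)) * Real.exp (τ * s * (Real.cos θ - 1 / 2)) *
    (((m + k + 1 : ℕ) / (τ * (Real.cos θ - 1 / 2))) ^ (m + k + 1) * Real.exp (-(m + k + 1 : ℕ))) *
    (((m - 1)! : ℝ) / ((m + k)! : ℝ) *
      ∑ j ∈ Finset.range m, |laguerre (m - 1 - j) k (τ * s)| * cCoeff j θ)

theorem lensBound_one {k m : ℕ} {τ θ : ℝ} (hτ : 0 < τ) (P : ℝ) :
    lensBound k m τ θ 1 * P = bound₁ 1 k m τ θ P := by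
  unfold lensBound bound₁ bigC
  have h1 : Real.exp (τ * (Real.cos θ - 1 / 2) - m - k - 1) =
      Real.exp (τ * (Real.cos θ - 1 / 2)) * Real.exp (-(m + k + 1 : ℕ)) := by
    rw [← Real.exp_add]; push_cast; ring_nf
  have h2 : ((m + k + 1 : ℕ) : ℝ) / (τ * (Real.cos θ - 1 / 2)) =
      (2 * (m + k + 1) / (2 * Real.cos θ - 1)) / τ := by
    rw [show 2 * Real.cos θ - 1 = 2 * (Real.cos θ - 1 / 2) by ring, mul_div_mul_left _ _ two_ne_zero,
      div_div, mul_comm τ]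
    push_cast; rfl
  rw [h1, h2, div_pow]
  simp only [sub_self, mul_zero, Real.exp_zero, mul_one, one_mul]
  rw [pow_succ τ]
  field_simp

theorem tendsto_lensBound (k m : ℕ) {τ θ : ℝ} (hτ : 0 < τ) (hθ : 1 / 2 < Real.cos θ) :
    Filter.Tendsto (fun t => lensBound k m τ (θ + t) (1 - t)) (nhds 0)
      (nhds (lensBound k m τ θ 1)) := by
  have h : ContinuousAt (fun t => lensBound k m τ (θ + t) (1 - t)) 0 := by
    unfold lensBound laguerre cCoeff
    have h0 : τ * (Real.cos (θ + 0) - 1 / 2) ≠ 0 := by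
      rw [add_zero]; exact (mul_pos hτ (by linarith)).ne'
    have h1 : ContinuousAt (fun t : ℝ =>
        ((m + k + 1 : ℕ) : ℝ) / (τ * (Real.cos (θ + t) - 1 / 2))) 0 :=
      ContinuousAt.div (by fun_prop) (by fun_prop) h0
    refine ContinuousAt.mul (ContinuousAt.mul (by fun_prop) (ContinuousAt.mul (h1.pow _)
      (by fun_prop))) ?_
    fun_prop
  simpa [ContinuousAt] using h

theorem norm_iterate_deriv_expInv_le {n k : ℕ} {τ θ s : ℝ} (hτ : 0 < τ) (hs : 0 < s)
    (hθ : 1 / 2 < Real.cos θ) (hsin : 0 ≤ Real.sin θ) {z : ℂ} (hz : z ∈ lens s θ) :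
    ‖deriv^[n + 1 + k] (expInv k τ) z‖ ≤
      ((n + 1 + k)! : ℝ) * (τ ^ k * lensBound k (n + 1) τ θ s) := by
  have hz0 := ne_zero_of_mem_lens hz
  set w := z⁻¹ with hw
  have hu : w - s ∈ wedge θ := by
    rw [← inv_mem_lens_iff (inv_ne_zero hz0), inv_inv]; exact hz
  -- With w = 1/z = s + u and u = c|u|, |c| = 1, the sector condition says Re c ≥ cos θ, hence |1 -
  -- c| ≤ √(2(1 - cos θ)).
  set u := w - s with hu_def
  have hc0 : 0 ≤ Real.cos θ := by linarith
  have hre := re_pos_of_mem_wedge hc0 hsin hu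
  have hre2 := norm_mul_cos_lt_re hc0 hsin hu
  have hr : 0 < ‖u‖ := norm_pos_iff.mpr (by intro h; rw [h] at hre; simp at hre)
  set c : ℂ := u / ‖u‖ with hc
  have hrC : (‖u‖ : ℂ) ≠ 0 := by exact_mod_cast hr.ne'
  have huc : u = c * ‖u‖ := by rw [hc]; field_simp
  have hcn : ‖c‖ = 1 := by rw [hc, norm_div, Complex.norm_real, norm_norm, div_self hr.ne']
  have hcre : Real.cos θ ≤ c.re := by
    rw [hc, Complex.div_ofReal_re, le_div_iff₀ hr, mul_comm]; exact hre2.le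
  have hure : u.re = ‖u‖ * c.re := by
    conv_lhs => rw [huc, Complex.re_mul_ofReal]
    ring
  have h1c : 1 + ‖1 - c‖ ≤ 1 + √(2 * (1 - Real.cos θ)) := by
    gcongr
    refine Real.le_sqrt_of_sq_le ?_
    have h2 : c.re ^ 2 + c.im ^ 2 = 1 := by
      have := Complex.sq_norm c
      rw [hcn, Complex.normSq_apply] at this
      nlinarith
    rw [Complex.sq_norm, Complex.normSq_apply]
    simp only [Complex.sub_re, Complex.one_re, Complex.sub_im, Complex.one_im]
    nlinarith
  -- Split τw = τs + c·τ|u|: the addition theorem handles the sum, the multiplication theorem the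
  -- complex direction c.
  have hlag : ‖lag n (k + 1) (τ * w)‖ ≤ (∑ j ∈ Finset.range (n + 1),
      |laguerre (n - j) k (τ * s)| * cCoeff j θ) * Real.exp (τ * ‖u‖ / 2) := by
    have : (τ : ℂ) * w = ((τ * s : ℝ) : ℂ) + c * ((τ * ‖u‖ : ℝ) : ℂ) := by
      push_cast; linear_combination (τ : ℂ) * huc
    rw [this, lag_add, Finset.sum_mul]
    refine (norm_sum_le _ _).trans (Finset.sum_le_sum fun j _ => ?_)
    rw [norm_mul, ← ofReal_laguerre, Complex.norm_real, Real.norm_eq_abs, mul_assoc]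
    refine mul_le_mul_of_nonneg_left ?_ (abs_nonneg _)
    refine (norm_lag_zero_le (mul_pos hτ hr) j hcn).trans ?_
    refine mul_le_mul_of_nonneg_right ?_ (Real.exp_pos _).le
    exact pow_le_pow_left₀ (by positivity) h1c j
  have hexp : ‖Complex.exp (τ * (1 - w))‖ = Real.exp (τ * (1 - s) - τ * u.re) := by
    rw [Complex.norm_exp]
    congr 1
    have : w = u + s := by rw [hu_def]; ring
    rw [this]
    simp
    ring
  have hwle : ‖w‖ ≤ s + ‖u‖ := by
    have : w = s + u := by rw [hu_def]; ring
    rw [this]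
    refine (norm_add_le _ _).trans (le_of_eq ?_)
    rw [Complex.norm_real, Real.norm_of_nonneg hs.le]
  have hmain : ‖w‖ ^ (n + k + 2) * (Real.exp (τ * ‖u‖ / 2) *
      Real.exp (τ * (1 - s) - τ * u.re)) ≤
      Real.exp (τ * (1 - s)) * Real.exp (τ * s * (Real.cos θ - 1 / 2)) *
      (((n + k + 2 : ℕ) / (τ * (Real.cos θ - 1 / 2))) ^ (n + k + 2) *
        Real.exp (-(n + k + 2 : ℕ))) := by
    have ha : 0 < τ * (Real.cos θ - 1 / 2) := mul_pos hτ (by linarith)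
    have h3 := pow_mul_exp_neg_le (norm_nonneg w) ha (show 0 < n + k + 2 by omega)
    -- The Laguerre bound costs e^{τ|u|/2} and the exponential gains e^{-τ|u| cos θ}. The net decay
    -- needs cos θ > 1/2, that is θ < π/3; then |u| ≥ |w| - s makes the maximum of y^N e^{-ay}
    -- applicable to y = |w|.
    have h4 : Real.exp (τ * ‖u‖ / 2) * Real.exp (τ * (1 - s) - τ * u.re) ≤
        Real.exp (τ * (1 - s)) * Real.exp (τ * s * (Real.cos θ - 1 / 2)) *
        Real.exp (-(τ * (Real.cos θ - 1 / 2) * ‖w‖)) := by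
      rw [← Real.exp_add, ← Real.exp_add, ← Real.exp_add, Real.exp_le_exp, hure]
      have h5 : τ * ‖u‖ * (Real.cos θ - 1 / 2) ≤ τ * ‖u‖ * (c.re - 1 / 2) :=
        mul_le_mul_of_nonneg_left (by linarith) (by positivity)
      have h6 := mul_le_mul_of_nonneg_left hwle ha.le
      nlinarith
    calc _ ≤ ‖w‖ ^ (n + k + 2) * (Real.exp (τ * (1 - s)) *
          Real.exp (τ * s * (Real.cos θ - 1 / 2)) *
          Real.exp (-(τ * (Real.cos θ - 1 / 2) * ‖w‖))) := by gcongr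
      _ = Real.exp (τ * (1 - s)) * Real.exp (τ * s * (Real.cos θ - 1 / 2)) * (‖w‖ ^ (n + k + 2) *
          Real.exp (-(τ * (Real.cos θ - 1 / 2) * ‖w‖))) := by ring
      _ ≤ _ := by gcongr
  rw [show n + 1 + k = n + (k + 1) by ring, iterate_deriv_expInv n k τ hz0, norm_mul, norm_mul,
    norm_mul, norm_mul, norm_mul, norm_pow, norm_pow, norm_neg, norm_one, one_pow, mul_one,
    Complex.norm_natCast, Complex.norm_real, Real.norm_of_nonneg hτ.le, ← hw, hexp, norm_pow]
  have hS : 0 ≤ ∑ j ∈ Finset.range (n + 1), |laguerre (n - j) k (τ * s)| * cCoeff j θ :=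
    Finset.sum_nonneg fun j _ => mul_nonneg (abs_nonneg _) (pow_nonneg (by positivity) _)
  set S := ∑ j ∈ Finset.range (n + 1), |laguerre (n - j) k (τ * s)| * cCoeff j θ with hSdef
  calc _ ≤ τ ^ (k + 1) * n ! * (‖w‖ ^ (n + k + 2) * (S * Real.exp (τ * ‖u‖ / 2) *
        Real.exp (τ * (1 - s) - τ * u.re))) := by gcongr
    _ = τ ^ (k + 1) * n ! * S * (‖w‖ ^ (n + k + 2) * (Real.exp (τ * ‖u‖ / 2) *
      Real.exp (τ * (1 - s) - τ * u.re))) := by ring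
    _ ≤ τ ^ (k + 1) * n ! * S * (Real.exp (τ * (1 - s)) * Real.exp (τ * s * (Real.cos θ - 1 / 2)) *
      (((n + k + 2 : ℕ) / (τ * (Real.cos θ - 1 / 2))) ^ (n + k + 2) *
        Real.exp (-(n + k + 2 : ℕ)))) := by gcongr
    _ = _ := by
      unfold lensBound
      rw [show n + 1 + k + 1 = n + k + 2 by ring, show n + 1 + k = n + (k + 1) by ring,
        Nat.add_sub_cancel, ← hSdef]
      field_simp
      ring

theorem pow_mul_phi (k : ℕ) (x : ℂ) :
    x ^ k * phi k x = Complex.exp x - ∑ j ∈ Finset.range k, x ^ j / (j ! : ℂ) := by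
  induction k with
  | zero => simp [phi_zero, Complex.exp_eq_exp_ℂ]
  | succ k ih =>
    have h := mul_phi_succ k x
    rw [pow_succ, mul_assoc, h, mul_sub, ih, Finset.sum_range_succ, Complex.real_smul]
    push_cast
    ring

theorem norm_divided_difference_le {k m : ℕ} (hm : 1 ≤ m) {τ θ s : ℝ} (hτ : 0 < τ) (hs : 0 < s)
    (hs1 : s < 1) (hθ : 1 / 2 < Real.cos θ) (hsin : 0 < Real.sin θ) {S : Multiset ℂ}
    (hS : ∀ a ∈ S, a ∈ lens s θ) (hcard : S.card = m) {P : ℂ[X]} (hP : P.degree < m) {g : ℂ → ℂ}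
    (hg : DifferentiableOn ℂ g (lens s θ))
    (h : ∀ z ∈ lens s θ, phi k ((τ : ℂ) * (1 - z⁻¹)) = P.eval z + (nodal S).eval z * g z) :
    ∀ z ∈ lens s θ, ‖g z‖ ≤ lensBound k m τ θ s := by
  obtain ⟨n, rfl⟩ : ∃ n, m = n + 1 := ⟨m - 1, by omega⟩
  -- With x = τ(1 - 1/z), z^k times x^k φ_k(x) = e^x - ∑_{j<k} x^j/j! becomes z^k e^x = Q(z) + τ^k
  -- (z - 1)^k φ_k(x). So τ^k g is the remainder for `expInv` with 1 added k times to the nodes.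
  let Q : ℂ[X] := ∑ j ∈ Finset.range k, C ((τ : ℂ) ^ j / (j ! : ℂ)) * (X ^ (k - j) * (X - C 1) ^ j)
  let R : ℂ[X] := Q + (X - C 1) ^ k * (C ((τ : ℂ) ^ k) * P)
  let S' : Multiset ℂ := Multiset.replicate k 1 + S
  have hcard' : S'.card = n + 1 + k := by simp [S', hcard, add_comm]
  have hnodal : nodal S' = (X - C 1) ^ k * nodal S := by
    rw [nodal_add]; simp [nodal]
  have hX1 : (X - C (1 : ℂ)).degree ≤ 1 := (degree_X_sub_C_le 1)
  have hR : R.degree < S'.card := by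
    rw [hcard']
    refine (degree_add_le _ _).trans_lt (max_lt ?_ ?_)
    · refine (mem_degreeLE.mp (Submodule.sum_mem (degreeLE ℂ (k : ℕ)) fun j hj =>
        mem_degreeLE.mpr ?_)).trans_lt (by exact_mod_cast (by omega : k < n + 1 + k))
      have hj := Finset.mem_range.mp hj
      have e1 : (X ^ (k - j) * (X - C (1 : ℂ)) ^ j).degree = ((k - j + j : ℕ) : WithBot ℕ) := by
        rw [degree_mul, degree_pow, degree_pow, degree_X, degree_X_sub_C]
        simp
      refine (degree_mul_le _ _).trans ?_
      rw [e1, Nat.sub_add_cancel hj.le]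
      exact (add_le_add_left degree_C_le _).trans (by simp)
    · rw [degree_mul, degree_pow, degree_X_sub_C]
      rcases eq_or_ne P 0 with rfl | hP0
      · simp only [mul_zero, degree_zero, WithBot.add_bot]; exact WithBot.bot_lt_coe _
      · have h2 : (C ((τ : ℂ) ^ k) * P).degree = P.degree := by
          rw [degree_C_mul]; exact pow_ne_zero _ (by exact_mod_cast hτ.ne')
        rw [h2, degree_eq_natDegree hP0] at *
        simp only [nsmul_eq_mul, mul_one]
        norm_cast at hP ⊢
        omega
  have hEq : EqOn (expInv k τ)
      (fun z => R.eval z + (nodal S').eval z * ((τ : ℂ) ^ k * g z)) (lens s θ) := by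
    intro z hz
    have hz0 := ne_zero_of_mem_lens hz
    have hzw : z * ((τ : ℂ) * (1 - z⁻¹)) = τ * (z - 1) := by field_simp
    have h1 := pow_mul_phi k ((τ : ℂ) * (1 - z⁻¹))
    rw [h z hz] at h1
    have h2 : ∀ j, z ^ j * ((τ : ℂ) * (1 - z⁻¹)) ^ j = τ ^ j * (z - 1) ^ j := fun j => by
      rw [← mul_pow, hzw, mul_pow]
    have h3 : z ^ k * ∑ j ∈ Finset.range k, ((τ : ℂ) * (1 - z⁻¹)) ^ j / (j ! : ℂ) = Q.eval z := by
      rw [Finset.mul_sum, eval_finsetSum]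
      refine Finset.sum_congr rfl fun j hj => ?_
      simp only [eval_mul, eval_C, eval_pow, eval_X, eval_sub]
      rw [show z ^ k = z ^ (k - j) * z ^ j by
        rw [← pow_add, Nat.sub_add_cancel (Finset.mem_range.mp hj).le]]
      linear_combination z ^ (k - j) / (j ! : ℂ) * h2 j
    simp only [expInv, R, hnodal, eval_add, eval_mul, eval_pow, eval_sub, eval_X, eval_C]
    rw [← h3]
    linear_combination (-z ^ k) * h1 + (P.eval z + (nodal S).eval z * g z) * h2 k
  have hopen := isOpen_lens s θ
  have hS' : ∀ a ∈ S', a ∈ lens s θ := by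
    intro a ha
    rcases Multiset.mem_add.mp ha with ha | ha
    · rw [Multiset.eq_of_mem_replicate ha, ← inv_one, inv_mem_lens_iff one_ne_zero]
      simp only [wedge, mem_ofPred_eq, Complex.sub_im, Complex.one_im, Complex.ofReal_im, sub_self,
        abs_zero, zero_mul, Complex.sub_re, Complex.one_re, Complex.ofReal_re]
      exact mul_pos (by linarith) hsin
    · exact hS a ha
  have key := norm_interpolation_error_le hopen (convex_lens hs.le (by linarith) hsin.le)
    (hg.const_mul ((τ : ℂ) ^ k)) S' hS' R hR (M := τ ^ k * lensBound k (n + 1) τ θ s) fun z hz => by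
      rw [← eqOn_iterate_deriv hopen hEq _ hz, hcard']
      exact norm_iterate_deriv_expInv_le hτ hs hθ hsin.le hz
  intro z hz
  have := key z hz
  rw [norm_mul, norm_pow, Complex.norm_real, Real.norm_of_nonneg hτ.le] at this
  exact le_of_mul_le_mul_left this (by positivity)

end RDArnoldi
end

/-! ### The Arnoldi process and polynomials in Z. -/

noncomputable section
namespace RDArnoldi
open Polynomial

section ArnoldiVectors
variable {M : ℕ} (Z : Matrix (Fin M) (Fin M) ℝ) (v : EuclideanSpace ℝ (Fin M))

/-- The unnormalized Arnoldi vectors. -/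
def arnoldiResidual (n : ℕ) : EuclideanSpace ℝ (Fin M) :=
  Matrix.toEuclideanLin Z (arnoldiVec Z v n) -
    ∑ i ∈ Finset.range (n + 1), arnoldiCoeff Z v i n • arnoldiVec Z v i

theorem arnoldiVec_succ (n : ℕ) :
    arnoldiVec Z v (n + 1) = ‖arnoldiResidual Z v n‖⁻¹ • arnoldiResidual Z v n := by
  rw [arnoldiVec, arnoldiResidual, Finset.sum_range]
  rfl

theorem norm_smul_arnoldiVec_succ (n : ℕ) :
    ‖arnoldiResidual Z v n‖ • arnoldiVec Z v (n + 1) = arnoldiResidual Z v n := by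
  rw [arnoldiVec_succ, smul_smul]
  rcases eq_or_ne (arnoldiResidual Z v n) 0 with h | h
  · rw [h]; simp
  · rw [mul_inv_cancel₀ (norm_ne_zero_iff.mpr h), one_smul]

/-- If the residual vanishes, the normalised vector is 0 by the convention 0⁻¹ = 0. The bound
therefore needs no assumption, and breakdown at the very last step is allowed. -/
theorem norm_arnoldiVec_succ_le (n : ℕ) : ‖arnoldiVec Z v (n + 1)‖ ≤ 1 := by
  rw [arnoldiVec_succ, norm_smul, norm_inv, norm_norm]
  exact inv_mul_le_one

/-- The first `n + 1` Arnoldi vectors are orthonormal. -/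
def OrthonormalUpTo (n : ℕ) : Prop :=
  ∀ i ≤ n, ∀ j ≤ n, inner ℝ (arnoldiVec Z v i) (arnoldiVec Z v j) = if i = j then (1 : ℝ) else 0

variable {Z v}

theorem inner_arnoldiResidual {n : ℕ} (h : OrthonormalUpTo Z v n) {i : ℕ} (hi : i ≤ n) :
    inner ℝ (arnoldiVec Z v i) (arnoldiResidual Z v n) = 0 := by
  rw [arnoldiResidual, inner_sub_right, inner_sum, Finset.sum_eq_single i]
  · rw [inner_smul_right, h i hi i hi, if_pos rfl, mul_one, arnoldiCoeff, sub_self]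
  · intro j hj hji
    rw [inner_smul_right, h i hi j (by simp at hj; omega), if_neg hji.symm, mul_zero]
  · intro hi'; simp at hi'; omega

/-- The subtracted projections are orthogonal to the residual. The identity also holds for a
vanishing residual, where both sides are 0. -/
theorem arnoldiCoeff_succ_self {n : ℕ} (h : OrthonormalUpTo Z v n) :
    arnoldiCoeff Z v (n + 1) n = ‖arnoldiResidual Z v n‖ := by
  have hu : Matrix.toEuclideanLin Z (arnoldiVec Z v n) = arnoldiResidual Z v n +
    ∑ i ∈ Finset.range (n + 1), arnoldiCoeff Z v i n • arnoldiVec Z v i := by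
    rw [arnoldiResidual]; abel
  have h0 : inner ℝ (arnoldiResidual Z v n)
      (∑ i ∈ Finset.range (n + 1), arnoldiCoeff Z v i n • arnoldiVec Z v i) = 0 := by
    rw [inner_sum]
    refine Finset.sum_eq_zero fun i hi => ?_
    rw [inner_smul_right, real_inner_comm, inner_arnoldiResidual h (by simp at hi; omega), mul_zero]
  rw [arnoldiCoeff, arnoldiVec_succ, inner_smul_left, hu, inner_add_right, h0, add_zero,
    real_inner_self_eq_norm_sq]
  simp only [map_inv₀, conj_trivial]
  rcases eq_or_ne ‖arnoldiResidual Z v n‖ 0 with h1 | h1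
  · rw [h1]; simp
  · field_simp

theorem toEuclideanLin_arnoldiVec {n : ℕ} (h : OrthonormalUpTo Z v n) :
    Matrix.toEuclideanLin Z (arnoldiVec Z v n) =
      ∑ i ∈ Finset.range (n + 2), arnoldiCoeff Z v i n • arnoldiVec Z v i := by
  rw [Finset.sum_range_succ, arnoldiCoeff_succ_self h, norm_smul_arnoldiVec_succ, arnoldiResidual]
  abel

theorem OrthonormalUpTo.mono {n m : ℕ} (h : OrthonormalUpTo Z v n) (hm : m ≤ n) :
    OrthonormalUpTo Z v m := fun i hi j hj => h i (hi.trans hm) j (hj.trans hm)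

theorem OrthonormalUpTo.succ {n : ℕ} (h : OrthonormalUpTo Z v n)
    (h1 : arnoldiCoeff Z v (n + 1) n ≠ 0) : OrthonormalUpTo Z v (n + 1) := by
  rw [arnoldiCoeff_succ_self h] at h1
  have horth : ∀ i ≤ n, inner ℝ (arnoldiVec Z v i) (arnoldiVec Z v (n + 1)) = 0 := fun i hi => by
    rw [arnoldiVec_succ, inner_smul_right, inner_arnoldiResidual h hi, mul_zero]
  have hself : inner ℝ (arnoldiVec Z v (n + 1)) (arnoldiVec Z v (n + 1)) = (1 : ℝ) := by
    rw [real_inner_self_eq_norm_sq, arnoldiVec_succ, norm_smul, norm_inv, norm_norm,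
      inv_mul_cancel₀ h1, one_pow]
  intro i hi j hj
  rcases Nat.le_succ_iff.mp hi with hi | rfl <;> rcases Nat.le_succ_iff.mp hj with hj | rfl
  · exact h i hi j hj
  · rw [horth i hi, if_neg (by omega)]
  · rw [real_inner_comm, horth j hj, if_neg (by omega)]
  · rw [hself, if_pos rfl]

theorem NoBreakdown.orthonormalUpTo (hv : ‖v‖ = 1) {m : ℕ} (h : NoBreakdown Z v (m + 1)) :
    OrthonormalUpTo Z v m := by
  have : ∀ n ≤ m, OrthonormalUpTo Z v n := by
    intro n hn
    induction n with
    | zero =>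
      intro i hi j hj
      obtain rfl : i = 0 := by omega
      obtain rfl : j = 0 := by omega
      rw [if_pos rfl, real_inner_self_eq_norm_sq, arnoldiVec, hv, one_pow]
    | succ n ih => exact (ih (by omega)).succ (h n (by omega))
  exact this m le_rfl

theorem arnoldiCoeff_eq_zero {n i j : ℕ} (h : OrthonormalUpTo Z v n) (hi : i ≤ n)
    (hij : j + 1 < i) : arnoldiCoeff Z v i j = 0 := by
  rw [arnoldiCoeff, toEuclideanLin_arnoldiVec (h.mono (by omega)), inner_sum]
  refine Finset.sum_eq_zero fun l hl => ?_
  simp only [Finset.mem_range] at hl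
  rw [inner_smul_right, h i hi l (by omega), if_neg (by omega), mul_zero]

theorem subdiagProd_nonneg {m : ℕ} (h : OrthonormalUpTo Z v m) : 0 ≤ subdiagProd Z v (m + 1) := by
  refine Finset.prod_nonneg fun i hi => ?_
  rw [arnoldiCoeff_succ_self (h.mono (by simp at hi; omega))]
  exact norm_nonneg _

theorem toEuclideanLin_arnoldiVec_eq_sum {m j : ℕ} (h : OrthonormalUpTo Z v m) (hj : j ≤ m) :
    Matrix.toEuclideanLin Z (arnoldiVec Z v j) =
      ∑ i ∈ Finset.range (m + 1), arnoldiCoeff Z v i j • arnoldiVec Z v i +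
        if j = m then arnoldiCoeff Z v (m + 1) m • arnoldiVec Z v (m + 1) else 0 := by
  rw [toEuclideanLin_arnoldiVec (h.mono hj)]
  split_ifs with hjm
  · subst hjm; rw [Finset.sum_range_succ]
  · rw [add_zero]
    refine Finset.sum_subset (Finset.range_subset_range.mpr (by omega)) fun i hi hi' => ?_
    simp only [Finset.mem_range] at hi hi'
    rw [arnoldiCoeff_eq_zero h (by omega) (by omega), zero_smul]

/-- The first unit vector. -/
def e₀ (m : ℕ) : Fin (m + 1) → ℝ := fun i => if (i : ℕ) = 0 then 1 else 0

/-- The Arnoldi relation ZV = VH + h v_{m+1} eᵀ, where eᵀ picks the last coordinate. With vectors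
numbered from 0, `OrthonormalUpTo Z v m` concerns m + 1 vectors. -/
theorem mulVec_arnoldiV {m : ℕ} (h : OrthonormalUpTo Z v m) (y : Fin (m + 1) → ℝ) :
    Z *ᵥ (arnoldiV Z v (m + 1) *ᵥ y) =
      arnoldiV Z v (m + 1) *ᵥ (arnoldiH Z v (m + 1) *ᵥ y) +
        (y (Fin.last m) * arnoldiCoeff Z v (m + 1) m) • (arnoldiVec Z v (m + 1)).ofLp := by
  have hcol : ∀ j : Fin (m + 1), Z *ᵥ (arnoldiVec Z v j).ofLp = ∑ i : Fin (m + 1),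
      arnoldiCoeff Z v i j • (arnoldiVec Z v i).ofLp +
        if (j : ℕ) = m then arnoldiCoeff Z v (m + 1) m • (arnoldiVec Z v (m + 1)).ofLp else 0 :=
    fun j => by
    have := congrArg WithLp.ofLp (toEuclideanLin_arnoldiVec_eq_sum h (show (j : ℕ) ≤ m by omega))
    rw [Matrix.ofLp_toLpLin, Matrix.toLin'_apply] at this
    rw [this, Finset.sum_range]
    split_ifs <;> simp
  have hV : ∀ y : Fin (m + 1) → ℝ, arnoldiV Z v (m + 1) *ᵥ y =
      ∑ j, y j • (arnoldiVec Z v j).ofLp := fun y => by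
    ext i
    simp [Matrix.mulVec, dotProduct, arnoldiV, mul_comm]
  rw [hV, hV, Matrix.mulVec_sum]
  simp only [Matrix.mulVec_smul, hcol, smul_add, Finset.sum_add_distrib]
  congr 1
  · simp only [Finset.smul_sum, Matrix.mulVec, dotProduct, Finset.sum_smul]
    rw [Finset.sum_comm]
    refine Finset.sum_congr rfl fun i _ => Finset.sum_congr rfl fun j _ => ?_
    rw [smul_smul, mul_comm]; rfl
  · rw [Finset.sum_eq_single (Fin.last m)]
    · simp [smul_smul]
    · intro j _ hj
      have hjm : (j : ℕ) ≠ m := fun h => hj (Fin.ext h)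
      rw [if_neg hjm, smul_zero]
    · simp

/-- A Hessenberg matrix moves the support of a vector down by at most one coordinate, multiplying
the leading entry by a subdiagonal coefficient. -/
theorem arnoldiH_pow_mulVec {m j : ℕ} (h : OrthonormalUpTo Z v m) (hj : j ≤ m) :
    (∀ i : Fin (m + 1), j < i → ((arnoldiH Z v (m + 1) ^ j) *ᵥ e₀ m) i = 0) ∧
    ∀ i : Fin (m + 1), (i : ℕ) = j → ((arnoldiH Z v (m + 1) ^ j) *ᵥ e₀ m) i =
      ∏ l ∈ Finset.range j, arnoldiCoeff Z v (l + 1) l := by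
  induction j with
  | zero =>
    refine ⟨fun i hi => ?_, fun i hi => ?_⟩
    · rw [pow_zero, Matrix.one_mulVec, e₀, if_neg (by omega)]
    · rw [pow_zero, Matrix.one_mulVec, e₀, if_pos hi, Finset.prod_range_zero]
  | succ j ih =>
    obtain ⟨ih1, ih2⟩ := ih (by omega)
    simp only [pow_succ', ← Matrix.mulVec_mulVec]
    set y := (arnoldiH Z v (m + 1) ^ j) *ᵥ e₀ m
    refine ⟨fun i hi => ?_, fun i hi => ?_⟩
    · rw [Matrix.mulVec, dotProduct]
      refine Finset.sum_eq_zero fun l _ => ?_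
      rcases le_or_gt (l : ℕ) j with hl | hl
      · rw [arnoldiH, Matrix.of_apply, arnoldiCoeff_eq_zero h (by omega) (by omega), zero_mul]
      · rw [ih1 l hl, mul_zero]
    · rw [Matrix.mulVec, dotProduct, Finset.sum_eq_single ⟨j, by omega⟩]
      · rw [ih2 _ rfl, Finset.prod_range_succ, mul_comm, arnoldiH, Matrix.of_apply, hi]
      · intro l _ hl
        rcases lt_trichotomy (l : ℕ) j with hl' | hl' | hl'
        · rw [arnoldiH, Matrix.of_apply, arnoldiCoeff_eq_zero h (by omega) (by omega), zero_mul]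
        · exact absurd (Fin.ext hl') hl
        · rw [ih1 l hl', mul_zero]
      · simp

theorem pow_mulVec_eq {m j : ℕ} (h : OrthonormalUpTo Z v m) (hj : j ≤ m) :
    (Z ^ j) *ᵥ v.ofLp = arnoldiV Z v (m + 1) *ᵥ ((arnoldiH Z v (m + 1) ^ j) *ᵥ e₀ m) := by
  induction j with
  | zero =>
    rw [pow_zero, pow_zero, Matrix.one_mulVec, Matrix.one_mulVec]
    ext i
    rw [Matrix.mulVec, dotProduct, Finset.sum_eq_single 0]
    · simp [e₀, arnoldiV, arnoldiVec]
    · intro l _ hl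
      have hl0 : (l : ℕ) ≠ 0 := fun h => hl (Fin.ext h)
      rw [e₀, if_neg hl0, mul_zero]
    · simp
  | succ j ih =>
    rw [pow_succ', ← Matrix.mulVec_mulVec, ih (by omega), mulVec_arnoldiV h,
      (arnoldiH_pow_mulVec h (by omega : j ≤ m)).1 _ (by simp; omega), zero_mul, zero_smul, add_zero,
      Matrix.mulVec_mulVec _ (arnoldiH Z v (m + 1)), ← pow_succ']

theorem pow_mulVec_last {m : ℕ} (h : OrthonormalUpTo Z v m) :
    (Z ^ (m + 1)) *ᵥ v.ofLp =
      arnoldiV Z v (m + 1) *ᵥ ((arnoldiH Z v (m + 1) ^ (m + 1)) *ᵥ e₀ m) +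
        subdiagProd Z v (m + 1) • (arnoldiVec Z v (m + 1)).ofLp := by
  rw [pow_succ', ← Matrix.mulVec_mulVec, pow_mulVec_eq h le_rfl, mulVec_arnoldiV h,
    (arnoldiH_pow_mulVec h le_rfl).2 _ (by simp), Matrix.mulVec_mulVec _ (arnoldiH Z v (m + 1)),
    ← pow_succ', subdiagProd, Finset.prod_range_succ]

theorem arnoldiV_transpose_mul_self {m : ℕ} (h : OrthonormalUpTo Z v m) :
    (arnoldiV Z v (m + 1))ᵀ * arnoldiV Z v (m + 1) = 1 := by
  ext i j
  have := h i (by omega) j (by omega)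
  rw [EuclideanSpace.inner_eq_star_dotProduct, star_trivial, dotProduct_comm] at this
  rw [Matrix.mul_apply', Matrix.one_apply]
  simp only [Fin.ext_iff]
  exact this

theorem arnoldiH_eq (m : ℕ) :
    arnoldiH Z v m = (arnoldiV Z v m)ᵀ * Z * arnoldiV Z v m := by
  ext i j
  rw [arnoldiH, Matrix.of_apply, arnoldiCoeff, EuclideanSpace.inner_eq_star_dotProduct, star_trivial,
    Matrix.mul_assoc, Matrix.mul_apply', dotProduct_comm, Matrix.ofLp_toLpLin, Matrix.toLin'_apply]
  rfl

end ArnoldiVectors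

/-- Complexification of a real matrix. -/
abbrev cx {m n : ℕ} (A : Matrix (Fin m) (Fin n) ℝ) : Matrix (Fin m) (Fin n) ℂ :=
  A.map Complex.ofRealHom

/-- Complexification of a real vector. -/
abbrev cxv {n : ℕ} (x : Fin n → ℝ) : Fin n → ℂ := fun i => (x i : ℂ)

theorem cxv_mulVec {m n : ℕ} (A : Matrix (Fin m) (Fin n) ℝ) (x : Fin n → ℝ) :
    cxv (A *ᵥ x) = cx A *ᵥ cxv x := by
  ext i
  exact RingHom.map_mulVec Complex.ofRealHom A x i

theorem cx_pow {n : ℕ} (A : Matrix (Fin n) (Fin n) ℝ) (j : ℕ) : cx (A ^ j) = cx A ^ j :=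
  map_pow Complex.ofRealHom.mapMatrix A j

theorem norm_cxv {n : ℕ} (x : EuclideanSpace ℝ (Fin n)) :
    ‖WithLp.toLp 2 (cxv x.ofLp)‖ = ‖x‖ := by
  rw [EuclideanSpace.norm_eq, EuclideanSpace.norm_eq]
  simp

section Polynomial
variable {M : ℕ} {Z : Matrix (Fin M) (Fin M) ℝ} {v : EuclideanSpace ℝ (Fin M)}

/-- Below the top degree the last coordinate of H^j e₁ is zero until the final multiplication, so
the residual term of the Arnoldi relation never enters. -/
theorem aeval_mulVec_eq {m : ℕ} (h : OrthonormalUpTo Z v m) {p : ℂ[X]} (hp : p.degree < (m + 1 : ℕ)) :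
    aeval (cx Z) p *ᵥ cxv v.ofLp =
      cx (arnoldiV Z v (m + 1)) *ᵥ (aeval (cx (arnoldiH Z v (m + 1))) p *ᵥ cxv (e₀ m)) := by
  have hd : p.natDegree < m + 1 := by
    rcases eq_or_ne p 0 with rfl | hp0
    · simp
    · exact (natDegree_lt_iff_degree_lt hp0).mpr hp
  rw [aeval_eq_sum_range' hd, aeval_eq_sum_range' hd, Matrix.sum_mulVec, Matrix.sum_mulVec,
    Matrix.mulVec_sum]
  refine Finset.sum_congr rfl fun j hj => ?_
  rw [Matrix.smul_mulVec, Matrix.smul_mulVec, Matrix.mulVec_smul, ← cx_pow, ← cx_pow,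
    ← cxv_mulVec, ← cxv_mulVec, ← cxv_mulVec, pow_mulVec_eq h (by simp at hj; omega)]

/-- Lower powers are reproduced exactly, the leading power leaves the residual term, and
Cayley–Hamilton removes everything else. -/
theorem charpoly_mulVec_eq {m : ℕ} (h : OrthonormalUpTo Z v m) :
    aeval (cx Z) (cx (arnoldiH Z v (m + 1))).charpoly *ᵥ cxv v.ofLp =
      (subdiagProd Z v (m + 1) : ℂ) • cxv (arnoldiVec Z v (m + 1)).ofLp := by
  set χ := (cx (arnoldiH Z v (m + 1))).charpoly with hχ
  have hmonic : χ.Monic := Matrix.charpoly_monic _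
  have hdeg : χ.natDegree = m + 1 := by simp [hχ, Matrix.charpoly_natDegree_eq_dim]
  have h1 : χ = X ^ (m + 1) + χ.eraseLead := by
    conv_lhs => rw [← χ.eraseLead_add_C_mul_X_pow, hmonic.leadingCoeff, hdeg]
    rw [C_1, one_mul, add_comm]
  have h2 : χ.eraseLead.degree < (m + 1 : ℕ) := by
    rw [← hdeg, ← degree_eq_natDegree hmonic.ne_zero]
    exact degree_eraseLead_lt hmonic.ne_zero
  have h3 := Matrix.aeval_self_charpoly (cx (arnoldiH Z v (m + 1)))
  rw [← hχ, h1, map_add, map_pow, aeval_X] at h3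
  rw [h1, map_add, map_pow, aeval_X, Matrix.add_mulVec, aeval_mulVec_eq h h2, ← cx_pow,
    ← cxv_mulVec, pow_mulVec_last h]
  have h4 : cxv (arnoldiV Z v (m + 1) *ᵥ ((arnoldiH Z v (m + 1) ^ (m + 1)) *ᵥ e₀ m) +
        subdiagProd Z v (m + 1) • (arnoldiVec Z v (m + 1)).ofLp) =
      cx (arnoldiV Z v (m + 1)) *ᵥ (cx (arnoldiH Z v (m + 1)) ^ (m + 1) *ᵥ cxv (e₀ m)) +
      (subdiagProd Z v (m + 1) : ℂ) • cxv (arnoldiVec Z v (m + 1)).ofLp := by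
    rw [← cx_pow, ← cxv_mulVec, ← cxv_mulVec]
    ext i
    simp [cxv]
  rw [h4, add_right_comm, ← Matrix.mulVec_add, ← Matrix.add_mulVec, h3]
  simp

end Polynomial

end RDArnoldi
end

/-! ### Sectorial matrices and their compressions. -/

noncomputable section
namespace RDArnoldi
open Polynomial

/-- The quadratic form `x ↦ xᴴ A x`. -/
def qf {n : ℕ} (A : Matrix (Fin n) (Fin n) ℂ) (x : Fin n → ℂ) : ℂ := star x ⬝ᵥ (A *ᵥ x)

/-- The Euclidean norm of a complex vector. -/
def nrm {n : ℕ} (x : Fin n → ℂ) : ℝ := ‖WithLp.toLp 2 x‖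

/-- The numerical range of `A` lies in the closed sector of semiangle `θ` around the positive real
axis. -/
def IsSectorial {n : ℕ} (θ : ℝ) (A : Matrix (Fin n) (Fin n) ℂ) : Prop :=
  ∀ x, 0 ≤ (qf A x).re ∧ |(qf A x).im| * Real.cos θ ≤ (qf A x).re * Real.sin θ

section
variable {n : ℕ}

theorem star_dotProduct_eq_inner (x y : Fin n → ℂ) :
    star x ⬝ᵥ y = inner ℂ (WithLp.toLp 2 x) (WithLp.toLp 2 y) := by
  rw [EuclideanSpace.inner_eq_star_dotProduct, dotProduct_comm]

theorem star_dotProduct_self (x : Fin n → ℂ) : star x ⬝ᵥ x = ((nrm x ^ 2 : ℝ) : ℂ) := by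
  rw [star_dotProduct_eq_inner, inner_self_eq_norm_sq_to_K, nrm]
  push_cast; rfl

theorem norm_star_dotProduct_le (x y : Fin n → ℂ) : ‖star x ⬝ᵥ y‖ ≤ nrm x * nrm y := by
  rw [star_dotProduct_eq_inner]; exact norm_inner_le_norm _ _

theorem nrm_nonneg (x : Fin n → ℂ) : 0 ≤ nrm x := norm_nonneg _

theorem nrm_eq_zero {x : Fin n → ℂ} : nrm x = 0 ↔ x = 0 := by
  rw [nrm, norm_eq_zero, WithLp.toLp_eq_zero]

theorem nrm_pos {x : Fin n → ℂ} (hx : x ≠ 0) : 0 < nrm x :=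
  (nrm_nonneg x).lt_of_ne' (nrm_eq_zero.not.mpr hx)

theorem star_star_dotProduct (x y : Fin n → ℂ) : star (star x ⬝ᵥ y) = star y ⬝ᵥ x := by
  rw [Matrix.star_dotProduct, star_star]

theorem isUnit_det_of_mulVec {A : Matrix (Fin n) (Fin n) ℂ} (h : ∀ x, A *ᵥ x = 0 → x = 0) :
    IsUnit A.det := by
  rw [isUnit_iff_ne_zero]
  intro h0
  obtain ⟨x, hx, hx0⟩ := Matrix.exists_mulVec_eq_zero_iff.mpr h0
  exact hx (h x hx0)

theorem isSectorial_of_numericalRange_subset {L : Matrix (Fin n) (Fin n) ℝ} {θ δ : ℝ} (h0 : 0 ≤ θ)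
    (h1 : θ < Real.pi / 2) (hδ : 0 < δ) (h : numericalRange L ⊆ sector θ) :
    IsSectorial θ (cx (-(δ • L))) := by
  intro x
  rcases eq_or_ne x 0 with rfl | hx
  · simp [qf]
  set N := nrm x ^ 2
  have hN : 0 < N := pow_pos (nrm_pos hx) 2
  have hNC : (N : ℂ) ≠ 0 := by exact_mod_cast hN.ne'
  set z := (star x ⬝ᵥ (L.map (fun t : ℝ => (t : ℂ)) *ᵥ x)) / (star x ⬝ᵥ x) with hz
  have harg : |Complex.arg (-z)| ≤ θ := h ⟨x, hx, rfl⟩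
  have hq : qf (cx (-(δ • L))) x = ((δ * N : ℝ) : ℂ) * (-z) := by
    rw [hz, star_dotProduct_self]
    have : cx (-(δ • L)) = (-(δ : ℂ)) • L.map (fun t : ℝ => (t : ℂ)) := by
      ext i j; simp
    rw [qf, this, Matrix.smul_mulVec, dotProduct_smul, smul_eq_mul]
    push_cast
    field_simp
    rw [mul_assoc, show ((nrm x : ℂ)) ^ 2 = (N : ℂ) by simp [N]]
    field_simp
  have ha1 : |Complex.arg (-z)| ≤ Real.pi / 2 := harg.trans h1.le
  have hcos : 0 ≤ Real.cos (Complex.arg (-z)) :=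
    Real.cos_nonneg_of_neg_pi_div_two_le_of_le (by linarith [neg_abs_le (Complex.arg (-z))])
      ((le_abs_self _).trans ha1)
  have hre : (-z).re = ‖-z‖ * Real.cos (Complex.arg (-z)) := (Complex.norm_mul_cos_arg _).symm
  have him : (-z).im = ‖-z‖ * Real.sin (Complex.arg (-z)) := (Complex.norm_mul_sin_arg _).symm
  have hs : |Real.sin (Complex.arg (-z))| = Real.sin |Complex.arg (-z)| := by
    rcases le_or_gt 0 (Complex.arg (-z)) with ha | ha
    · rw [abs_of_nonneg ha, abs_of_nonneg (Real.sin_nonneg_of_nonneg_of_le_pi ha (Complex.arg_le_pi _))]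
    · rw [abs_of_neg ha, Real.sin_neg, abs_of_nonpos]
      exact Real.sin_nonpos_of_nonpos_of_neg_pi_le ha.le (Complex.neg_pi_lt_arg _).le
  have hsub : 0 ≤ Real.sin (θ - |Complex.arg (-z)|) :=
    Real.sin_nonneg_of_nonneg_of_le_pi (by linarith) (by
      linarith [abs_nonneg (Complex.arg (-z)), Real.pi_pos])
  rw [Real.sin_sub, Real.cos_abs, ← hs] at hsub
  rw [hq, Complex.re_ofReal_mul, Complex.im_ofReal_mul, hre, him, abs_mul (δ * N), abs_mul ‖-z‖, abs_norm,
    abs_of_pos (mul_pos hδ hN)]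
  refine ⟨by positivity, ?_⟩
  have h2 : 0 ≤ δ * N * ‖-z‖ := by positivity
  have h3 := mul_nonneg h2 hsub
  linarith

theorem qf_one_add (A : Matrix (Fin n) (Fin n) ℂ) (x : Fin n → ℂ) :
    star x ⬝ᵥ ((1 + A) *ᵥ x) = ((nrm x ^ 2 : ℝ) : ℂ) + qf A x := by
  rw [Matrix.add_mulVec, Matrix.one_mulVec, dotProduct_add, star_dotProduct_self, qf]

theorem IsSectorial.isUnit_det_one_add {θ : ℝ} {A : Matrix (Fin n) (Fin n) ℂ}
    (h : IsSectorial θ A) : IsUnit (1 + A).det := by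
  refine isUnit_det_of_mulVec fun x hx => ?_
  have h1 := congrArg Complex.re (qf_one_add A x)
  rw [hx, dotProduct_zero, Complex.add_re, Complex.ofReal_re, Complex.zero_re] at h1
  have h2 := (h x).1
  have h3 : nrm x = 0 := by nlinarith [sq_nonneg (nrm x), nrm_nonneg x]
  exact nrm_eq_zero.mp h3

theorem nrm_mulVec_isometry {m : ℕ} {V : Matrix (Fin n) (Fin m) ℂ} (hV : Vᴴ * V = 1)
    (y : Fin m → ℂ) : nrm (V *ᵥ y) = nrm y := by
  have h : star (V *ᵥ y) ⬝ᵥ (V *ᵥ y) = star y ⬝ᵥ y := by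
    rw [Matrix.star_mulVec, Matrix.dotProduct_mulVec, Matrix.vecMul_vecMul, hV, Matrix.vecMul_one]
  rw [star_dotProduct_self, star_dotProduct_self] at h
  have h2 : nrm (V *ᵥ y) ^ 2 = nrm y ^ 2 := by exact_mod_cast h
  exact (pow_left_inj₀ (nrm_nonneg _) (nrm_nonneg _) two_ne_zero).mp h2

theorem nrm_conjTranspose_mulVec_le {m : ℕ} {V : Matrix (Fin n) (Fin m) ℂ} (hV : Vᴴ * V = 1)
    (b : Fin n → ℂ) : nrm (Vᴴ *ᵥ b) ≤ nrm b := by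
  have h : star (V *ᵥ (Vᴴ *ᵥ b)) ⬝ᵥ b = ((nrm (Vᴴ *ᵥ b) ^ 2 : ℝ) : ℂ) := by
    rw [Matrix.star_mulVec, ← Matrix.dotProduct_mulVec, star_dotProduct_self]
  have h2 := norm_star_dotProduct_le (V *ᵥ (Vᴴ *ᵥ b)) b
  rw [h, nrm_mulVec_isometry hV, Complex.norm_real, Real.norm_of_nonneg (sq_nonneg _), sq] at h2
  rcases (nrm_nonneg (Vᴴ *ᵥ b)).eq_or_lt with h0 | h0
  · rw [← h0]; exact nrm_nonneg _
  · exact le_of_mul_le_mul_left h2 h0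

/-- Compressions of `(1 + A)⁻¹` are again of this form. -/
theorem IsSectorial.compression {m : ℕ} {θ : ℝ} {A : Matrix (Fin n) (Fin n) ℂ}
    (h : IsSectorial θ A) (hsin : 0 ≤ Real.sin θ) {V : Matrix (Fin n) (Fin m) ℂ} (hV : Vᴴ * V = 1)
    {H : Matrix (Fin m) (Fin m) ℂ} (hH : H = Vᴴ * (1 + A)⁻¹ * V) :
    IsUnit H.det ∧ IsSectorial θ (H⁻¹ - 1) := by
  have hu := h.isUnit_det_one_add
  have hx : ∀ c, V *ᵥ c = (1 + A) *ᵥ ((1 + A)⁻¹ *ᵥ (V *ᵥ c)) := fun c => by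
    rw [Matrix.mulVec_mulVec, Matrix.mul_nonsing_inv _ hu, Matrix.one_mulVec]
  have hHc : ∀ c, H *ᵥ c = Vᴴ *ᵥ ((1 + A)⁻¹ *ᵥ (V *ᵥ c)) := fun c => by
    rw [hH, Matrix.mulVec_mulVec, Matrix.mulVec_mulVec]
  have hκ : ∀ c, star (H *ᵥ c) ⬝ᵥ c = ((nrm ((1 + A)⁻¹ *ᵥ (V *ᵥ c)) ^ 2 : ℝ) : ℂ) +
      qf A ((1 + A)⁻¹ *ᵥ (V *ᵥ c)) := fun c => by
    rw [hHc, ← qf_one_add, ← hx, Matrix.star_mulVec, ← Matrix.dotProduct_mulVec,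
      Matrix.conjTranspose_conjTranspose]
  have hdet : IsUnit H.det := by
    refine isUnit_det_of_mulVec fun c hc => ?_
    have h1 := congrArg Complex.re (hκ c)
    rw [hc, star_zero, zero_dotProduct, Complex.add_re, Complex.ofReal_re, Complex.zero_re] at h1
    have h2 := (h ((1 + A)⁻¹ *ᵥ (V *ᵥ c))).1
    have h3 : nrm ((1 + A)⁻¹ *ᵥ (V *ᵥ c)) = 0 := by
      nlinarith [sq_nonneg (nrm ((1 + A)⁻¹ *ᵥ (V *ᵥ c))), nrm_nonneg ((1 + A)⁻¹ *ᵥ (V *ᵥ c))]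
    have h4 := hx c
    rw [nrm_eq_zero.mp h3, Matrix.mulVec_zero] at h4
    rw [← nrm_eq_zero, ← nrm_mulVec_isometry hV, h4, nrm_eq_zero]
  refine ⟨hdet, fun y => ?_⟩
  set c := H⁻¹ *ᵥ y with hc
  have hy : y = H *ᵥ c := by rw [hc, Matrix.mulVec_mulVec, Matrix.mul_nonsing_inv _ hdet, Matrix.one_mulVec]
  set b := (1 + A)⁻¹ *ᵥ (V *ᵥ c) with hb
  -- For y = Hc and b = (1 + A)⁻¹Vc one has y = Vᴴb and yᴴc = bᴴ(1 + A)b. Hence the form of H⁻¹ - 1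
  -- at y is that of A at b plus ‖b‖² - ‖Vᴴb‖² ≥ 0, and a nonnegative shift keeps the sector.
  have hq : qf (H⁻¹ - 1) y = ((nrm b ^ 2 - nrm (H *ᵥ c) ^ 2 : ℝ) : ℂ) + qf A b := by
    rw [qf, Matrix.sub_mulVec, ← hc, Matrix.one_mulVec, hy, dotProduct_sub, hκ, star_dotProduct_self]
    push_cast; ring
  have hle : 0 ≤ nrm b ^ 2 - nrm (H *ᵥ c) ^ 2 := by
    have := nrm_conjTranspose_mulVec_le hV b
    rw [hb, ← hHc, ← hb] at this
    nlinarith [nrm_nonneg (H *ᵥ c)]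
  obtain ⟨h1, h2⟩ := h b
  rw [hq, Complex.add_re, Complex.add_im, Complex.ofReal_re, Complex.ofReal_im, zero_add]
  exact ⟨by linarith, h2.trans (mul_le_mul_of_nonneg_right (by linarith) hsin)⟩

/-- An eigenvector shows that 1/a - 1 lies in the closed sector; moving the vertex from 1 to s < 1
puts it strictly inside the wider open one. -/
theorem mem_lens_of_isRoot_charpoly {θ θ' s : ℝ} (h0 : 0 ≤ θ) (hθ : θ < θ') (hθ' : θ' < Real.pi / 2)
    (hs : s < 1) {H : Matrix (Fin n) (Fin n) ℂ} (hH : IsUnit H.det) (h : IsSectorial θ (H⁻¹ - 1))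
    {a : ℂ} (ha : H.charpoly.IsRoot a) : a ∈ lens s θ' := by
  rw [← Matrix.mem_spectrum_iff_isRoot_charpoly, ← Matrix.spectrum_toLin',
    ← Module.End.hasEigenvalue_iff_mem_spectrum] at ha
  obtain ⟨y, hy⟩ := ha.exists_hasEigenvector
  have hy1 : H *ᵥ y = a • y := by simpa using hy.apply_eq_smul
  have hy0 : y ≠ 0 := hy.2
  have hinv : H⁻¹ *ᵥ (H *ᵥ y) = y := by
    rw [Matrix.mulVec_mulVec, Matrix.nonsing_inv_mul _ hH, Matrix.one_mulVec]
  have ha0 : a ≠ 0 := by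
    rintro rfl
    rw [hy1, zero_smul, Matrix.mulVec_zero] at hinv
    exact hy0 hinv.symm
  have hinv' : H⁻¹ *ᵥ y = a⁻¹ • y := by
    rw [hy1, Matrix.mulVec_smul] at hinv
    conv_rhs => rw [← hinv]
    rw [smul_smul, inv_mul_cancel₀ ha0, one_smul]
  have hq : qf (H⁻¹ - 1) y = ((nrm y ^ 2 : ℝ) : ℂ) * (a⁻¹ - 1) := by
    rw [qf, Matrix.sub_mulVec, hinv', Matrix.one_mulVec, dotProduct_sub, dotProduct_smul,
      star_dotProduct_self, smul_eq_mul]; ring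
  have hN : 0 < nrm y ^ 2 := pow_pos (nrm_pos hy0) 2
  obtain ⟨h1, h2⟩ := h y
  rw [hq, Complex.re_ofReal_mul] at h1 h2
  rw [Complex.im_ofReal_mul, abs_mul, abs_of_pos hN, mul_assoc, mul_assoc] at h2
  have h1' := nonneg_of_mul_nonneg_right h1 hN
  have h2' := le_of_mul_le_mul_left h2 hN
  rw [← inv_inv a, inv_mem_lens_iff (inv_ne_zero ha0)]
  simp only [wedge, Set.mem_ofPred_eq, Complex.sub_im, Complex.sub_re, Complex.one_im, Complex.one_re,
    Complex.ofReal_re, Complex.ofReal_im, sub_zero] at h1' h2' ⊢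
  have hcos : Real.cos θ' ≤ Real.cos θ :=
    Real.cos_le_cos_of_nonneg_of_le_pi h0 (by linarith) hθ.le
  have hsin : Real.sin θ ≤ Real.sin θ' :=
    Real.sin_le_sin_of_le_of_le_pi_div_two (by linarith) hθ'.le hθ.le
  have hsin' : 0 < Real.sin θ' := Real.sin_pos_of_pos_of_lt_pi (by linarith) (by linarith)
  calc _ ≤ |(a⁻¹).im| * Real.cos θ := by gcongr
    _ ≤ ((a⁻¹).re - 1) * Real.sin θ := h2'
    _ ≤ ((a⁻¹).re - 1) * Real.sin θ' := by gcongr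
    _ < _ := by gcongr

open scoped Matrix.Norms.L2Operator in
theorem nrm_mulVec_le (A : Matrix (Fin n) (Fin n) ℂ) (x : Fin n → ℂ) :
    nrm (A *ᵥ x) ≤ ‖A‖ * nrm x :=
  Matrix.l2_opNorm_mulVec A (WithLp.toLp 2 x)

open scoped Matrix.Norms.L2Operator in
theorem norm_qf_le (A : Matrix (Fin n) (Fin n) ℂ) (x : Fin n → ℂ) :
    ‖qf A x‖ ≤ ‖A‖ * nrm x ^ 2 := by
  refine (norm_star_dotProduct_le _ _).trans ?_
  have := mul_le_mul_of_nonneg_left (nrm_mulVec_le A x) (nrm_nonneg x)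
  linarith

end
end RDArnoldi
end

/-! ### Rotation of ray integrals and the Cauchy kernel on a line. -/

noncomputable section
namespace RDArnoldi
open Set Filter Topology MeasureTheory Complex

/-- The unit complex number of argument `β`. -/
def cis (β : ℝ) : ℂ := exp (β * I)

theorem norm_cis (β : ℝ) : ‖cis β‖ = 1 := norm_exp_ofReal_mul_I β

theorem cis_add (a b : ℝ) : cis (a + b) = cis a * cis b := by
  rw [cis, cis, cis, ← exp_add]; push_cast; ring_nf

theorem cis_zero : cis 0 = 1 := by simp [cis]

theorem cis_mul_neg (a : ℝ) : cis a * cis (-a) = 1 := by rw [← cis_add, add_neg_cancel, cis_zero]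

theorem cis_ne_zero (a : ℝ) : cis a ≠ 0 := exp_ne_zero _

theorem conj_cis (a : ℝ) : (starRingEnd ℂ) (cis a) = cis (-a) := by
  rw [cis, cis, ← exp_conj]; simp

theorem cis_re (a : ℝ) : (cis a).re = Real.cos a := exp_ofReal_mul_I_re a

theorem cis_im (a : ℝ) : (cis a).im = Real.sin a := exp_ofReal_mul_I_im a

theorem integrableOn_of_norm_le {F : ℝ → ℂ} (hF : ContinuousOn F (Ioi 0)) {C : ℝ}
    (h : ∀ r > 0, ‖F r‖ ≤ C / (1 + r) ^ 2) : IntegrableOn F (Ioi 0) := by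
  refine Integrable.mono' (g := fun r => |C| * (1 + r ^ 2)⁻¹)
    ((integrable_inv_one_add_sq.const_mul _).integrableOn)
    (hF.aestronglyMeasurable measurableSet_Ioi) ?_
  filter_upwards [ae_restrict_mem measurableSet_Ioi] with r hr
  have hr : (0 : ℝ) < r := hr
  refine (h r hr).trans ?_
  rw [div_eq_mul_inv]
  refine mul_le_mul (le_abs_self C) (inv_anti₀ (by positivity) ?_) (by positivity) (abs_nonneg _)
  nlinarith

theorem one_add_norm_le_mul {z p : ℂ} {c : ℝ} (hc : 0 < c) (h : c ≤ ‖z - p‖) :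
    1 + ‖z‖ ≤ ((1 + ‖p‖) / c + 1) * ‖z - p‖ := by
  have h1 : ‖z‖ ≤ ‖z - p‖ + ‖p‖ := by simpa using norm_add_le (z - p) p
  have h2 : (1 + ‖p‖) ≤ (1 + ‖p‖) / c * ‖z - p‖ := by
    rw [div_mul_eq_mul_div, le_div_iff₀ hc]
    exact mul_le_mul_of_nonneg_left h (by positivity)
  linarith

/-- Integrals of a holomorphic function along rays may be rotated. -/
theorem integral_ray_eq {h : ℂ → ℂ} {β₁ β₂ C : ℝ} (hβ : β₁ ≤ β₂)
    (hd : ∀ r : ℝ, 0 < r → ∀ β ∈ Icc β₁ β₂, DifferentiableAt ℂ h (r * cis β))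
    (hC : ∀ r : ℝ, 0 < r → ∀ β ∈ Icc β₁ β₂, ‖h (r * cis β)‖ ≤ C / (1 + r) ^ 2) :
    ∫ r in Ioi (0 : ℝ), h (r * cis β₁) * cis β₁ = ∫ r in Ioi (0 : ℝ), h (r * cis β₂) * cis β₂ := by
  -- Under z = e^ζ rays become horizontal lines and the sector a strip. The decay hypothesis gives
  -- |F| ≤ C e^{-|x|}, so the vertical sides of Cauchy's rectangle vanish in the limit.
  let F : ℂ → ℂ := fun ζ => h (exp ζ) * exp ζ
  have hexp : ∀ x y : ℝ, exp (x + y * I) = (Real.exp x : ℂ) * cis y := fun x y => by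
    rw [exp_add, cis, ofReal_exp]
  have hC0 : 0 ≤ C := by
    have := (norm_nonneg _).trans (hC 1 one_pos β₁ (left_mem_Icc.mpr hβ))
    by_contra! hneg
    exact absurd this (not_le.mpr (div_neg_of_neg_of_pos hneg (by positivity)))
  have hray : ∀ β ∈ Icc β₁ β₂,
      IntegrableOn (fun r : ℝ => h (r * cis β) * cis β) (Ioi 0) := fun β hb => by
    refine integrableOn_of_norm_le (C := C) (fun r hr => ?_) fun r hr => ?_
    · have h1 : ContinuousAt (fun r : ℝ => h (r * cis β)) r :=
        ContinuousAt.comp (f := fun r : ℝ => (r : ℂ) * cis β) (hd r hr β hb).continuousAt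
          (by fun_prop)
      exact (h1.mul continuousAt_const).continuousWithinAt
    · rw [norm_mul, norm_cis, mul_one]; exact hC r hr β hb
  have himg : Real.exp '' univ = Ioi 0 := by rw [image_univ, Real.range_exp]
  have hFeq : ∀ β : ℝ, (fun x : ℝ => |Real.exp x| • (h (Real.exp x * cis β) * cis β)) =
      fun x : ℝ => F (x + β * I) := fun β => by
    funext x
    simp only [F, hexp, abs_of_pos (Real.exp_pos x), real_smul]
    ring
  have hFint : ∀ β ∈ Icc β₁ β₂, Integrable fun x : ℝ => F (x + β * I) := fun β hb => by
    have := (integrableOn_image_iff_integrableOn_abs_deriv_smul MeasurableSet.univ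
      (fun x _ => (Real.hasDerivAt_exp x).hasDerivWithinAt) Real.exp_injective.injOn
      (fun r : ℝ => h (r * cis β) * cis β)).mp (by rw [himg]; exact hray β hb)
    rwa [hFeq, integrableOn_univ] at this
  have hFval : ∀ β : ℝ, ∫ r in Ioi (0 : ℝ), h (r * cis β) * cis β = ∫ x : ℝ, F (x + β * I) :=
    fun β => by
    have := integral_image_eq_integral_abs_deriv_smul MeasurableSet.univ
      (fun x _ => (Real.hasDerivAt_exp x).hasDerivWithinAt) Real.exp_injective.injOn
      (fun r : ℝ => h (r * cis β) * cis β)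
    rw [himg, hFeq, setIntegral_univ] at this
    exact this
  have hlim : ∀ β ∈ Icc β₁ β₂, Tendsto (fun S : ℝ => ∫ x in (-S)..S, F (x + β * I)) atTop
      (𝓝 (∫ x : ℝ, F (x + β * I))) := fun β hb =>
    intervalIntegral_tendsto_integral (hFint β hb) tendsto_neg_atTop_atBot tendsto_id
  have hbound : ∀ x y : ℝ, y ∈ Icc β₁ β₂ → ‖F (x + y * I)‖ ≤ C * Real.exp (-|x|) := fun x y hy => by
    have h1 := hC (Real.exp x) (Real.exp_pos x) y hy
    simp only [F, hexp]
    rw [norm_mul, norm_mul, norm_cis, mul_one, norm_real, Real.norm_of_nonneg (Real.exp_pos x).le]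
    have h2 : Real.exp x / (1 + Real.exp x) ^ 2 ≤ Real.exp (-|x|) := by
      have hp := Real.exp_pos x
      rw [div_le_iff₀ (by positivity)]
      rcases le_or_gt 0 x with hx | hx
      · rw [abs_of_nonneg hx, Real.exp_neg, inv_mul_eq_div, le_div_iff₀ hp]; nlinarith
      · rw [abs_of_neg hx, neg_neg]
        exact le_mul_of_one_le_right hp.le (one_le_pow₀ (by linarith))
    calc _ ≤ C / (1 + Real.exp x) ^ 2 * Real.exp x := by gcongr
      _ = C * (Real.exp x / (1 + Real.exp x) ^ 2) := by ring
      _ ≤ _ := by gcongr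
  have hside : ∀ σ : ℝ → ℝ, (∀ S, |σ S| = |S|) →
      Tendsto (fun S : ℝ => ∫ y in β₁..β₂, F (σ S + y * I)) atTop (𝓝 0) := fun σ hσ => by
    refine squeeze_zero_norm (a := fun S => C * Real.exp (-|S|) * |β₂ - β₁|) (fun S => ?_) ?_
    · refine intervalIntegral.norm_integral_le_of_norm_le_const fun y hy => ?_
      rw [uIoc_of_le hβ] at hy
      have := hbound (σ S) y ⟨hy.1.le, hy.2⟩
      rwa [hσ] at this
    · have : Tendsto (fun S : ℝ => Real.exp (-|S|)) atTop (𝓝 0) :=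
        Real.tendsto_exp_neg_atTop_nhds_zero.comp tendsto_abs_atTop_atTop
      simpa using (this.const_mul C).mul_const |β₂ - β₁|
  have hrect : ∀ S : ℝ, (∫ x in (-S)..S, F (x + β₁ * I)) - (∫ x in (-S)..S, F (x + β₂ * I)) +
      I • (∫ y in β₁..β₂, F (S + y * I)) - I • (∫ y in β₁..β₂, F ((-S : ℝ) + y * I)) = 0 :=
    fun S => by
    have := integral_boundary_rect_eq_zero_of_differentiableOn F ((-S : ℝ) + β₁ * I)
      ((S : ℝ) + β₂ * I) fun ζ hζ => by
        have him : ζ.im ∈ Icc β₁ β₂ := by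
          have := hζ.2
          simpa [uIcc_of_le hβ] using this
        have h1 := hd (Real.exp ζ.re) (Real.exp_pos _) ζ.im him
        rw [← hexp, re_add_im] at h1
        exact ((h1.comp ζ differentiable_exp.differentiableAt).mul
          differentiable_exp.differentiableAt).differentiableWithinAt
    simpa using this
  have h1 := (((hlim β₁ (left_mem_Icc.mpr hβ)).sub (hlim β₂ (right_mem_Icc.mpr hβ))).add
    ((hside id fun _ => rfl).const_smul I)).sub ((hside (fun S => -S) fun S => abs_neg S).const_smul I)
  have h2 := tendsto_nhds_unique (h1.congr fun S => hrect S) tendsto_const_nhds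
  rw [hFval, hFval]
  simpa [sub_eq_zero] using h2

/-- Both logarithms are log r + o(1). The imaginary parts are nonzero so that the principal branch
splits as log r + log(1 + p/r). -/
theorem tendsto_log_sub_log (p q : ℂ) (hp : p.im ≠ 0) (hq : q.im ≠ 0) :
    Tendsto (fun r : ℝ => log (r - p) - log (r + q)) atTop (𝓝 0) := by
  have h1 : ∀ p : ℂ, Tendsto (fun r : ℝ => log (1 + p / r)) atTop (𝓝 0) := fun p => by
    have h2 : Tendsto (fun r : ℝ => 1 + p / (r : ℂ)) atTop (𝓝 (1 + 0)) := by
      refine tendsto_const_nhds.add ?_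
      have : Tendsto (fun r : ℝ => ((r⁻¹ : ℝ) : ℂ)) atTop (𝓝 ((0 : ℝ) : ℂ)) :=
        (continuous_ofReal.tendsto 0).comp tendsto_inv_atTop_zero
      simpa [div_eq_mul_inv] using this.const_mul p
    rw [add_zero] at h2
    have h3 := (continuousAt_clog one_mem_slitPlane).tendsto.comp h2
    rwa [log_one] at h3
  have h4 := (h1 (-p)).sub (h1 q)
  rw [sub_zero] at h4
  refine h4.congr' ?_
  filter_upwards [eventually_gt_atTop 0] with r hr
  have hrC : (r : ℂ) ≠ 0 := by exact_mod_cast hr.ne'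
  have h5 : ∀ p : ℂ, p.im ≠ 0 → log (r + p) = Real.log r + log (1 + p / r) := fun p hp => by
    rw [← log_ofReal_mul hr]
    · congr 1; field_simp
    · intro h
      have := congrArg im h
      simp [div_ofReal_im] at this
      exact hp (this.resolve_right hr.ne')
  rw [sub_eq_add_neg (r : ℂ) p, h5 _ (by simpa using hp), h5 q hq]
  ring

theorem hasDerivAt_log_sub {p : ℂ} (hp : p.im ≠ 0) (r : ℝ) :
    HasDerivAt (fun r : ℝ => log (r - p)) (1 / (r - p)) r := by
  have h1 : (r : ℂ) - p ∈ slitPlane := by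
    rw [mem_slitPlane_iff]; right; simpa using hp
  have := (ofRealCLM.hasDerivAt (x := r)).sub_const p |>.clog_real h1
  simpa using this

theorem abs_im_le_norm_sub (r : ℝ) (p : ℂ) : |p.im| ≤ ‖(r : ℂ) - p‖ := by
  have := abs_im_le_norm ((r : ℂ) - p)
  simpa using this

/-- The Poisson kernel of the half plane has total mass `π`. -/
theorem tendsto_integral_inv_sub {p : ℂ} (hp : 0 < p.im) :
    Tendsto (fun R : ℝ => ∫ r in (-R)..R, 1 / ((r : ℂ) - p)) atTop (𝓝 (Real.pi * I)) := by
  have h1 : ∀ R : ℝ, ∫ r in (-R)..R, 1 / ((r : ℂ) - p) =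
      (log (R - p) - log (R + p)) + Real.pi * I := fun R => by
    rw [intervalIntegral.integral_eq_sub_of_hasDerivAt (fun r _ => hasDerivAt_log_sub hp.ne' r)]
    · have h2 : log (((-R : ℝ) : ℂ) - p) = log (R + p) - Real.pi * I := by
        have h3 : ((-R : ℝ) : ℂ) - p = -(R + p) := by push_cast; ring
        have h4 : 0 < ((R : ℂ) + p).im := by simpa using hp
        rw [h3, log, log, norm_neg, arg_neg_eq_arg_sub_pi_of_im_pos h4]
        push_cast; ring
      rw [h2]; ring
    · refine ContinuousOn.intervalIntegrable fun r _ => ?_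
      refine ContinuousAt.continuousWithinAt (ContinuousAt.div continuousAt_const (by fun_prop) ?_)
      intro h0
      have := abs_im_le_norm_sub r p
      rw [h0, norm_zero, abs_of_pos hp] at this
      linarith
  have h2 := (tendsto_log_sub_log p p hp.ne' hp.ne').add_const (Real.pi * I : ℂ)
  rw [zero_add] at h2
  exact h2.congr fun R => (h1 R).symm

theorem tendsto_integral_inv_sub_neg {p : ℂ} (hp : p.im < 0) :
    Tendsto (fun R : ℝ => ∫ r in (-R)..R, 1 / ((r : ℂ) - p)) atTop (𝓝 (-(Real.pi * I))) := by
  have h := (continuous_conj.tendsto _).comp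
    (tendsto_integral_inv_sub (p := (starRingEnd ℂ) p) (by simpa using hp))
  have h2 : (starRingEnd ℂ) (Real.pi * I) = -(Real.pi * I) := by simp
  rw [h2] at h
  refine h.congr fun R => ?_
  simp only [Function.comp]
  simp only [intervalIntegral, map_sub, ← integral_conj]
  simp

end RDArnoldi
end

/-! ### Cauchy's formula for a sector. -/

noncomputable section
namespace RDArnoldi
open Set Filter Topology MeasureTheory Complex

/-- Holomorphic functions on a sector that decay like `1 / ‖z‖` and are bounded near the vertex. -/
structure Admissible (θ : ℝ) (f : ℂ → ℂ) : Prop where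
  differentiableOn : DifferentiableOn ℂ f (wedge θ)
  decay : ∃ C, 0 ≤ C ∧ ∀ z ∈ wedge θ, ‖f z‖ ≤ C / (1 + ‖z‖)

theorem mem_wedge_iff {α : ℝ} (hα : 0 ≤ Real.cos α) {u : ℂ} :
    u ∈ wedge α ↔ 0 < (cis α * u).im ∧ (cis (-α) * u).im < 0 := by
  simp only [wedge, mem_ofPred_eq, mul_im, cis_re, cis_im, Real.cos_neg, Real.sin_neg]
  rw [← abs_of_nonneg hα, ← abs_mul, abs_of_nonneg hα, abs_lt]
  constructor
  · rintro ⟨h1, h2⟩; constructor <;> linarith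
  · rintro ⟨h1, h2⟩; constructor <;> linarith

theorem ray_mem_wedge {r β θ : ℝ} (hr : 0 < r) (hβ : |β| < θ) (hθ : θ < Real.pi) :
    (r : ℂ) * cis β ∈ wedge θ := by
  have hs : |Real.sin β| = Real.sin |β| := by
    rcases le_or_gt 0 β with ha | ha
    · rw [abs_of_nonneg ha] at hβ ⊢
      rw [abs_of_nonneg (Real.sin_nonneg_of_nonneg_of_le_pi ha (by linarith))]
    · rw [abs_of_neg ha] at hβ ⊢
      rw [Real.sin_neg, abs_of_nonpos]
      exact Real.sin_nonpos_of_nonpos_of_neg_pi_le ha.le (by linarith)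
  have h1 : 0 < Real.sin (θ - |β|) :=
    Real.sin_pos_of_pos_of_lt_pi (by linarith) (by linarith [abs_nonneg β])
  rw [Real.sin_sub, Real.cos_abs, ← hs] at h1
  simp only [wedge, mem_ofPred_eq, re_ofReal_mul, im_ofReal_mul, cis_re, cis_im, abs_mul,
    abs_of_pos hr]
  nlinarith

theorem exists_polar {θ : ℝ} (h0 : 0 < θ) (hθ : θ < Real.pi / 2) {u : ℂ} (hu : u ∈ wedge θ) :
    ‖u‖ * cis (arg u) = u ∧ |arg u| < θ ∧ 0 < ‖u‖ := by
  have hc := Real.cos_pos_of_mem_Ioo ⟨by linarith [Real.pi_pos], hθ⟩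
  have hs := Real.sin_pos_of_pos_of_lt_pi h0 (by linarith)
  have hre := re_pos_of_mem_wedge hc.le hs.le hu
  have hu0 : 0 < ‖u‖ := norm_pos_iff.mpr (by rintro rfl; simp at hre)
  refine ⟨norm_mul_exp_arg_mul_I u, ?_, hu0⟩
  have h1 := norm_mul_cos_lt_re hc.le hs.le hu
  rw [← norm_mul_cos_arg u, ← Real.cos_abs (arg u)] at h1
  have h2 := lt_of_mul_lt_mul_left h1 hu0.le
  by_contra! h3
  exact absurd (Real.cos_le_cos_of_nonneg_of_le_pi h0.le (abs_arg_le_pi u) h3) (not_le.mpr h2)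

theorem norm_ray {r β : ℝ} (hr : 0 < r) : ‖(r : ℂ) * cis β‖ = r := by
  rw [norm_mul, norm_cis, mul_one, norm_real, Real.norm_of_nonneg hr.le]

theorem continuousOn_ray {θ β : ℝ} {f : ℂ → ℂ} (hf : DifferentiableOn ℂ f (wedge θ)) (hβ : |β| < θ)
    (hθ : θ < Real.pi) : ContinuousOn (fun r : ℝ => f (r * cis β)) (Ioi 0) :=
  hf.continuousOn.comp (by fun_prop) fun _ hr => ray_mem_wedge hr hβ hθ

theorem ofReal_sub_ne_zero (r : ℝ) {p : ℂ} (hp : p.im ≠ 0) : (r : ℂ) - p ≠ 0 := fun h => by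
  have := abs_im_le_norm_sub r p
  rw [h, norm_zero] at this
  exact hp (abs_eq_zero.mp (le_antisymm this (abs_nonneg _)))

theorem one_add_le_mul_norm_sub {r : ℝ} (hr : 0 < r) {p : ℂ} (hp : p.im ≠ 0) :
    1 + r ≤ ((1 + ‖p‖) / |p.im| + 1) * ‖(r : ℂ) - p‖ := by
  have := one_add_norm_le_mul (abs_pos.mpr hp) (abs_im_le_norm_sub r p)
  rwa [norm_real, Real.norm_of_nonneg hr.le] at this

theorem Admissible.integrableOn {θ β : ℝ} {f : ℂ → ℂ} (hf : Admissible θ f) (hβ : |β| < θ)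
    (hθ : θ < Real.pi) {p : ℂ} (hp : p.im ≠ 0) :
    IntegrableOn (fun r : ℝ => f (r * cis β) / (r - p)) (Ioi 0) := by
  obtain ⟨C, hC0, hC⟩ := hf.decay
  refine integrableOn_of_norm_le (C := C * ((1 + ‖p‖) / |p.im| + 1)) ?_ fun r hr => ?_
  · exact (continuousOn_ray hf.differentiableOn hβ hθ).div (by fun_prop)
      fun r _ => ofReal_sub_ne_zero r hp
  · have h1 := hC _ (ray_mem_wedge hr hβ hθ)
    rw [norm_ray hr] at h1
    have h2 := one_add_le_mul_norm_sub hr hp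
    have h3 : 0 < ‖(r : ℂ) - p‖ := norm_pos_iff.mpr (ofReal_sub_ne_zero r hp)
    rw [norm_div, div_le_iff₀ h3]
    refine h1.trans ?_
    rw [div_mul_eq_mul_div, div_le_div_iff₀ (by positivity) (by positivity)]
    have := mul_le_mul_of_nonneg_left h2 (mul_nonneg hC0 (by positivity : (0:ℝ) ≤ 1 + r))
    linarith

theorem integral_inv_sub_sub_inv_add {p q : ℂ} (hp : p.im ≠ 0) (hq : q.im ≠ 0) :
    IntegrableOn (fun r : ℝ => 1 / (r - p) - 1 / (r + q)) (Ioi 0) ∧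
    ∫ r in Ioi (0 : ℝ), (1 / (r - p) - 1 / (r + q)) = log q - log (-p) := by
  have hq' : (-q).im ≠ 0 := by simpa using hq
  have hadd : ∀ r : ℝ, (r : ℂ) + q = r - -q := fun r => by ring
  have hint : IntegrableOn (fun r : ℝ => 1 / (r - p) - 1 / (r + q)) (Ioi 0) := by
    refine integrableOn_of_norm_le (C := ‖p + q‖ * (((1 + ‖p‖) / |p.im| + 1) *
      ((1 + ‖-q‖) / |(-q).im| + 1))) ?_ fun r hr => ?_
    · refine ContinuousOn.sub ?_ ?_
      · exact continuousOn_const.div (by fun_prop) fun r _ => ofReal_sub_ne_zero r hp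
      · exact continuousOn_const.div (by fun_prop) fun r _ => by
          rw [hadd]; exact ofReal_sub_ne_zero r hq'
    · have h1 := one_add_le_mul_norm_sub hr hp
      have h2 := one_add_le_mul_norm_sub hr hq'
      have h3 := ofReal_sub_ne_zero r hp
      have h4 := ofReal_sub_ne_zero r hq'
      rw [hadd, div_sub_div _ _ h3 h4, show (1 : ℂ) * (r - -q) - (r - p) * 1 = p + q by ring,
        norm_div, norm_mul, div_le_div_iff₀ (mul_pos (norm_pos_iff.mpr h3) (norm_pos_iff.mpr h4))
        (by positivity)]
      calc ‖p + q‖ * (1 + r) ^ 2 = ‖p + q‖ * ((1 + r) * (1 + r)) := by ring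
        _ ≤ ‖p + q‖ * ((((1 + ‖p‖) / |p.im| + 1) * ‖(r : ℂ) - p‖) *
            (((1 + ‖-q‖) / |(-q).im| + 1) * ‖(r : ℂ) - -q‖)) := by gcongr
        _ = _ := by ring
  refine ⟨hint, ?_⟩
  have hder : ∀ r ∈ Ici (0 : ℝ), HasDerivAt (fun r : ℝ => log (r - p) - log (r + q))
      (1 / (r - p) - 1 / (r + q)) r := fun r _ => by
    simp only [hadd]
    exact (hasDerivAt_log_sub hp r).sub (hasDerivAt_log_sub hq' r)
  rw [integral_Ioi_of_hasDerivAt_of_tendsto' hder hint (tendsto_log_sub_log p q hp hq)]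
  simp

/-- Cauchy's integral formula for a sector. -/
theorem cauchy_wedge {θ α : ℝ} (hα : 0 < α) (hαθ : α < θ) (hθ : θ < Real.pi / 2) {f : ℂ → ℂ}
    (hf : Admissible θ f) {d : ℂ} (hd : d ∈ wedge α) :
    (∫ r in Ioi (0 : ℝ), f (r * cis (-α)) / (r - cis α * d)) -
      ∫ r in Ioi (0 : ℝ), f (r * cis α) / (r - cis (-α) * d) = 2 * Real.pi * I * f d := by
  have hpi := Real.pi_pos
  have hcα := Real.cos_pos_of_mem_Ioo ⟨by linarith, (by linarith : α < Real.pi / 2)⟩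
  have hcθ := Real.cos_pos_of_mem_Ioo ⟨by linarith, hθ⟩
  have hsθ := Real.sin_pos_of_pos_of_lt_pi (by linarith : 0 < θ) (by linarith)
  obtain ⟨hp, hp'⟩ := (mem_wedge_iff hcα.le).mp hd
  obtain ⟨hpol, harg, hdn⟩ := exists_polar hα (by linarith) hd
  rw [abs_lt] at harg
  have hdθ : d ∈ wedge θ := by
    rw [← hpol]; exact ray_mem_wedge hdn (abs_lt.mpr ⟨by linarith, by linarith⟩) (by linarith)
  -- Subtracting f(d)(1 + d)/(1 + z) makes F vanish at d while preserving the 1/|z| decay. Hence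
  -- F(z)/(z - d) is holomorphic and of order |z|⁻², and its integrals along the two boundary rays
  -- agree; the subtracted part is integrated by logarithms.
  let F : ℂ → ℂ := fun z => f z - f d * (1 + d) / (1 + z)
  have h1z : ∀ z ∈ wedge θ, (1 + ‖z‖) / 2 ≤ ‖1 + z‖ := fun z hz => by
    have hre := re_pos_of_mem_wedge hcθ.le hsθ.le hz
    have h2 : ‖1 + z‖ ^ 2 = 1 + 2 * z.re + ‖z‖ ^ 2 := by
      rw [← normSq_eq_norm_sq, ← normSq_eq_norm_sq, normSq_apply, normSq_apply]
      simp only [add_re, add_im, one_re, one_im]; ring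
    refine abs_le_of_sq_le_sq' ?_ (norm_nonneg _) |>.2
    nlinarith [sq_nonneg (1 - ‖z‖), norm_nonneg z]
  have h1z0 : ∀ z ∈ wedge θ, 1 + z ≠ 0 := fun z hz => by
    refine norm_pos_iff.mp (lt_of_lt_of_le ?_ (h1z z hz)); positivity
  have hF : DifferentiableOn ℂ F (wedge θ) :=
    hf.differentiableOn.sub ((differentiableOn_const _).div (by fun_prop) h1z0)
  have hFd : F d = 0 := by simp only [F]; rw [mul_div_cancel_right₀ _ (h1z0 d hdθ), sub_self]
  have hh : DifferentiableOn ℂ (dslope F d) (wedge θ) :=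
    (differentiableOn_dslope ((isOpen_wedge θ).mem_nhds hdθ)).mpr hF
  have hslope : ∀ z, z ≠ d → dslope F d z = F z / (z - d) := fun z hz => by
    rw [dslope_of_ne _ hz, slope_def_field, hFd, sub_zero]
  obtain ⟨C, hC0, hC⟩ := hf.decay
  obtain ⟨ρ, hρ, hball⟩ := Metric.nhds_basis_closedBall.mem_iff.mp ((isOpen_wedge θ).mem_nhds hdθ)
  obtain ⟨B, hB⟩ := (isCompact_closedBall d ρ).exists_bound_of_continuousOn
    (hh.continuousOn.mono hball)
  have hB0 : 0 ≤ B := (norm_nonneg _).trans (hB d (Metric.mem_closedBall_self hρ.le))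
  have hbound : ∀ z ∈ wedge θ, ‖dslope F d z‖ ≤ (B * (1 + ‖d‖ + ρ) ^ 2 +
      (C + ‖f d * (1 + d)‖ * 2) * ((1 + ‖d‖) / ρ + 1)) / (1 + ‖z‖) ^ 2 := fun z hz => by
    rw [add_div]
    rcases le_or_gt ‖z - d‖ ρ with hzd | hzd
    · have hz' : z ∈ Metric.closedBall d ρ := by rwa [mem_closedBall_iff_norm]
      have h3 : ‖z‖ ≤ ‖d‖ + ρ := by
        have := norm_add_le (z - d) d
        rw [sub_add_cancel] at this; linarith
      refine (hB z hz').trans (le_add_of_le_of_nonneg ?_ (by positivity))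
      rw [le_div_iff₀ (by positivity)]
      have h4 : 1 + ‖z‖ ≤ 1 + ‖d‖ + ρ := by linarith
      gcongr
    · have hzne : z ≠ d := by rintro rfl; simp at hzd; linarith
      have h3 := one_add_norm_le_mul hρ hzd.le
      rw [hslope z hzne, norm_div]
      refine le_add_of_nonneg_of_le (by positivity) ?_
      have h4 : ‖F z‖ ≤ (C + ‖f d * (1 + d)‖ * 2) / (1 + ‖z‖) := by
        refine (norm_sub_le _ _).trans ?_
        rw [add_div]
        refine add_le_add (hC z hz) ?_
        rw [norm_div, div_le_div_iff₀ (norm_pos_iff.mpr (h1z0 z hz)) (by positivity)]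
        have := mul_le_mul_of_nonneg_left (h1z z hz) (norm_nonneg (f d * (1 + d)))
        linarith
      rw [div_le_div_iff₀ (by linarith) (by positivity)]
      have h5 := (le_div_iff₀ (by positivity)).mp h4
      calc ‖F z‖ * (1 + ‖z‖) ^ 2 = (‖F z‖ * (1 + ‖z‖)) * (1 + ‖z‖) := by ring
        _ ≤ (C + ‖f d * (1 + d)‖ * 2) * (((1 + ‖d‖) / ρ + 1) * ‖z - d‖) := by gcongr
        _ = _ := by ring
  have hβ : ∀ β ∈ Icc (-α) α, |β| < θ := fun β hb => (abs_le.mpr hb).trans_lt hαθ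
  have hrot := integral_ray_eq (h := dslope F d) (by linarith : -α ≤ α)
    (fun r hr β hb => hh.differentiableAt ((isOpen_wedge θ).mem_nhds
      (ray_mem_wedge hr (hβ β hb) (by linarith))))
    (fun r hr β hb => by
      have := hbound _ (ray_mem_wedge hr (hβ β hb) (by linarith))
      rwa [norm_ray hr] at this)
  have hpt : ∀ β, |β| < θ → (cis (-β) * d).im ≠ 0 → ∀ r : ℝ, 0 < r →
      dslope F d (r * cis β) * cis β = f (r * cis β) / (r - cis (-β) * d) -
        f d * (1 / (r - cis (-β) * d) - 1 / (r + cis (-β))) := fun β hb him r hr => by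
    have hcc := cis_mul_neg β
    have h3 := ofReal_sub_ne_zero r him
    have hz : (r : ℂ) * cis β - d = cis β * (r - cis (-β) * d) := by
      linear_combination d * hcc
    have hzne : (r : ℂ) * cis β ≠ d := fun h => by
      rw [h, sub_self] at hz
      exact (mul_ne_zero (cis_ne_zero β) h3) hz.symm
    have hw := h1z0 _ (ray_mem_wedge hr hb (by linarith))
    have hz2 : 1 + (r : ℂ) * cis β = cis β * (r + cis (-β)) := by
      linear_combination -hcc
    have h4 : (r : ℂ) + cis (-β) ≠ 0 := fun h => hw (by rw [hz2, h, mul_zero])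
    rw [hslope _ hzne, hz]
    simp only [F]
    rw [hz2]
    have hcβ := cis_ne_zero β
    have hAB : ((r : ℂ) + cis (-β)) - (r - cis (-β) * d) = cis (-β) * (1 + d) := by ring
    generalize (r : ℂ) + cis (-β) = q, (r : ℂ) - cis (-β) * d = p at *
    field_simp
    linear_combination f d * cis β * hAB + f d * (1 + d) * hcc
  have hint : ∀ β, |β| < θ → (cis (-β) * d).im ≠ 0 → (cis (-β)).im ≠ 0 →
      ∫ r in Ioi (0 : ℝ), dslope F d (r * cis β) * cis β =
      (∫ r in Ioi (0 : ℝ), f (r * cis β) / (r - cis (-β) * d)) -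
        f d * (log (cis (-β)) - log (-(cis (-β) * d))) := fun β hb him him2 => by
    obtain ⟨h5, h6⟩ := integral_inv_sub_sub_inv_add him him2
    rw [← h6, ← integral_const_mul, ← integral_sub (hf.integrableOn hb (by linarith) him)
      (h5.const_mul _)]
    exact setIntegral_congr_fun measurableSet_Ioi fun r hr => hpt β hb him r hr
  have hsα := Real.sin_pos_of_pos_of_lt_pi hα (by linarith)
  rw [hint (-α) (by rw [abs_neg, abs_of_pos hα]; exact hαθ) (by rw [neg_neg]; exact hp.ne')
      (by rw [neg_neg, cis_im]; exact hsα.ne'),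
    hint α (by rw [abs_of_pos hα]; exact hαθ) hp'.ne
      (by rw [cis_im, Real.sin_neg]; exact (neg_neg_of_pos hsα).ne), neg_neg] at hrot
  have hlog : ∀ β : ℝ, -Real.pi < β → β ≤ Real.pi → log (cis β) = β * I := fun β h1 h2 => by
    rw [cis, log_exp] <;> simpa
  have hd0 : d ≠ 0 := norm_pos_iff.mp hdn
  have hlogd : ∀ β : ℝ, -Real.pi < β + arg d → β + arg d ≤ Real.pi →
      log (cis β * d) = β * I + log d := fun β h1 h2 => by
    have : cis β * d = exp (β * I + log d) := by rw [exp_add, exp_log hd0, cis]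
    rw [this, log_exp]
    · simpa [log_im] using h1
    · simpa [log_im] using h2
  have hm1 : ∀ β, -(cis β * d) = cis (β - Real.pi) * d ∧ -(cis β * d) = cis (β + Real.pi) * d :=
    fun β => by
    have h1 : cis Real.pi = -1 := by rw [cis, exp_pi_mul_I]
    have h2 : cis (-Real.pi) = -1 := by
      have := cis_mul_neg Real.pi
      rw [h1] at this; linear_combination -this
    constructor
    · rw [sub_eq_add_neg, cis_add, h2]; ring
    · rw [cis_add, h1]; ring
  -- The logarithms contribute πi - log d on one ray and -πi - log d on the other. The shifts by ∓π
  -- keep both arguments in the principal range, and the difference is 2πi.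
  rw [hlog α (by linarith) (by linarith), hlog (-α) (by linarith) (by linarith), (hm1 α).1,
    (hm1 (-α)).2, hlogd _ (by linarith) (by linarith), hlogd _ (by linarith) (by linarith)] at hrot
  push_cast at hrot
  linear_combination hrot

end RDArnoldi
end

/-! ### The Cauchy transform of the conjugate of f. -/

noncomputable section
namespace RDArnoldi
open Set Filter Topology MeasureTheory Complex

/-- A nonnegative function whose symmetric integrals converge is integrable on the half line, with
at most the full mass. The symmetric limits are exactly the principal values known for the Cauchy
kernel. -/
theorem integrableOn_Ioi_of_tendsto {F : ℝ → ℝ} (hF : Continuous F) (h0 : ∀ r, 0 ≤ F r) {c : ℝ}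
    (hc : Tendsto (fun R : ℝ => ∫ r in (-R)..R, F r) atTop (𝓝 c)) :
    IntegrableOn F (Ioi 0) ∧ ∫ r in Ioi (0 : ℝ), F r ≤ c := by
  have hi : ∀ a b, IntervalIntegrable F volume a b := fun a b => hF.intervalIntegrable a b
  have hle : ∀ᶠ R : ℝ in atTop, ∫ r in (0 : ℝ)..R, F r ≤ ∫ r in (-R)..R, F r := by
    filter_upwards [eventually_ge_atTop 0] with R hR
    rw [← intervalIntegral.integral_add_adjacent_intervals (hi (-R) 0) (hi 0 R)]
    exact le_add_of_nonneg_left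
      (intervalIntegral.integral_nonneg (by linarith) fun r _ => h0 r)
  have hint : IntegrableOn F (Ioi 0) := by
    refine integrableOn_Ioi_of_intervalIntegral_norm_bounded (c + 1) 0
      (fun R : ℝ => (hF.integrableOn_Icc (a := 0) (b := R)).mono_set Ioc_subset_Icc_self)
      tendsto_id ?_
    filter_upwards [hle, hc.eventually_le_const (lt_add_one c)] with R h1 h2
    simp only [Real.norm_of_nonneg (h0 _)]
    exact h1.trans h2
  exact ⟨hint, le_of_tendsto_of_tendsto
    (intervalIntegral_tendsto_integral_Ioi 0 hint tendsto_id) hc hle⟩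

theorem integral_im_inv_sub_le {p : ℂ} (hp : 0 < p.im) :
    IntegrableOn (fun r : ℝ => (1 / ((r : ℂ) - p)).im) (Ioi 0) ∧
      ∫ r in Ioi (0 : ℝ), (1 / ((r : ℂ) - p)).im ≤ Real.pi := by
  have hcont : Continuous fun r : ℝ => 1 / ((r : ℂ) - p) :=
    continuous_const.div (by fun_prop) fun r => ofReal_sub_ne_zero r hp.ne'
  refine integrableOn_Ioi_of_tendsto (continuous_im.comp hcont) (fun r => ?_) ?_
  · simp only [Function.comp_apply, one_div, inv_im, sub_im, ofReal_im, zero_sub, neg_neg]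
    exact div_nonneg hp.le (normSq_nonneg _)
  · have h := (continuous_im.tendsto _).comp (tendsto_integral_inv_sub hp)
    have h2 : (Real.pi * I : ℂ).im = Real.pi := by simp
    rw [h2] at h
    refine h.congr fun R => ?_
    exact (imCLM.intervalIntegral_comp_comm (hcont.intervalIntegrable _ _)).symm

theorem differentiableAt_integral_div_sub {F : ℝ → ℂ} (hF : ContinuousOn F (Ioi 0)) {C : ℝ}
    (hC0 : 0 ≤ C) (hC : ∀ r > 0, ‖F r‖ ≤ C / (1 + r)) {p : ℂ} (hp : p.im ≠ 0) :
    DifferentiableAt ℂ (fun p => ∫ r in Ioi (0 : ℝ), F r / (r - p)) p := by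
  set c := |p.im| / 2 with hc
  have hc0 : 0 < c := half_pos (abs_pos.mpr hp)
  set K := (1 + (‖p‖ + c)) / c + 1 with hK
  have hball : ∀ q ∈ Metric.ball p c, ∀ r : ℝ, 0 < r → c ≤ ‖(r : ℂ) - q‖ ∧
      1 + r ≤ K * ‖(r : ℂ) - q‖ := fun q hq r hr => by
    rw [mem_ball_iff_norm] at hq
    have h1 : |p.im| - |q.im| ≤ c := by
      refine (abs_sub_abs_le_abs_sub _ _).trans ?_
      rw [abs_sub_comm, ← sub_im]
      exact (abs_im_le_norm _).trans hq.le
    have h2 : c ≤ ‖(r : ℂ) - q‖ := le_trans (by linarith) (abs_im_le_norm_sub r q)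
    refine ⟨h2, ?_⟩
    have h3 := one_add_norm_le_mul hc0 h2
    rw [norm_real, Real.norm_of_nonneg hr.le] at h3
    refine h3.trans ?_
    have : ‖q‖ ≤ ‖p‖ + c := by
      have := norm_add_le p (q - p)
      rw [add_sub_cancel] at this; linarith
    rw [hK]; gcongr
  have hcont : ∀ q ∈ Metric.ball p c, ∀ n : ℕ,
      ContinuousOn (fun r : ℝ => F r / (r - q) ^ n) (Ioi 0) := fun q hq n =>
    hF.div (by fun_prop) fun r hr =>
      pow_ne_zero _ (norm_pos_iff.mp (hc0.trans_le (hball q hq r hr).1))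
  have hp' : p ∈ Metric.ball p c := Metric.mem_ball_self hc0
  refine (hasDerivAt_integral_of_dominated_loc_of_deriv_le (μ := volume.restrict (Ioi (0 : ℝ)))
    (F := fun q r => F r / (r - q)) (F' := fun q r => F r / (r - q) ^ 2)
    (bound := fun r => |C * K ^ 2| * (1 + r ^ 2)⁻¹) (Metric.ball_mem_nhds p hc0)
    ?_ ?_ ?_ ?_ ((integrable_inv_one_add_sq.const_mul _).integrableOn) ?_).2.differentiableAt
  · filter_upwards [Metric.ball_mem_nhds p hc0] with q hq
    simpa using (hcont q hq 1).aestronglyMeasurable measurableSet_Ioi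
  · refine integrableOn_of_norm_le (C := C * K) (by simpa using hcont p hp' 1) fun r hr => ?_
    obtain ⟨h1, h2⟩ := hball p hp' r hr
    have h0 : 0 < ‖(r : ℂ) - p‖ := hc0.trans_le h1
    have h3 := (le_div_iff₀ (by positivity)).mp (hC r hr)
    rw [norm_div, div_le_div_iff₀ h0 (by positivity)]
    calc ‖F r‖ * (1 + r) ^ 2 = (‖F r‖ * (1 + r)) * (1 + r) := by ring
      _ ≤ C * (K * ‖(r : ℂ) - p‖) := by gcongr
      _ = _ := by ring
  · exact (hcont p hp' 2).aestronglyMeasurable measurableSet_Ioi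
  · filter_upwards [ae_restrict_mem measurableSet_Ioi] with r hr q hq
    have hr : (0 : ℝ) < r := hr
    obtain ⟨h1, h2⟩ := hball q hq r hr
    have h0 : 0 < ‖(r : ℂ) - q‖ := hc0.trans_le h1
    have h3 : ‖F r‖ ≤ C := (hC r hr).trans (div_le_self hC0 (by linarith))
    rw [norm_div, norm_pow, abs_of_nonneg (by positivity), ← div_eq_mul_inv,
      div_le_div_iff₀ (by positivity) (by positivity)]
    calc ‖F r‖ * (1 + r ^ 2) ≤ C * (1 + r) ^ 2 := by
          refine mul_le_mul h3 ?_ (by positivity) hC0; nlinarith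
      _ ≤ C * (K * ‖(r : ℂ) - q‖) ^ 2 := by gcongr
      _ = _ := by ring
  · filter_upwards [ae_restrict_mem measurableSet_Ioi] with r hr q hq
    have h0 : (r : ℂ) - q ≠ 0 := norm_pos_iff.mp (hc0.trans_le (hball q hq r hr).1)
    have := (((hasDerivAt_id q).const_sub (r : ℂ)).fun_inv h0).const_mul (F r)
    simpa [div_eq_mul_inv] using this

/-- The contour may be turned as long as the pole p keeps a positive distance from all the rays
swept. -/
theorem integral_div_sub_eq {θ C c : ℝ} (hθ : θ < Real.pi / 2) {f : ℂ → ℂ}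
    (hf : DifferentiableOn ℂ f (wedge θ)) (hC0 : 0 ≤ C)
    (hC : ∀ z ∈ wedge θ, ‖f z‖ ≤ C / (1 + ‖z‖)) {p : ℂ} (hc : 0 < c) {β₁ β₂ : ℝ} (hβ : β₁ ≤ β₂)
    (hβθ : ∀ β ∈ Icc β₁ β₂, |β| < θ)
    (hp : ∀ r : ℝ, 0 < r → ∀ β ∈ Icc β₁ β₂, c ≤ ‖(r : ℂ) * cis β - p‖) :
    ∫ r in Ioi (0 : ℝ), f (r * cis β₁) / (r - cis (-β₁) * p) =
      ∫ r in Ioi (0 : ℝ), f (r * cis β₂) / (r - cis (-β₂) * p) := by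
  have hw : ∀ r : ℝ, 0 < r → ∀ β ∈ Icc β₁ β₂, (r : ℂ) * cis β ∈ wedge θ := fun r hr β hb =>
    ray_mem_wedge hr (hβθ β hb) (by linarith [Real.pi_pos])
  have h := integral_ray_eq (h := fun z => f z / (z - p)) (C := C * ((1 + ‖p‖) / c + 1)) hβ
    (fun r hr β hb => by
      have := hf.differentiableAt ((isOpen_wedge θ).mem_nhds (hw r hr β hb))
      exact this.div (by fun_prop) (norm_pos_iff.mp (hc.trans_le (hp r hr β hb))))
    (fun r hr β hb => by
      have h1 := hC _ (hw r hr β hb)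
      have h2 := one_add_norm_le_mul hc (hp r hr β hb)
      have h3 := hc.trans_le (hp r hr β hb)
      rw [norm_ray hr] at h1 h2
      have h4 := (le_div_iff₀ (by positivity)).mp h1
      rw [norm_div, div_le_div_iff₀ h3 (by positivity)]
      calc ‖f (r * cis β)‖ * (1 + r) ^ 2 = (‖f (r * cis β)‖ * (1 + r)) * (1 + r) := by ring
        _ ≤ C * (((1 + ‖p‖) / c + 1) * ‖(r : ℂ) * cis β - p‖) := by gcongr
        _ = _ := by ring)
  have hpt : ∀ β (r : ℝ), f (r * cis β) / (r * cis β - p) * cis β =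
      f (r * cis β) / (r - cis (-β) * p) := fun β r => by
    have : (r : ℂ) * cis β - p = cis β * (r - cis (-β) * p) := by
      linear_combination p * cis_mul_neg β
    rw [this, div_mul_eq_mul_div, mul_comm (f _) (cis β), mul_div_mul_left _ _ (cis_ne_zero β)]
  simpa only [hpt] using h

/-- The Cauchy transform of `conj f` over the boundary of a sector, transported to the positive
half line. -/
def conjTransform (α : ℝ) (f : ℂ → ℂ) (a : ℂ) : ℂ :=
  (2 * Real.pi * I)⁻¹ * ∫ x in Ioi (0 : ℝ), (starRingEnd ℂ) (f x) *
    (1 / (x - cis (2 * α) * a) - 1 / (x - cis (-(2 * α)) * a))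

/-- The arguments ±2α + arg a avoid 0 and ±π since |arg a| < θ ≤ 3α/2 and 2α + θ < 3θ < π. So the
kernels of `conjTransform` are regular on the whole of `wedge θ`, beyond `wedge α`. -/
theorem im_cis_mul_pos {θ α : ℝ} (hαθ : α < θ) (hθα : θ ≤ 3 / 2 * α)
    (hθ : θ < Real.pi / 3) {a : ℂ} (ha : a ∈ wedge θ) :
    0 < (cis (2 * α) * a).im ∧ (cis (-(2 * α)) * a).im < 0 := by
  obtain ⟨hpol, harg, hn⟩ := exists_polar (by linarith) (by linarith [Real.pi_pos]) ha
  rw [abs_lt] at harg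
  have h : ∀ β, (cis β * a).im = ‖a‖ * Real.sin (β + arg a) := fun β => by
    rw [← cis_im, ← im_ofReal_mul, cis_add]; conv_lhs => rw [← hpol]
    congr 1; ring
  rw [h, h]
  constructor
  · exact mul_pos hn (Real.sin_pos_of_pos_of_lt_pi (by linarith) (by linarith))
  · exact mul_neg_of_pos_of_neg hn
      (Real.sin_neg_of_neg_of_neg_pi_lt (by linarith) (by linarith))

theorem norm_sub_cis_mul_le {θ α : ℝ} (hαθ : α < θ) (hθα : θ ≤ 3 / 2 * α)
    (hθ : θ < Real.pi / 3) {a : ℂ} (ha : a ∈ wedge θ) {x : ℝ} (hx : 0 < x) :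
    ‖(x : ℂ) - ‖a‖ * cis (α / 2)‖ ≤ ‖(x : ℂ) - cis (2 * α) * a‖ ∧
    ‖(x : ℂ) - ‖a‖ * cis (α / 2)‖ ≤ ‖(x : ℂ) - cis (-(2 * α)) * a‖ := by
  obtain ⟨hpol, harg, hn⟩ := exists_polar (by linarith) (by linarith [Real.pi_pos]) ha
  rw [abs_lt] at harg
  have hsq : ∀ β, ‖(x : ℂ) - ‖a‖ * cis β‖ ^ 2 = x ^ 2 + ‖a‖ ^ 2 - 2 * x * ‖a‖ * Real.cos β :=
    fun β => by
    rw [← normSq_eq_norm_sq, normSq_apply]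
    simp only [sub_re, sub_im, re_ofReal_mul, im_ofReal_mul, cis_re, cis_im, ofReal_re, ofReal_im]
    linear_combination ‖a‖ ^ 2 * Real.sin_sq_add_cos_sq β
  have hmono : ∀ β, Real.cos β ≤ Real.cos (α / 2) →
      ‖(x : ℂ) - ‖a‖ * cis (α / 2)‖ ≤ ‖(x : ℂ) - ‖a‖ * cis β‖ := fun β hβ => by
    refine (abs_le_of_sq_le_sq' ?_ (norm_nonneg _)).2
    rw [hsq, hsq]
    have := mul_le_mul_of_nonneg_left hβ (by positivity : 0 ≤ 2 * x * ‖a‖)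
    linarith
  have hrew : ∀ β, cis β * a = ‖a‖ * cis (β + arg a) := fun β => by
    rw [cis_add]; conv_lhs => rw [← hpol]
    ring
  rw [hrew, hrew]
  constructor
  · exact hmono _ (Real.cos_le_cos_of_nonneg_of_le_pi (by linarith) (by linarith) (by linarith))
  · refine hmono _ ?_
    rw [← Real.cos_neg (-(2 * α) + arg a)]
    exact Real.cos_le_cos_of_nonneg_of_le_pi (by linarith) (by linarith) (by linarith)

theorem norm_conjTransform_le {θ α : ℝ} (hαθ : α < θ) (hθα : θ ≤ 3 / 2 * α)
    (hθ : θ < Real.pi / 3) {f : ℂ → ℂ} (hf1 : ∀ z ∈ wedge θ, ‖f z‖ ≤ 1) {a : ℂ}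
    (ha : a ∈ wedge θ) : ‖conjTransform α f a‖ ≤ 4 := by
  obtain ⟨hpol, harg, hn⟩ := exists_polar (by linarith) (by linarith [Real.pi_pos]) ha
  obtain ⟨him1, him2⟩ := im_cis_mul_pos hαθ hθα hθ ha
  have hs : 0 < Real.sin (α / 2) := Real.sin_pos_of_pos_of_lt_pi (by linarith) (by linarith)
  have hs2 : 0 ≤ Real.sin (2 * α) :=
    Real.sin_nonneg_of_nonneg_of_le_pi (by linarith) (by linarith)
  have hb : 0 < ((‖a‖ : ℂ) * cis (α / 2)).im := by
    rw [im_ofReal_mul, cis_im]; positivity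
  obtain ⟨hint, hle⟩ := integral_im_inv_sub_le hb
  -- sin 2α = 4 sin(α/2) cos(α/2) cos α. Since ±2α + arg a has absolute value at least α/2, the
  -- kernel is dominated by 8 times the Poisson kernel at |a|e^{iα/2}; its mass is at most π, and
  -- 8π/(2π) = 4.
  have hratio : 2 * Real.sin (2 * α) / Real.sin (α / 2) ≤ 8 := by
    rw [div_le_iff₀ hs, show 2 * α = 2 * (2 * (α / 2)) by ring, Real.sin_two_mul, Real.sin_two_mul]
    have h1 := Real.cos_le_one (α / 2)
    have h2 := Real.cos_le_one (2 * (α / 2))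
    have h3 : 0 ≤ Real.cos (α / 2) := Real.cos_nonneg_of_mem_Icc ⟨by linarith, by linarith⟩
    have h4 : Real.cos (α / 2) * Real.cos (2 * (α / 2)) ≤ 1 := by nlinarith
    nlinarith
  have hpt : ∀ x ∈ Ioi (0 : ℝ), ‖(starRingEnd ℂ) (f x) *
      (1 / (x - cis (2 * α) * a) - 1 / (x - cis (-(2 * α)) * a))‖ ≤
      8 * (1 / ((x : ℂ) - ‖a‖ * cis (α / 2))).im := fun x hx => by
    have hx : 0 < x := hx
    have hfx : ‖f x‖ ≤ 1 := by
      have := hf1 _ (ray_mem_wedge hx (β := 0) (by rw [abs_zero]; linarith)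
        (by linarith [Real.pi_pos]))
      rwa [cis_zero, mul_one] at this
    have h0 := ofReal_sub_ne_zero x hb.ne'
    have h0' : 0 < ‖(x : ℂ) - ‖a‖ * cis (α / 2)‖ := norm_pos_iff.mpr h0
    obtain ⟨h1, h2⟩ := norm_sub_cis_mul_le hαθ hθα hθ ha hx
    have hdiff : ‖cis (2 * α) * a - cis (-(2 * α)) * a‖ = 2 * Real.sin (2 * α) * ‖a‖ := by
      have : cis (2 * α) - cis (-(2 * α)) = ((2 * Real.sin (2 * α) : ℝ) : ℂ) * I := by
        apply Complex.ext
        · rw [sub_re, re_ofReal_mul, I_re, cis_re, cis_re, Real.cos_neg]; ring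
        · rw [sub_im, im_ofReal_mul, I_im, cis_im, cis_im, Real.sin_neg]; ring
      rw [← sub_mul, norm_mul, this, norm_mul, norm_real, norm_I, mul_one,
        Real.norm_of_nonneg (by positivity)]
    have him : (1 / ((x : ℂ) - ‖a‖ * cis (α / 2))).im =
        ‖a‖ * Real.sin (α / 2) / ‖(x : ℂ) - ‖a‖ * cis (α / 2)‖ ^ 2 := by
      rw [one_div, inv_im, normSq_eq_norm_sq]
      simp [cis_im, cis_re]
    rw [norm_mul, RCLike.norm_conj, div_sub_div _ _ (ofReal_sub_ne_zero x him1.ne')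
      (ofReal_sub_ne_zero x him2.ne), show ∀ u v w : ℂ, (1 : ℂ) * (w - v) - (w - u) * 1 = u - v from
      fun u v w => by ring, norm_div, norm_mul, hdiff, him]
    calc ‖f x‖ * (2 * Real.sin (2 * α) * ‖a‖ /
          (‖(x : ℂ) - cis (2 * α) * a‖ * ‖(x : ℂ) - cis (-(2 * α)) * a‖))
        ≤ 1 * (2 * Real.sin (2 * α) * ‖a‖ /
          (‖(x : ℂ) - ‖a‖ * cis (α / 2)‖ * ‖(x : ℂ) - ‖a‖ * cis (α / 2)‖)) := by gcongr
      _ = 2 * Real.sin (2 * α) / Real.sin (α / 2) *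
          (‖a‖ * Real.sin (α / 2) / ‖(x : ℂ) - ‖a‖ * cis (α / 2)‖ ^ 2) := by
        field_simp
      _ ≤ _ := by gcongr
  have hbound : ‖∫ x in Ioi (0 : ℝ), (starRingEnd ℂ) (f x) *
      (1 / (x - cis (2 * α) * a) - 1 / (x - cis (-(2 * α)) * a))‖ ≤ 8 * Real.pi := by
    refine (norm_integral_le_of_norm_le (hint.const_mul 8)
      ((ae_restrict_iff' measurableSet_Ioi).mpr (ae_of_all _ hpt))).trans ?_
    rw [integral_const_mul]
    gcongr
  have hpi := Real.pi_pos
  rw [conjTransform, norm_mul, norm_inv, norm_mul, norm_mul, norm_I, norm_real,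
    Real.norm_of_nonneg hpi.le, mul_one, norm_ofNat, inv_mul_le_iff₀ (by positivity)]
  linarith

theorem integrableOn_conj_div_sub {θ α : ℝ} (hαθ : α < θ) (hθα : θ ≤ 3 / 2 * α)
    (hθ : θ < Real.pi / 3) {f : ℂ → ℂ} (hf : Admissible θ f) {p : ℂ} (hp : p.im ≠ 0) :
    IntegrableOn (fun x : ℝ => (starRingEnd ℂ) (f x) / (x - p)) (Ioi 0) := by
  have h := hf.integrableOn (β := 0) (by rw [abs_zero]; linarith) (by linarith [Real.pi_pos])
    (p := (starRingEnd ℂ) p) (by simpa using hp)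
  have h2 := (conjCLE.toContinuousLinearMap).integrable_comp h
  refine h2.congr (ae_of_all _ fun x => ?_)
  simp [cis_zero]

theorem conjTransform_eq_sub {θ α : ℝ} (hαθ : α < θ) (hθα : θ ≤ 3 / 2 * α)
    (hθ : θ < Real.pi / 3) {f : ℂ → ℂ} (hf : Admissible θ f) {a : ℂ} (ha : a ∈ wedge θ) :
    conjTransform α f a = (2 * Real.pi * I)⁻¹ *
      ((∫ x in Ioi (0 : ℝ), (starRingEnd ℂ) (f x) / (x - cis (2 * α) * a)) -
      ∫ x in Ioi (0 : ℝ), (starRingEnd ℂ) (f x) / (x - cis (-(2 * α)) * a)) := by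
  obtain ⟨him1, him2⟩ := im_cis_mul_pos hαθ hθα hθ ha
  rw [conjTransform, ← integral_sub
    (integrableOn_conj_div_sub hαθ hθα hθ hf him1.ne')
    (integrableOn_conj_div_sub hαθ hθα hθ hf him2.ne)]
  congr 1
  refine integral_congr_ae (ae_of_all _ fun x => ?_)
  simp only []
  ring

theorem differentiableOn_conjTransform {θ α : ℝ} (hαθ : α < θ) (hθα : θ ≤ 3 / 2 * α)
    (hθ : θ < Real.pi / 3) {f : ℂ → ℂ} (hf : Admissible θ f) :
    DifferentiableOn ℂ (conjTransform α f) (wedge θ) := by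
  obtain ⟨C, hC0, hC⟩ := hf.decay
  have hray : ∀ x : ℝ, 0 < x → (x : ℂ) ∈ wedge θ := fun x hx => by
    have := ray_mem_wedge hx (β := 0) (θ := θ) (by rw [abs_zero]; linarith)
      (by linarith [Real.pi_pos])
    rwa [cis_zero, mul_one] at this
  have hcont : ContinuousOn (fun x : ℝ => (starRingEnd ℂ) (f x)) (Ioi 0) :=
    continuous_conj.comp_continuousOn (hf.differentiableOn.continuousOn.comp (by fun_prop) hray)
  have hbd : ∀ x > 0, ‖(starRingEnd ℂ) (f (x : ℝ))‖ ≤ C / (1 + x) := fun x hx => by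
    have := hC _ (hray x hx)
    rwa [norm_real, Real.norm_of_nonneg hx.le, ← RCLike.norm_conj] at this
  have hd : ∀ (u : ℂ) a, (u * a).im ≠ 0 → DifferentiableAt ℂ
      (fun a => ∫ x in Ioi (0 : ℝ), (starRingEnd ℂ) (f x) / (x - u * a)) a := fun u a hu =>
    DifferentiableAt.comp (g := fun p => ∫ x in Ioi (0 : ℝ), (starRingEnd ℂ) (f x) / (x - p))
      (f := fun a => u * a) a (differentiableAt_integral_div_sub hcont hC0 hbd hu) (by fun_prop)
  refine DifferentiableOn.congr (fun a ha => ?_)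
    fun a ha => conjTransform_eq_sub hαθ hθα hθ hf ha
  obtain ⟨him1, him2⟩ := im_cis_mul_pos hαθ hθα hθ ha
  exact (((hd _ a him1.ne').sub (hd _ a him2.ne)).const_mul _).differentiableWithinAt

/-- On `wedge α` the two half-line integrals are rotated back to the rays ±α. There they become the
terms with conjugated resolvents that pair with Cauchy's formula for f. -/
theorem conj_conjTransform {θ α : ℝ} (hα : 0 < α) (hαθ : α < θ) (hθα : θ ≤ 3 / 2 * α)
    (hθ : θ < Real.pi / 3) {f : ℂ → ℂ} (hf : Admissible θ f) {d : ℂ} (hd : d ∈ wedge α) :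
    2 * Real.pi * I * (starRingEnd ℂ) (conjTransform α f d) =
      (∫ r in Ioi (0 : ℝ), f (r * cis α) / (r - cis α * (starRingEnd ℂ) d)) -
      ∫ r in Ioi (0 : ℝ), f (r * cis (-α)) / (r - cis (-α) * (starRingEnd ℂ) d) := by
  have hpi := Real.pi_pos
  obtain ⟨C, hC0, hC⟩ := hf.decay
  have hcα := Real.cos_pos_of_mem_Ioo ⟨by linarith, (by linarith : α < Real.pi / 2)⟩
  obtain ⟨hd1, hd2⟩ := (mem_wedge_iff hcα.le).mp hd
  obtain ⟨hpol, harg, hdn⟩ := exists_polar hα (by linarith) hd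
  rw [abs_lt] at harg
  have hdθ : d ∈ wedge θ := by
    rw [← hpol]; exact ray_mem_wedge hdn (abs_lt.mpr ⟨by linarith, by linarith⟩) (by linarith)
  have hsin : ∀ {x}, 0 ≤ x → x ≤ α → 0 ≤ Real.sin x := fun h1 h2 =>
    Real.sin_nonneg_of_nonneg_of_le_pi h1 (by linarith)
  have e1 := integral_div_sub_eq (by linarith) hf.differentiableOn hC0 hC
    (p := cis (-(2 * α)) * (starRingEnd ℂ) d) hd1 (by linarith : -α ≤ 0)
    (fun β hb => abs_lt.mpr ⟨by linarith [hb.1], by linarith [hb.2]⟩) fun r hr β hb => by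
      have h1 : cis α * ((r : ℂ) * cis β - cis (-(2 * α)) * (starRingEnd ℂ) d) =
          r * cis (α + β) - (starRingEnd ℂ) (cis α * d) := by
        rw [map_mul, conj_cis, show -α = α + -(2 * α) by ring, cis_add, cis_add]; ring
      have h2 := abs_im_le_norm (cis α * ((r : ℂ) * cis β - cis (-(2 * α)) * (starRingEnd ℂ) d))
      rw [norm_mul, norm_cis, one_mul] at h2
      refine le_trans ?_ h2
      rw [h1, sub_im, im_ofReal_mul, cis_im, conj_im, sub_neg_eq_add]
      have := mul_nonneg hr.le (hsin (by linarith [hb.1] : 0 ≤ α + β) (by linarith [hb.2]))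
      exact le_trans (by linarith) (le_abs_self _)
  have e2 := integral_div_sub_eq (by linarith) hf.differentiableOn hC0 hC
    (p := cis (2 * α) * (starRingEnd ℂ) d) (neg_pos.mpr hd2) hα.le
    (fun β hb => abs_lt.mpr ⟨by linarith [hb.1], by linarith [hb.2]⟩) fun r hr β hb => by
      have h1 : cis (-α) * ((r : ℂ) * cis β - cis (2 * α) * (starRingEnd ℂ) d) =
          r * cis (-(α - β)) - (starRingEnd ℂ) (cis (-α) * d) := by
        rw [map_mul, conj_cis, neg_neg, show -(α - β) = -α + β by ring,
          show cis α = cis (-α + 2 * α) by ring_nf, cis_add, cis_add]; ring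
      have h2 := abs_im_le_norm (cis (-α) * ((r : ℂ) * cis β - cis (2 * α) * (starRingEnd ℂ) d))
      rw [norm_mul, norm_cis, one_mul] at h2
      refine le_trans ?_ h2
      rw [h1, sub_im, im_ofReal_mul, cis_im, conj_im, sub_neg_eq_add, Real.sin_neg]
      have := mul_nonneg hr.le (hsin (by linarith [hb.2] : 0 ≤ α - β) (by linarith [hb.1]))
      exact le_trans (by linarith) (neg_le_abs _)
  have hsimp : ∀ x : ℂ, cis (-α) * (cis (2 * α) * x) = cis α * x ∧
      cis (- -α) * (cis (-(2 * α)) * x) = cis (-α) * x := fun x => by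
    constructor
    · rw [← mul_assoc, ← cis_add]; ring_nf
    · rw [← mul_assoc, ← cis_add]; ring_nf
  simp only [(hsimp _).1, (hsimp _).2, neg_zero, cis_zero, mul_one, one_mul] at e1 e2
  rw [e1, ← e2, conjTransform_eq_sub hαθ hθα hθ hf hdθ, map_mul, map_sub, ← integral_conj,
    ← integral_conj]
  simp only [map_div₀, map_sub, map_mul, conj_cis, conj_conj, conj_ofReal, neg_neg, map_inv₀,
    conj_I, map_ofNat]
  have : (Real.pi : ℂ) ≠ 0 := ofReal_ne_zero.mpr hpi.ne'
  have hI := I_ne_zero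
  field_simp
  ring

end RDArnoldi
end

/-! ### Sectors of semiangle below π/3 are 4-spectral sets. -/

noncomputable section
namespace RDArnoldi
open Set Filter Topology MeasureTheory Complex
open scoped Matrix.Norms.L2Operator

variable {n : ℕ}

theorem norm_le_of_forall_nrm_le {T : Matrix (Fin n) (Fin n) ℂ} {c : ℝ} (hc : 0 ≤ c)
    (h : ∀ x, nrm (T *ᵥ x) ≤ c * nrm x) : ‖T‖ ≤ c := by
  rw [Matrix.l2_opNorm_def]
  refine ContinuousLinearMap.opNorm_le_bound _ hc fun x => ?_
  exact h x.ofLp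

theorem norm_le_two_of_forall {T : Matrix (Fin n) (Fin n) ℂ}
    (h : ∀ x y, ‖star y ⬝ᵥ (T *ᵥ x)‖ ≤ nrm x ^ 2 + nrm y ^ 2) : ‖T‖ ≤ 2 := by
  refine norm_le_of_forall_nrm_le zero_le_two fun x => ?_
  rcases (nrm_nonneg (T *ᵥ x)).eq_or_lt with h0 | h0
  · rw [← h0]; have := nrm_nonneg x; positivity
  have hx : 0 < nrm x := nrm_pos fun hx => by
    rw [hx, Matrix.mulVec_zero, nrm_eq_zero.mpr rfl] at h0; exact lt_irrefl _ h0
  -- Test with y = cTx scaled to the norm of x, so that the quadratic bound becomes 2‖x‖².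
  set c : ℝ := nrm x / nrm (T *ᵥ x)
  have hc : 0 < c := div_pos hx h0
  have h1 := h x ((c : ℂ) • (T *ᵥ x))
  have h2 : nrm ((c : ℂ) • (T *ᵥ x)) = nrm x := by
    rw [nrm, WithLp.toLp_smul, norm_smul, norm_real, Real.norm_of_nonneg hc.le]
    exact div_mul_cancel₀ _ h0.ne'
  rw [h2, star_smul, smul_dotProduct, star_dotProduct_self, smul_eq_mul, norm_mul, norm_star,
    norm_real, norm_real, Real.norm_of_nonneg hc.le, Real.norm_of_nonneg (sq_nonneg _), sq,
    ← mul_assoc] at h1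
  rw [show c * nrm (T *ᵥ x) = nrm x from div_mul_cancel₀ _ h0.ne'] at h1
  exact le_of_mul_le_mul_left (by linarith) hx

theorem norm_sub_star_le {R : Matrix (Fin n) (Fin n) ℂ} (h : ∀ x, 0 ≤ (qf R x).im)
    (x y : Fin n → ℂ) :
    ‖star y ⬝ᵥ (R *ᵥ x) - star (star x ⬝ᵥ (R *ᵥ y))‖ ≤ (qf R x).im + (qf R y).im := by
  set w := star y ⬝ᵥ (R *ᵥ x) - star (star x ⬝ᵥ (R *ᵥ y)) with hw
  rcases eq_or_ne w 0 with h0 | h0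
  · rw [h0, norm_zero]; exact add_nonneg (h x) (h y)
  have hn : (‖w‖ : ℂ) ≠ 0 := by exact_mod_cast norm_ne_zero_iff.mpr h0
  -- The phase c makes the cross term of the form at y + cx equal to -‖w‖; nonnegativity of its
  -- imaginary part is then the claim.
  set c : ℂ := -I * (starRingEnd ℂ) w / ‖w‖ with hc
  have hcw : c * w = -(‖w‖ * I) := by
    rw [hc]; field_simp
    rw [mul_comm, mul_conj, normSq_eq_norm_sq]; push_cast; ring
  have hcc : (starRingEnd ℂ) c * c = 1 := by
    rw [hc]; simp only [map_div₀, map_mul, map_neg, conj_I, conj_conj, conj_ofReal]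
    have hnn : w * (starRingEnd ℂ) w = ‖w‖ ^ 2 := by
      rw [mul_conj, normSq_eq_norm_sq]; push_cast; rfl
    field_simp
    linear_combination hnn - w * (starRingEnd ℂ) w * I_sq
  have h1 := h (y + c • x)
  have h2 : qf R (y + c • x) = qf R y + (starRingEnd ℂ) c * c * qf R x +
      (c * (star y ⬝ᵥ (R *ᵥ x)) + (starRingEnd ℂ) c * (star x ⬝ᵥ (R *ᵥ y))) := by
    simp only [qf, Matrix.mulVec_add, Matrix.mulVec_smul, star_add, star_smul, add_dotProduct,
      dotProduct_add, smul_dotProduct, dotProduct_smul, smul_eq_mul, RCLike.star_def]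
    ring
  have h3 : ((starRingEnd ℂ) c * (star x ⬝ᵥ (R *ᵥ y))).im =
      -(c * star (star x ⬝ᵥ (R *ᵥ y))).im := by
    rw [← conj_im]; simp
  have h4 : (c * w).im = -‖w‖ := by rw [hcw]; simp
  rw [hw, mul_sub, sub_im] at h4
  rw [h2, hcc, one_mul, add_im, add_im, add_im, h3] at h1
  linarith

/-- The functional calculus of a diagonalized matrix. -/
def fc (P : Matrix (Fin n) (Fin n) ℂ) (d : Fin n → ℂ) (f : ℂ → ℂ) : Matrix (Fin n) (Fin n) ℂ :=
  P * Matrix.diagonal (fun i => f (d i)) * P⁻¹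

section
variable {P : Matrix (Fin n) (Fin n) ℂ} {d : Fin n → ℂ}

theorem fc_mul (hP : IsUnit P.det) (f g : ℂ → ℂ) :
    fc P d (fun z => f z * g z) = fc P d f * fc P d g := by
  simp only [fc, ← Matrix.diagonal_mul_diagonal]
  simp only [Matrix.mul_assoc, Matrix.nonsing_inv_mul_cancel_left _ _ hP]

theorem fc_add (f g : ℂ → ℂ) : fc P d (fun z => f z + g z) = fc P d f + fc P d g := by
  simp only [fc, ← Matrix.diagonal_add, Matrix.mul_add, Matrix.add_mul]

theorem fc_const_mul (c : ℂ) (f : ℂ → ℂ) : fc P d (fun z => c * f z) = c • fc P d f := by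
  have : (Matrix.diagonal fun i => c * f (d i)) = c • Matrix.diagonal fun i => f (d i) := by
    rw [← Matrix.diagonal_smul]; rfl
  rw [fc, fc, this, Matrix.mul_smul, Matrix.smul_mul]

theorem fc_const (hP : IsUnit P.det) (c : ℂ) : fc P d (fun _ => c) = c • 1 := by
  rw [show (fun _ : ℂ => c) = fun z => c * (fun _ => 1) z by simp, fc_const_mul]
  simp [fc, Matrix.mul_nonsing_inv _ hP]

theorem fc_congr {f g : ℂ → ℂ} (h : ∀ i, f (d i) = g (d i)) : fc P d f = fc P d g := by
  simp only [fc, h]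

theorem dotProduct_fc_mulVec (f : ℂ → ℂ) (x y : Fin n → ℂ) :
    star y ⬝ᵥ (fc P d f *ᵥ x) = ∑ i, (star y ᵥ* P) i * (P⁻¹ *ᵥ x) i * f (d i) := by
  rw [fc, ← Matrix.mulVec_mulVec, ← Matrix.mulVec_mulVec, Matrix.dotProduct_mulVec]
  refine Finset.sum_congr rfl fun i _ => ?_
  rw [Matrix.mulVec_diagonal]; ring

theorem exists_eigenvector (hP : IsUnit P.det) (i : Fin n) :
    ∃ x ≠ 0, qf (fc P d id) x = d i * (nrm x ^ 2 : ℝ) := by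
  refine ⟨P *ᵥ Pi.single i 1, fun h => ?_, ?_⟩
  · have := congrArg (P⁻¹ *ᵥ ·) h
    simp only [Matrix.mulVec_mulVec, Matrix.nonsing_inv_mul _ hP, Matrix.one_mulVec,
      Matrix.mulVec_zero] at this
    have h1 := congrFun this i
    rw [Pi.single_eq_same, Pi.zero_apply] at h1
    exact one_ne_zero h1
  · have : fc P d id *ᵥ (P *ᵥ Pi.single i 1) = d i • (P *ᵥ Pi.single i 1) := by
      rw [fc, Matrix.mulVec_mulVec, Matrix.nonsing_inv_mul_cancel_right _ _ hP,
        ← Matrix.mulVec_mulVec, ← Matrix.mulVec_smul]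
      congr 1
      ext j
      rw [Matrix.mulVec_diagonal]
      rcases eq_or_ne j i with rfl | hj
      · simp
      · simp [hj]
    rw [qf, this, dotProduct_smul, star_dotProduct_self, smul_eq_mul]

/-- The resolvent of `u • A`. -/
theorem qf_resolvent (hP : IsUnit P.det) {u : ℂ} (hu : ∀ i, (u * d i).im ≠ 0) (r : ℝ)
    (x : Fin n → ℂ) : (qf (fc P d fun z => 1 / (r - u * z)) x).im =
      (u * qf (fc P d id) ((fc P d fun z => 1 / (r - u * z)) *ᵥ x)).im := by
  set z := (fc P d fun z => 1 / (r - u * z)) *ᵥ x with hz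
  have h1 : fc P d (fun z => r - u * z) * (fc P d fun z => 1 / (r - u * z)) = 1 := by
    rw [← fc_mul hP, fc_congr (g := fun _ => 1), fc_const hP, one_smul]
    intro i
    exact mul_one_div_cancel (ofReal_sub_ne_zero r (hu i))
  have h2 : fc P d (fun z => r - u * z) = (r : ℂ) • 1 + (-u) • fc P d id := by
    rw [← fc_const hP, ← fc_const_mul, ← fc_add]
    exact fc_congr fun i => by simp [sub_eq_add_neg]
  have h3 : x = (r : ℂ) • z + (-u) • (fc P d id *ᵥ z) := by
    rw [hz]
    conv_lhs => rw [← Matrix.one_mulVec x, ← h1, h2, ← Matrix.mulVec_mulVec, Matrix.add_mulVec,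
      Matrix.smul_mulVec, Matrix.smul_mulVec, Matrix.one_mulVec]
  -- With z the resolvent applied to x, the form at x is the conjugate of zᴴx = r‖z‖² - u zᴴAz. Its
  -- imaginary part is that of u zᴴAz, so its sign does not depend on r and the half-line integral
  -- is at most the integral over ℝ.
  have h4 : qf (fc P d fun z => 1 / (r - u * z)) x = star (star z ⬝ᵥ x) := by
    rw [star_star_dotProduct]; rfl
  have h5 : star z ⬝ᵥ x = r * (nrm z ^ 2 : ℝ) - u * qf (fc P d id) z := by
    conv_lhs => rw [h3]
    rw [dotProduct_add, dotProduct_smul, dotProduct_smul, star_dotProduct_self, qf]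
    simp only [smul_eq_mul]; ring
  rw [h4, h5, RCLike.star_def, conj_im, sub_im, im_ofReal_mul, ofReal_im]
  ring

theorem sum_dotProduct (hP : IsUnit P.det) (x : Fin n → ℂ) :
    ∑ i, (star x ᵥ* P) i * (P⁻¹ *ᵥ x) i = (nrm x ^ 2 : ℝ) := by
  have := dotProduct_fc_mulVec (P := P) (d := fun _ => 0) (fun _ => 1) x x
  rw [fc_const hP, one_smul, Matrix.one_mulVec, star_dotProduct_self] at this
  rw [this]; simp

theorem integral_im_qf_resolvent_le (hP : IsUnit P.det) {u : ℂ} {σ : ℝ} (hσ : |σ| = 1)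
    (hu : ∀ i, (u * d i).im ≠ 0)
    (hlim : ∀ i, Tendsto (fun R : ℝ => ∫ r in (-R)..R, 1 / ((r : ℂ) - u * d i)) atTop
      (𝓝 (σ * (Real.pi * I))))
    (hA : ∀ x, 0 ≤ σ * (u * qf (fc P d id) x).im) (x : Fin n → ℂ) :
    IntegrableOn (fun r : ℝ => σ * (qf (fc P d fun z => 1 / (r - u * z)) x).im) (Ioi 0) ∧
    ∫ r in Ioi (0 : ℝ), σ * (qf (fc P d fun z => 1 / (r - u * z)) x).im ≤
      Real.pi * nrm x ^ 2 := by
  have hq : ∀ r : ℝ, qf (fc P d fun z => 1 / (r - u * z)) x =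
      ∑ i, (star x ᵥ* P) i * (P⁻¹ *ᵥ x) i * (1 / (r - u * d i)) := fun r =>
    dotProduct_fc_mulVec _ x x
  have hcont : ∀ i, Continuous fun r : ℝ => 1 / ((r : ℂ) - u * d i) := fun i =>
    continuous_const.div (by fun_prop) fun r => ofReal_sub_ne_zero r (hu i)
  have hqc : Continuous fun r : ℝ => qf (fc P d fun z => 1 / (r - u * z)) x := by
    simp only [hq]
    exact continuous_finsetSum _ fun i _ => continuous_const.mul (hcont i)
  refine integrableOn_Ioi_of_tendsto
    (F := fun r : ℝ => σ * (qf (fc P d fun z => 1 / (r - u * z)) x).im)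
    (continuous_const.mul (continuous_im.comp hqc)) (fun r => ?_) ?_
  · rw [qf_resolvent hP hu]
    exact hA _
  · have h1 : Tendsto (fun R : ℝ => ∫ r in (-R)..R, qf (fc P d fun z => 1 / (r - u * z)) x) atTop
        (𝓝 (∑ i, (star x ᵥ* P) i * (P⁻¹ *ᵥ x) i * (σ * (Real.pi * I)))) := by
      have h2 : ∀ R : ℝ, ∫ r in (-R)..R, qf (fc P d fun z => 1 / (r - u * z)) x =
          ∑ i, (star x ᵥ* P) i * (P⁻¹ *ᵥ x) i * ∫ r in (-R)..R, 1 / ((r : ℂ) - u * d i) :=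
        fun R => by
        simp only [hq]
        rw [intervalIntegral.integral_finsetSum
          (f := fun i (r : ℝ) => (star x ᵥ* P) i * (P⁻¹ *ᵥ x) i * (1 / (r - u * d i))) fun i _ =>
          (continuous_const.mul (hcont i)).intervalIntegrable _ _]
        simp only [intervalIntegral.integral_const_mul]
      simp only [h2]
      exact tendsto_finsetSum _ fun i _ => (hlim i).const_mul _
    rw [← Finset.sum_mul, sum_dotProduct hP] at h1
    have h3 := ((continuous_im.tendsto _).comp h1).const_mul σ
    have h4 : σ * (((nrm x ^ 2 : ℝ) : ℂ) * (σ * (Real.pi * I))).im = Real.pi * nrm x ^ 2 := by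
      rw [im_ofReal_mul, im_ofReal_mul, im_ofReal_mul, I_im]
      have : σ * σ = 1 := by rw [← abs_mul_abs_self, hσ, one_mul]
      linear_combination Real.pi * nrm x ^ 2 * this
    rw [h4] at h3
    refine h3.congr fun R => ?_
    simp only [Function.comp_apply]
    rw [intervalIntegral.integral_const_mul]
    congr 1
    exact (imCLM.intervalIntegral_comp_comm (hqc.intervalIntegrable _ _)).symm

theorem norm_integral_resolvent_le (hP : IsUnit P.det) {u : ℂ} {σ : ℝ} (hσ : |σ| = 1)
    (hu : ∀ i, (u * d i).im ≠ 0)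
    (hlim : ∀ i, Tendsto (fun R : ℝ => ∫ r in (-R)..R, 1 / ((r : ℂ) - u * d i)) atTop
      (𝓝 (σ * (Real.pi * I))))
    (hA : ∀ x, 0 ≤ σ * (u * qf (fc P d id) x).im) (x y : Fin n → ℂ) {ψ : ℝ → ℂ}
    (hψ : ∀ r > 0, ‖ψ r‖ ≤ 1) :
    ‖∫ r in Ioi (0 : ℝ), ψ r * (star y ⬝ᵥ ((fc P d fun z => 1 / (r - u * z)) *ᵥ x) -
      star (star x ⬝ᵥ ((fc P d fun z => 1 / (r - u * z)) *ᵥ y)))‖ ≤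
      Real.pi * (nrm x ^ 2 + nrm y ^ 2) := by
  obtain ⟨hi, hl⟩ := integral_im_qf_resolvent_le hP hσ hu hlim hA x
  obtain ⟨hi', hl'⟩ := integral_im_qf_resolvent_le hP hσ hu hlim hA y
  refine (norm_integral_le_of_norm_le (hi.add hi')
    ((ae_restrict_iff' measurableSet_Ioi).mpr (ae_of_all _ fun r hr => ?_))).trans ?_
  · have h1 : ∀ x, qf ((σ : ℂ) • fc P d fun z => 1 / (r - u * z)) x =
        σ * qf (fc P d fun z => 1 / (r - u * z)) x := fun x => by
      rw [qf, Matrix.smul_mulVec, dotProduct_smul]; rfl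
    have h2 := norm_sub_star_le (R := (σ : ℂ) • fc P d fun z => 1 / (r - u * z)) (fun x => by
      rw [h1, im_ofReal_mul, qf_resolvent hP hu]; exact hA _) x y
    rw [h1, h1, im_ofReal_mul, im_ofReal_mul] at h2
    rw [norm_mul]
    refine (mul_le_of_le_one_left (norm_nonneg _) (hψ r hr)).trans (le_trans (le_of_eq ?_) h2)
    rw [Matrix.smul_mulVec, Matrix.smul_mulVec, dotProduct_smul, dotProduct_smul, star_smul,
      RCLike.star_def, conj_ofReal, ← smul_sub, norm_smul, norm_real, Real.norm_eq_abs, hσ, one_mul]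
  · have := integral_add hi hi'
    simp only [Pi.add_apply] at this ⊢
    rw [this]; linarith

theorem integral_mul_resolvent {ψ : ℝ → ℂ} {u : ℂ}
    (h1 : ∀ i, IntegrableOn (fun r : ℝ => ψ r / (r - u * d i)) (Ioi 0))
    (h2 : ∀ i, IntegrableOn (fun r : ℝ => ψ r / (r - (starRingEnd ℂ) (u * d i))) (Ioi 0))
    (x y : Fin n → ℂ) :
    ∫ r in Ioi (0 : ℝ), ψ r * (star y ⬝ᵥ ((fc P d fun z => 1 / (r - u * z)) *ᵥ x) -
      star (star x ⬝ᵥ ((fc P d fun z => 1 / (r - u * z)) *ᵥ y))) =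
    ∑ i, ((star y ᵥ* P) i * (P⁻¹ *ᵥ x) i * (∫ r in Ioi (0 : ℝ), ψ r / (r - u * d i)) -
      star ((star x ᵥ* P) i * (P⁻¹ *ᵥ y) i) *
        ∫ r in Ioi (0 : ℝ), ψ r / (r - (starRingEnd ℂ) (u * d i))) := by
  have h3 : ∀ r : ℝ, ψ r * (star y ⬝ᵥ ((fc P d fun z => 1 / (r - u * z)) *ᵥ x) -
      star (star x ⬝ᵥ ((fc P d fun z => 1 / (r - u * z)) *ᵥ y))) =
      ∑ i, ((star y ᵥ* P) i * (P⁻¹ *ᵥ x) i * (ψ r / (r - u * d i)) -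
      star ((star x ᵥ* P) i * (P⁻¹ *ᵥ y) i) * (ψ r / (r - (starRingEnd ℂ) (u * d i)))) :=
    fun r => by
    rw [dotProduct_fc_mulVec, dotProduct_fc_mulVec, star_sum, ← Finset.sum_sub_distrib,
      Finset.mul_sum]
    refine Finset.sum_congr rfl fun i _ => ?_
    simp only [RCLike.star_def, map_mul, map_div₀, map_sub, map_one, conj_ofReal]
    ring
  simp only [h3]
  rw [integral_finsetSum (f := fun i (r : ℝ) =>
    (star y ᵥ* P) i * (P⁻¹ *ᵥ x) i * (ψ r / (r - u * d i)) -
      star ((star x ᵥ* P) i * (P⁻¹ *ᵥ y) i) * (ψ r / (r - (starRingEnd ℂ) (u * d i))))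
    _ fun i _ => ((h1 i).const_mul _).sub ((h2 i).const_mul _)]
  refine Finset.sum_congr rfl fun i _ => ?_
  rw [integral_sub ((h1 i).const_mul _) ((h2 i).const_mul _), integral_const_mul,
    integral_const_mul]

/-- The numerical range condition: the field of values lies in the open sector `wedge α`. -/
theorem mem_wedge_of_forall {α : ℝ} (hc : 0 < Real.cos α) (hP : IsUnit P.det)
    (hA : ∀ x ≠ 0, qf (fc P d id) x ∈ wedge α) (i : Fin n) : d i ∈ wedge α := by
  obtain ⟨x, hx, h⟩ := exists_eigenvector (d := d) hP i
  have h1 := (mem_wedge_iff hc.le).mp (hA x hx)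
  have h2 : 0 < nrm x ^ 2 := pow_pos (nrm_pos hx) 2
  rw [h, ← mul_assoc, ← mul_assoc, mul_comm _ ((nrm x ^ 2 : ℝ) : ℂ), im_ofReal_mul,
    mul_comm _ ((nrm x ^ 2 : ℝ) : ℂ), im_ofReal_mul] at h1
  exact (mem_wedge_iff hc.le).mpr ⟨pos_of_mul_pos_right h1.1 h2.le, by nlinarith [h1.2]⟩

theorem norm_fc_add_conjTranspose_le {θ α : ℝ} (hα : 0 < α) (hαθ : α < θ) (hθα : θ ≤ 3 / 2 * α)
    (hθ : θ < Real.pi / 3) (hP : IsUnit P.det) (hA : ∀ x ≠ 0, qf (fc P d id) x ∈ wedge α)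
    {f : ℂ → ℂ} (hf : Admissible θ f) (hf1 : ∀ z ∈ wedge θ, ‖f z‖ ≤ 1) :
    ‖fc P d f + (fc P d (conjTransform α f))ᴴ‖ ≤ 2 := by
  have hpi := Real.pi_pos
  have hc := Real.cos_pos_of_mem_Ioo ⟨by linarith, (by linarith : α < Real.pi / 2)⟩
  have hd := mem_wedge_of_forall hc hP hA
  have hd' := fun i => (mem_wedge_iff hc.le).mp (hd i)
  refine norm_le_two_of_forall fun x y => ?_
  have hA' : ∀ x, 0 ≤ (cis α * qf (fc P d id) x).im ∧ (cis (-α) * qf (fc P d id) x).im ≤ 0 :=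
    fun x => by
    rcases eq_or_ne x 0 with rfl | hx
    · simp [qf]
    · have := (mem_wedge_iff hc.le).mp (hA x hx)
      exact ⟨this.1.le, this.2.le⟩
  have habs : |α| < θ := by rwa [abs_of_pos hα]
  have habs' : |-α| < θ := by rwa [abs_neg]
  have hray : ∀ β, |β| < θ → ∀ r : ℝ, r > 0 → ‖f (r * cis β)‖ ≤ 1 := fun β hb r hr =>
    hf1 _ (ray_mem_wedge hr hb (by linarith))
  have n1 := norm_integral_resolvent_le hP (u := cis α) (σ := 1) abs_one (fun i => (hd' i).1.ne')
    (fun i => by rw [ofReal_one, one_mul]; exact tendsto_integral_inv_sub (hd' i).1)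
    (fun x => by rw [one_mul]; exact (hA' x).1) x y (hray (-α) habs')
  have n2 := norm_integral_resolvent_le hP (u := cis (-α)) (σ := -1) (by simp)
    (fun i => (hd' i).2.ne)
    (fun i => by
      rw [ofReal_neg, ofReal_one, neg_one_mul]; exact tendsto_integral_inv_sub_neg (hd' i).2)
    (fun x => by rw [neg_one_mul]; exact neg_nonneg.mpr (hA' x).2) x y (hray α habs)
  have hint : ∀ β, |β| < θ → ∀ p : ℂ, p.im ≠ 0 →
      IntegrableOn (fun r : ℝ => f (r * cis β) / (r - p)) (Ioi 0) := fun β hb p hp =>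
    hf.integrableOn hb (by linarith) hp
  have hconj : ∀ p : ℂ, p.im ≠ 0 → ((starRingEnd ℂ) p).im ≠ 0 := fun p hp => by simpa using hp
  rw [integral_mul_resolvent (fun i => hint _ habs' _ (hd' i).1.ne')
    (fun i => hint _ habs' _ (hconj _ (hd' i).1.ne'))] at n1
  rw [integral_mul_resolvent (fun i => hint _ habs _ (hd' i).2.ne)
    (fun i => hint _ habs _ (hconj _ (hd' i).2.ne))] at n2
  -- Cauchy's formula for f and the rotated formula for the conjugate transform combine into
  -- integrals of f against resolvent minus adjoint on each ray. Each is at most π(‖x‖² + ‖y‖²).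
  have key : 2 * Real.pi * I * (star y ⬝ᵥ ((fc P d f + (fc P d (conjTransform α f))ᴴ) *ᵥ x)) =
      (∑ i, ((star y ᵥ* P) i * (P⁻¹ *ᵥ x) i *
        (∫ r in Ioi (0 : ℝ), f (r * cis (-α)) / (r - cis α * d i)) -
      star ((star x ᵥ* P) i * (P⁻¹ *ᵥ y) i) *
        ∫ r in Ioi (0 : ℝ), f (r * cis (-α)) / (r - (starRingEnd ℂ) (cis α * d i)))) -
      ∑ i, ((star y ᵥ* P) i * (P⁻¹ *ᵥ x) i *
        (∫ r in Ioi (0 : ℝ), f (r * cis α) / (r - cis (-α) * d i)) -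
      star ((star x ᵥ* P) i * (P⁻¹ *ᵥ y) i) *
        ∫ r in Ioi (0 : ℝ), f (r * cis α) / (r - (starRingEnd ℂ) (cis (-α) * d i))) := by
    have h1 : star y ⬝ᵥ ((fc P d (conjTransform α f))ᴴ *ᵥ x) =
        star (star x ⬝ᵥ (fc P d (conjTransform α f) *ᵥ y)) := by
      rw [star_star_dotProduct, Matrix.star_mulVec, ← Matrix.dotProduct_mulVec]
    rw [Matrix.add_mulVec, dotProduct_add, h1, dotProduct_fc_mulVec, dotProduct_fc_mulVec, star_sum,
      ← Finset.sum_add_distrib, Finset.mul_sum, ← Finset.sum_sub_distrib]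
    refine Finset.sum_congr rfl fun i _ => ?_
    have c1 := cauchy_wedge hα hαθ (by linarith) hf (hd i)
    have c2 := conj_conjTransform hα hαθ hθα hθ hf (hd i)
    simp only [star_mul', RCLike.star_def, map_mul, conj_cis, neg_neg] at *
    linear_combination -((star y ᵥ* P) i * (P⁻¹ *ᵥ x) i) * c1 +
      (starRingEnd ℂ) ((star x ᵥ* P) i) * (starRingEnd ℂ) ((P⁻¹ *ᵥ y) i) * c2
  have h2 := (norm_sub_le _ _).trans (add_le_add n1 n2)
  rw [← key, norm_mul, norm_mul, norm_mul, norm_I, norm_real, Real.norm_of_nonneg hpi.le,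
    mul_one, norm_ofNat] at h2
  refine le_of_mul_le_mul_left (a := 2 * Real.pi) (by linarith) (by positivity)

theorem norm_pow_four_le {X Y : Matrix (Fin n) (Fin n) ℂ} {K : ℝ} (hX : ‖X‖ ≤ K)
    (hT : ‖X + Yᴴ‖ ≤ 2) (hXYX : ‖X * Y * X‖ ≤ 4 * K) : ‖X‖ ^ 4 ≤ 2 * K ^ 3 + 4 * K ^ 2 := by
  have hK0 : 0 ≤ K := (norm_nonneg _).trans hX
  have h4 : ‖X‖ ^ 4 = ‖X * Xᴴ * X * Xᴴ‖ := by
    have h1 := Matrix.l2_opNorm_conjTranspose_mul_self Xᴴ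
    have h2 := Matrix.l2_opNorm_conjTranspose_mul_self (X * Xᴴ)
    rw [Matrix.conjTranspose_conjTranspose, Matrix.l2_opNorm_conjTranspose] at h1
    rw [Matrix.conjTranspose_mul, Matrix.conjTranspose_conjTranspose, h1, ← Matrix.mul_assoc] at h2
    rw [h2]; ring
  -- This is the extremal identity: the first term involves X + Yᴴ of norm at most 2, the second
  -- XYX, the value at the matrix of a function bounded by 4 on the sector.
  have h5 : X * Xᴴ * X * Xᴴ = X * (X + Yᴴ)ᴴ * X * Xᴴ - X * Y * X * Xᴴ := by
    rw [Matrix.conjTranspose_add, Matrix.conjTranspose_conjTranspose, Matrix.mul_add,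
      Matrix.add_mul, Matrix.add_mul, add_sub_cancel_right]
  have hXt : ‖Xᴴ‖ ≤ K := by rwa [Matrix.l2_opNorm_conjTranspose]
  have hTt : ‖(X + Yᴴ)ᴴ‖ ≤ 2 := by rwa [Matrix.l2_opNorm_conjTranspose]
  rw [h4, h5]
  refine (norm_sub_le _ _).trans ?_
  have e1 : ‖X * (X + Yᴴ)ᴴ * X * Xᴴ‖ ≤ K * 2 * K * K :=
    (norm_mul_le _ _).trans (mul_le_mul ((norm_mul_le _ _).trans (mul_le_mul
      ((norm_mul_le _ _).trans (mul_le_mul hX hTt (norm_nonneg _) hK0)) hX (norm_nonneg _)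
      (by positivity))) hXt (norm_nonneg _) (by positivity))
  have e2 : ‖X * Y * X * Xᴴ‖ ≤ 4 * K * K :=
    (norm_mul_le _ _).trans (mul_le_mul hXYX hXt (norm_nonneg _) (by positivity))
  linarith

/-- Passing t → K = sup S gives K² ≤ 2K + 4, that is K ≤ 1 + √5 < 4. The supremum need not be
attained, hence the continuity argument. -/
theorem csSup_le_four {S : Set ℝ} (hbdd : BddAbove S) {a : ℝ} (ha : a ∈ S)
    (h : ∀ t ∈ S, t ^ 4 ≤ 2 * sSup S ^ 3 + 4 * sSup S ^ 2) : sSup S ≤ 4 := by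
  generalize hK : sSup S = K at *
  by_contra! h4
  have hlt : 2 * K ^ 3 + 4 * K ^ 2 < K ^ 4 := by
    have h1 : 0 < K ^ 2 * ((K - 4) * (K + 2) + 4) := by
      have : 0 < K - 4 := by linarith
      positivity
    linarith
  have hcont : Tendsto (fun t : ℝ => t ^ 4) (𝓝 K) (𝓝 (K ^ 4)) := (continuous_pow 4).tendsto K
  obtain ⟨l, hl, hlK⟩ := exists_Ioc_subset_of_mem_nhds (hcont (Ioi_mem_nhds hlt))
    ⟨K - 1, by linarith⟩
  rw [← hK] at hl
  obtain ⟨t, htS, ht⟩ := exists_lt_of_lt_csSup ⟨_, ha⟩ hl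
  have : t ^ 4 ∈ Ioi _ := hlK ⟨ht, hK ▸ le_csSup hbdd htS⟩
  exact absurd (h t htS) (not_le.mpr this)

theorem norm_fc_le_of_admissible {θ α : ℝ} (hα : 0 < α) (hαθ : α < θ) (hθα : θ ≤ 3 / 2 * α)
    (hθ : θ < Real.pi / 3) (hP : IsUnit P.det) (hA : ∀ x ≠ 0, qf (fc P d id) x ∈ wedge α)
    {f : ℂ → ℂ} (hf : Admissible θ f) (hf1 : ∀ z ∈ wedge θ, ‖f z‖ ≤ 1) : ‖fc P d f‖ ≤ 4 := by
  have hpi := Real.pi_pos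
  have hc := Real.cos_pos_of_mem_Ioo ⟨by linarith, (by linarith : α < Real.pi / 2)⟩
  have hcθ := Real.cos_pos_of_mem_Ioo ⟨by linarith, (by linarith : θ < Real.pi / 2)⟩
  have hsub : wedge α ⊆ wedge θ := fun u hu => by
    obtain ⟨hpol, harg, hn⟩ := exists_polar hα (by linarith) hu
    rw [← hpol]; exact ray_mem_wedge hn (by linarith) (by linarith)
  have hd := fun i => hsub (mem_wedge_of_forall hc hP hA i)
  let S : Set ℝ := {t | ∃ f, Admissible θ f ∧ (∀ z ∈ wedge θ, ‖f z‖ ≤ 1) ∧ t = ‖fc P d f‖}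
  -- Diagonalizability makes the extremal constant finite, at most ‖P‖‖P⁻¹‖; the bound 4 no longer
  -- depends on P.
  have hbdd : BddAbove S := by
    refine ⟨‖P‖ * 1 * ‖P⁻¹‖, ?_⟩
    rintro _ ⟨g, hg, hg1, rfl⟩
    refine (norm_mul_le _ _).trans ?_
    gcongr
    refine (norm_mul_le _ _).trans ?_
    gcongr
    rw [Matrix.l2_opNorm_diagonal]
    exact (pi_norm_le_iff_of_nonneg zero_le_one).mpr fun i => hg1 _ (hd i)
  have hmem : ‖fc P d f‖ ∈ S := ⟨f, hf, hf1, rfl⟩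
  set K := sSup S
  have hK0 : 0 ≤ K := (norm_nonneg _).trans (le_csSup hbdd hmem)
  have hstep : ∀ t ∈ S, t ^ 4 ≤ 2 * K ^ 3 + 4 * K ^ 2 := by
    rintro _ ⟨g, hg, hg1, rfl⟩
    set X := fc P d g
    set Y := fc P d (conjTransform α g)
    have hX : ‖X‖ ≤ K := le_csSup hbdd ⟨g, hg, hg1, rfl⟩
    have hT : ‖X + Yᴴ‖ ≤ 2 := norm_fc_add_conjTranspose_le hα hαθ hθα hθ hP hA hg hg1
    have hXYX : ‖X * Y * X‖ ≤ 4 * K := by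
      -- f · Cf · f/4 is again a competitor on the same wedge. That is why `conjTransform` had to be
      -- bounded on all of `wedge θ`.
      have hadm : Admissible θ fun z => (1 / 4 : ℂ) * (g z * conjTransform α g z * g z) := by
        refine ⟨((hg.differentiableOn.mul (differentiableOn_conjTransform hαθ hθα hθ hg)).mul
          hg.differentiableOn).const_mul _, ?_⟩
        obtain ⟨C, hC0, hC⟩ := hg.decay
        refine ⟨C, hC0, fun z hz => le_trans ?_ (hC z hz)⟩
        have h1 := hg1 z hz
        have h2 := norm_conjTransform_le hαθ hθα hθ hg1 hz
        rw [norm_mul, norm_mul, norm_mul]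
        calc ‖(1 / 4 : ℂ)‖ * (‖g z‖ * ‖conjTransform α g z‖ * ‖g z‖)
            ≤ ‖(1 / 4 : ℂ)‖ * (1 * 4 * ‖g z‖) := by gcongr
          _ = ‖g z‖ := by norm_num; ring
      have h1 : ∀ z ∈ wedge θ, ‖(1 / 4 : ℂ) * (g z * conjTransform α g z * g z)‖ ≤ 1 := fun z hz => by
        have h1 := hg1 z hz
        have h2 := norm_conjTransform_le hαθ hθα hθ hg1 hz
        rw [norm_mul, norm_mul, norm_mul]
        calc ‖(1 / 4 : ℂ)‖ * (‖g z‖ * ‖conjTransform α g z‖ * ‖g z‖)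
            ≤ ‖(1 / 4 : ℂ)‖ * (1 * 4 * 1) := by gcongr
          _ = 1 := by norm_num
      have h2 := le_csSup hbdd ⟨_, hadm, h1, rfl⟩
      rw [fc_const_mul, fc_mul hP (fun z => g z * conjTransform α g z), fc_mul hP, norm_smul] at h2
      norm_num at h2
      linarith
    exact norm_pow_four_le hX hT hXYX
  exact (le_csSup hbdd hmem).trans (csSup_le_four hbdd hmem hstep)

/-- A sector of semiangle less than `π / 3` containing the numerical range of `A` is
`4`-spectral for `A`. -/
theorem norm_fc_le {θ α B : ℝ} (hα : 0 < α) (hαθ : α < θ) (hθα : θ ≤ 3 / 2 * α)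
    (hθ : θ < Real.pi / 3) (hP : IsUnit P.det) (hA : ∀ x ≠ 0, qf (fc P d id) x ∈ wedge α)
    {f : ℂ → ℂ} (hf : DifferentiableOn ℂ f (wedge θ)) (hB : 0 < B) (hf1 : ∀ z ∈ wedge θ, ‖f z‖ ≤ B) :
    ‖fc P d f‖ ≤ 4 * B := by
  have hpi := Real.pi_pos
  have hc := Real.cos_pos_of_mem_Ioo ⟨by linarith, (by linarith : α < Real.pi / 2)⟩
  have hcθ := Real.cos_pos_of_mem_Ioo ⟨by linarith, (by linarith : θ < Real.pi / 2)⟩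
  have hsθ := Real.sin_pos_of_pos_of_lt_pi (by linarith : 0 < θ) (by linarith)
  have hden : ∀ (N : ℕ), ∀ z ∈ wedge θ, ((N : ℝ) + 1 + ‖z‖) / 2 ≤ ‖(N : ℂ) + 1 + z‖ ∧
      (N : ℝ) + 1 ≤ ‖(N : ℂ) + 1 + z‖ := fun N z hz => by
    have hre := re_pos_of_mem_wedge hcθ.le hsθ.le hz
    have h2 : ‖(N : ℂ) + 1 + z‖ ^ 2 = ((N : ℝ) + 1) ^ 2 + 2 * (N + 1) * z.re + ‖z‖ ^ 2 := by
      rw [← normSq_eq_norm_sq, ← normSq_eq_norm_sq, normSq_apply, normSq_apply]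
      simp only [add_re, add_im, one_re, one_im, natCast_re, natCast_im]; ring
    have h3 : 0 ≤ ((N : ℝ) + 1) * z.re := by positivity
    constructor
    · refine (abs_le_of_sq_le_sq' ?_ (norm_nonneg _)).2
      nlinarith [sq_nonneg ((N : ℝ) + 1 - ‖z‖), sq_nonneg ((N : ℝ) + 1 + ‖z‖)]
    · refine (abs_le_of_sq_le_sq' ?_ (norm_nonneg _)).2
      nlinarith [sq_nonneg ‖z‖]
  -- The factors (N + 1)/(N + 1 + z) have modulus at most 1 on the right half plane and supply the
  -- decay; they tend to 1 at each eigenvalue.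
  have hN : ∀ N : ℕ, ‖fc P d fun z => ((N : ℂ) + 1) / (N + 1 + z) * ((B⁻¹ : ℝ) * f z)‖ ≤ 4 := fun N => by
    have hne : ∀ z ∈ wedge θ, (N : ℂ) + 1 + z ≠ 0 := fun z hz =>
      norm_pos_iff.mp (lt_of_lt_of_le (by positivity) (hden N z hz).2)
    have hnN : ‖(N : ℂ) + 1‖ = N + 1 := by
      rw [← Nat.cast_succ, norm_natCast]; push_cast; rfl
    have hle : ∀ z ∈ wedge θ, ‖((B⁻¹ : ℝ) : ℂ) * f z‖ ≤ 1 := fun z hz => by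
      rw [norm_mul, norm_real, Real.norm_of_nonneg (by positivity), inv_mul_le_iff₀ hB, mul_one]
      exact hf1 z hz
    refine norm_fc_le_of_admissible hα hαθ hθα hθ hP hA ⟨?_, 2 * (N + 1), by positivity, ?_⟩ ?_
    · exact ((differentiableOn_const _).div (by fun_prop) hne).mul (hf.const_mul _)
    · intro z hz
      rw [norm_mul, norm_div, hnN]
      refine (mul_le_of_le_one_right (by positivity) (hle z hz)).trans ?_
      rw [div_le_div_iff₀ (norm_pos_iff.mpr (hne z hz)) (by positivity)]
      have h1 := (hden N z hz).1
      have h2 : (0 : ℝ) ≤ N := by positivity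
      nlinarith [norm_nonneg z]
    · intro z hz
      rw [norm_mul, norm_div, hnN]
      refine mul_le_one₀ ?_ (norm_nonneg _) (hle z hz)
      rw [div_le_one (norm_pos_iff.mpr (hne z hz))]
      exact (hden N z hz).2
  have hlim : Tendsto (fun N : ℕ => fc P d fun z => ((N : ℂ) + 1) / (N + 1 + z) * ((B⁻¹ : ℝ) * f z))
      atTop (𝓝 (fc P d fun z => ((B⁻¹ : ℝ) : ℂ) * f z)) := by
    have h1 : ∀ z : ℂ, Tendsto (fun N : ℕ => ((N : ℂ) + 1) / (N + 1 + z)) atTop (𝓝 1) := fun z => by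
      have h2 := (tendsto_natCast_div_add_atTop (𝕜 := ℂ) z).comp (tendsto_add_atTop_nat 1)
      refine h2.congr fun N => ?_
      simp
    refine Tendsto.mul_const _ (Tendsto.const_mul _ ?_)
    refine ((Continuous.matrix_diagonal continuous_id).tendsto _).comp
      (tendsto_pi_nhds.mpr fun i => ?_)
    simpa using (h1 (d i)).mul_const (((B⁻¹ : ℝ) : ℂ) * f (d i))
  have := le_of_tendsto hlim.norm (Eventually.of_forall hN)
  rw [fc_const_mul, norm_smul, norm_real, Real.norm_of_nonneg (by positivity),
    inv_mul_le_iff₀ hB] at this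
  linarith

end

end RDArnoldi
end

/-! ### Interpolation errors for functions of sectorial matrices. -/

noncomputable section
namespace RDArnoldi
open Set Filter Topology Polynomial

theorem continuous_phi {A : Type*} [NormedRing A] [NormedAlgebra ℝ A] [CompleteSpace A] (k : ℕ) :
    Continuous (phi k : A → A) := by
  have hpow : ∀ (a : A) n, ‖a ^ n‖ ≤ ‖(1 : A)‖ * ‖a‖ ^ n := fun a n => by
    induction n with
    | zero => simp
    | succ n ih =>
      rw [pow_succ, pow_succ, ← mul_assoc]
      exact (norm_mul_le _ _).trans (mul_le_mul_of_nonneg_right ih (norm_nonneg _))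
  have hon : ∀ R : ℝ, ContinuousOn (phi k : A → A) (Metric.ball 0 R) := fun R => by
    refine continuousOn_tsum (u := fun n => (n ! : ℝ)⁻¹ * (‖(1 : A)‖ * |R| ^ n))
      (fun n => by fun_prop) ?_ fun n a ha => ?_
    · have := (Real.summable_pow_div_factorial |R|).mul_left ‖(1 : A)‖
      refine this.congr fun n => ?_
      ring
    · rw [mem_ball_zero_iff] at ha
      rw [norm_smul, norm_inv, Real.norm_natCast]
      gcongr
      · omega
      · refine (hpow a n).trans ?_
        gcongr
        exact ha.le.trans (le_abs_self R)
  refine continuous_iff_continuousAt.mpr fun a => ?_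
  exact (hon (‖a‖ + 1)).continuousAt (Metric.isOpen_ball.mem_nhds (by simp))

variable {n : ℕ}

theorem continuous_phi_matrix (k : ℕ) :
    Continuous (phi k : Matrix (Fin n) (Fin n) ℂ → Matrix (Fin n) (Fin n) ℂ) := by
  let _ : NormedRing (Matrix (Fin n) (Fin n) ℂ) := Matrix.linftyOpNormedRing
  let _ : NormedAlgebra ℝ (Matrix (Fin n) (Fin n) ℂ) := Matrix.linftyOpNormedAlgebra
  exact continuous_phi k

theorem hasSum_phi_matrix (k : ℕ) (B : Matrix (Fin n) (Fin n) ℝ) :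
    HasSum (fun j : ℕ => (((j + k)! : ℝ))⁻¹ • B ^ j) (phi k B) := by
  let _ : NormedRing (Matrix (Fin n) (Fin n) ℝ) := Matrix.linftyOpNormedRing
  let _ : NormedAlgebra ℝ (Matrix (Fin n) (Fin n) ℝ) := Matrix.linftyOpNormedAlgebra
  exact (summable_phi k B).hasSum

theorem cx_phi (k : ℕ) (B : Matrix (Fin n) (Fin n) ℝ) : cx (phi k B) = phi k (cx B) := by
  have h := (hasSum_phi_matrix k B).map (Complex.ofRealHom.mapMatrix (m := Fin n))
    (continuous_id.matrix_map Complex.continuous_ofReal)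
  refine (h.tsum_eq.symm.trans (tsum_congr fun j => ?_))
  ext a b
  simp only [Function.comp_apply, RingHom.mapMatrix_apply, Matrix.map_apply, Matrix.smul_apply,
    ← cx_pow]
  simp

section
variable {P : Matrix (Fin n) (Fin n) ℂ} {d : Fin n → ℂ}

theorem fc_one (hP : IsUnit P.det) : fc P d (fun _ => 1) = 1 := by rw [fc_const hP, one_smul]

theorem fc_sub (f g : ℂ → ℂ) : fc P d (fun z => f z - g z) = fc P d f - fc P d g := by
  simp only [fc, ← Matrix.diagonal_sub, Matrix.mul_sub, Matrix.sub_mul]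

theorem fc_pow (hP : IsUnit P.det) (f : ℂ → ℂ) (j : ℕ) :
    fc P d (fun z => f z ^ j) = fc P d f ^ j := by
  induction j with
  | zero => simp only [pow_zero]; exact fc_one hP
  | succ j ih => simp only [pow_succ]; rw [fc_mul hP, ih]

theorem aeval_fc (hP : IsUnit P.det) (f : ℂ → ℂ) (p : ℂ[X]) :
    aeval (fc P d f) p = fc P d (fun z => p.eval (f z)) := by
  induction p using Polynomial.induction_on' with
  | add p q hp hq => simp only [map_add, eval_add]; rw [hp, hq, fc_add]
  | monomial j a =>
    simp only [aeval_monomial, eval_monomial]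
    rw [fc_const_mul, fc_pow hP, Algebra.algebraMap_eq_smul_one, smul_one_mul]

theorem phi_fc (hP : IsUnit P.det) (k : ℕ) (f : ℂ → ℂ) :
    phi k (fc P d f) = fc P d (fun z => phi k (f z)) := by
  have h1 : HasSum (fun j : ℕ => fun i => (((j + k)! : ℝ))⁻¹ • f (d i) ^ j)
      (fun i => phi k (f (d i))) := Pi.hasSum.mpr fun i => (summable_phi k (f (d i))).hasSum
  have h2 := ((h1.matrix_diagonal).mul_left P).mul_right P⁻¹
  refine Eq.trans (tsum_congr fun j => ?_) h2.tsum_eq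
  rw [← fc_pow hP, fc, ← Matrix.smul_mul, ← Matrix.mul_smul, ← Matrix.diagonal_smul]
  rfl

theorem inv_fc (hP : IsUnit P.det) {f : ℂ → ℂ} (hf : ∀ i, f (d i) ≠ 0) :
    (fc P d f)⁻¹ = fc P d fun z => (f z)⁻¹ := by
  refine Matrix.inv_eq_right_inv ?_
  rw [← fc_mul hP, fc_congr (g := fun _ => 1), fc_one hP]
  exact fun i => mul_inv_cancel₀ (hf i)

theorem one_add_fc (hP : IsUnit P.det) : 1 + fc P d id = fc P d (fun z => 1 + z) := by
  rw [← fc_one (d := d) hP, ← fc_add]; rfl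

end

/-- `φ_k(τ (1 - 1 / z)) = p(z) + χ(z) g(z)` on a lens, with a bounded holomorphic `g`. -/
structure IsInterpolation (k : ℕ) (τ θ s B : ℝ) (p χ : ℂ[X]) (g : ℂ → ℂ) : Prop where
  differentiableOn : DifferentiableOn ℂ g (lens s θ)
  norm_le : ∀ z ∈ lens s θ, ‖g z‖ ≤ B
  eq : ∀ z ∈ lens s θ, phi k ((τ : ℂ) * (1 - z⁻¹)) = p.eval z + χ.eval z * g z

theorem add_ne_zero_of_mem_wedge {θ s : ℝ} (h0 : 0 < θ) (hθ : θ < Real.pi / 2) (hs : 0 < s) {b : ℂ}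
    (hb : b ∈ wedge θ) : (s : ℂ) + b ≠ 0 := fun h => by
  have hc := Real.cos_pos_of_mem_Ioo ⟨by linarith, hθ⟩
  have hsin := Real.sin_pos_of_pos_of_lt_pi h0 (by linarith)
  have h1 := re_pos_of_mem_wedge hc.le hsin.le hb
  have h2 := congrArg Complex.re h
  simp at h2
  linarith

/-- The scalar identity f - p = gχ evaluated at 1/(1 + d_i). Writing 1 + z = s + (z + (1 - s))
presents g as a function b ↦ g(1/(s + b)) on a sector with vertex 0, applied to A + (1 - s). -/
theorem phi_sub_aeval_fc {k : ℕ} {τ θ s B : ℝ} {p χ : ℂ[X]} {g : ℂ → ℂ}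
    (h : IsInterpolation k τ θ s B p χ g) (h0 : 0 < θ) (hθ : θ < Real.pi / 2) (hs : 0 < s)
    {P : Matrix (Fin n) (Fin n) ℂ} {d : Fin n → ℂ} (hP : IsUnit P.det)
    (hd : ∀ i, d i + (1 - s : ℝ) ∈ wedge θ) :
    phi k ((-τ) • fc P d id) - aeval (1 + fc P d id)⁻¹ p =
      fc P d (fun z => g (s + (z + (1 - s : ℝ)))⁻¹) * aeval (1 + fc P d id)⁻¹ χ := by
  have hne : ∀ i, (1 : ℂ) + d i ≠ 0 := fun i => by
    have := add_ne_zero_of_mem_wedge h0 hθ hs (hd i)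
    push_cast at this
    rwa [show (s : ℂ) + (d i + (1 - s)) = 1 + d i by ring] at this
  have hsm : (-τ) • fc P d id = fc P d (fun z => ((-τ : ℝ) : ℂ) * z) := by
    rw [fc_const_mul]; ext; simp [fc]
  rw [one_add_fc hP, inv_fc hP hne, aeval_fc hP, aeval_fc hP, hsm, phi_fc hP, ← fc_sub, ← fc_mul hP]
  refine fc_congr fun i => ?_
  have hmem : (s + (d i + (1 - s : ℝ)))⁻¹ ∈ lens s θ := by
    rw [inv_mem_lens_iff (add_ne_zero_of_mem_wedge h0 hθ hs (hd i)), add_sub_cancel_left]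
    exact hd i
  have hs1 : (s : ℂ) + (d i + (1 - s : ℝ)) = 1 + d i := by push_cast; ring
  have := h.eq _ hmem
  rw [hs1] at this ⊢
  rw [inv_inv, show (τ : ℂ) * (1 - (1 + d i)) = ((-τ : ℝ) : ℂ) * d i by push_cast; ring] at this
  rw [this]; ring

open scoped Matrix.Norms.L2Operator in
theorem nrm_phi_sub_aeval_fc_le {k : ℕ} {τ θ s α B : ℝ} {p χ : ℂ[X]} {g : ℂ → ℂ}
    (h : IsInterpolation k τ θ s B p χ g) (hB : 0 < B) (hα : 0 < α) (hαθ : α < θ)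
    (hθα : θ ≤ 3 / 2 * α) (hθ : θ < Real.pi / 3) (hs : 0 < s)
    {P : Matrix (Fin n) (Fin n) ℂ} {d : Fin n → ℂ} (hP : IsUnit P.det)
    (hA : ∀ x ≠ 0, qf (fc P d id) x + ((1 - s) * nrm x ^ 2 : ℝ) ∈ wedge α) (y : Fin n → ℂ) :
    nrm ((phi k ((-τ) • fc P d id) - aeval (1 + fc P d id)⁻¹ p) *ᵥ y) ≤
      4 * B * nrm (aeval (1 + fc P d id)⁻¹ χ *ᵥ y) := by
  have hpi := Real.pi_pos
  have hc := Real.cos_pos_of_mem_Ioo ⟨by linarith, (by linarith : α < Real.pi / 2)⟩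
  set d' : Fin n → ℂ := fun i => d i + (1 - s : ℝ)
  have hshift : ∀ f : ℂ → ℂ, fc P d' f = fc P d (fun z => f (z + (1 - s : ℝ))) := fun f => rfl
  have hA' : ∀ x ≠ 0, qf (fc P d' id) x ∈ wedge α := fun x hx => by
    have : qf (fc P d' id) x = qf (fc P d id) x + ((1 - s) * nrm x ^ 2 : ℝ) := by
      rw [hshift, show (fun z : ℂ => id (z + (1 - s : ℝ))) = fun z => id z + (fun _ => ((1 - s : ℝ) : ℂ)) z
        from rfl, fc_add, fc_const hP, qf, Matrix.add_mulVec, dotProduct_add, Matrix.smul_mulVec,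
        Matrix.one_mulVec, dotProduct_smul, star_dotProduct_self, qf]
      push_cast; rfl
    rw [this]; exact hA x hx
  have hd : ∀ i, d' i ∈ wedge θ := fun i => by
    obtain ⟨hpol, harg, hn⟩ := exists_polar hα (by linarith) (mem_wedge_of_forall hc hP hA' i)
    rw [← hpol]; exact ray_mem_wedge hn (by linarith) (by linarith)
  rw [phi_sub_aeval_fc h (by linarith) (by linarith) hs hP hd, ← Matrix.mulVec_mulVec]
  refine (nrm_mulVec_le _ _).trans (mul_le_mul_of_nonneg_right ?_ (nrm_nonneg _))
  have hmaps : ∀ b ∈ wedge θ, (s + b)⁻¹ ∈ lens s θ := fun b hb => by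
    rw [inv_mem_lens_iff (add_ne_zero_of_mem_wedge (by linarith) (by linarith) hs hb),
      add_sub_cancel_left]
    exact hb
  have := norm_fc_le (d := d') hα hαθ hθα hθ hP hA' (f := fun b => g (s + b)⁻¹)
    (h.differentiableOn.comp (DifferentiableOn.inv (by fun_prop) fun b hb =>
      add_ne_zero_of_mem_wedge (by linarith) (by linarith) hs hb) hmaps) hB
    (fun b hb => h.norm_le _ (hmaps b hb))
  rwa [hshift] at this

theorem continuous_nrm : Continuous (nrm : (Fin n → ℂ) → ℝ) :=
  continuous_norm.comp (PiLp.continuous_toLp 2 _)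

theorem continuousAt_inv_of_isUnit_det {A : Matrix (Fin n) (Fin n) ℂ} (h : IsUnit A.det) :
    ContinuousAt (Inv.inv : Matrix (Fin n) (Fin n) ℂ → _) A :=
  continuousAt_matrix_inv A (NormedRing.inverse_continuousAt h.unit)

open scoped Matrix.Norms.L2Operator in
-- The shift by ε moves the form into the open sector with a margin proportional to ‖x‖², which
-- absorbs the perturbation.
theorem IsSectorial.add_small_mem_wedge {A D : Matrix (Fin n) (Fin n) ℂ} {θ α ε : ℝ} (h0 : 0 ≤ θ)
    (hθα : θ ≤ α) (hα0 : 0 < α) (hα : α < Real.pi / 2) (h : IsSectorial θ A) {t : ℂ}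
    (ht : ‖t‖ * ‖D‖ * 2 < ε * Real.sin α) {x : Fin n → ℂ} (hx : x ≠ 0) :
    qf (A + t • D) x + (ε * nrm x ^ 2 : ℝ) ∈ wedge α := by
  obtain ⟨h1, h2⟩ := h x
  have hc := Real.cos_pos_of_mem_Ioo ⟨by linarith, hα⟩
  have hs := Real.sin_pos_of_pos_of_lt_pi hα0 (by linarith)
  have hcos : Real.cos α ≤ Real.cos θ := Real.cos_le_cos_of_nonneg_of_le_pi h0 (by linarith) hθα
  have hsin : Real.sin θ ≤ Real.sin α :=
    Real.sin_le_sin_of_le_of_le_pi_div_two (by linarith) hα.le hθα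
  have hN : 0 < nrm x ^ 2 := pow_pos (nrm_pos hx) 2
  have hD := norm_qf_le D x
  have hq : qf (A + t • D) x = qf A x + t * qf D x := by
    rw [qf, Matrix.add_mulVec, dotProduct_add, Matrix.smul_mulVec, dotProduct_smul]; rfl
  have hw : ‖t * qf D x‖ ≤ ‖t‖ * ‖D‖ * nrm x ^ 2 := by
    rw [norm_mul, mul_assoc]
    exact mul_le_mul_of_nonneg_left hD (norm_nonneg t)
  set w := t * qf D x
  have hre := (abs_le.mp ((Complex.abs_re_le_norm w).trans hw)).1
  have him := (Complex.abs_im_le_norm w).trans hw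
  rw [hq]
  simp only [wedge, mem_ofPred_eq, Complex.add_im, Complex.add_re, Complex.ofReal_im,
    Complex.ofReal_re, add_zero]
  set c := ‖t‖ * ‖D‖
  have hc0 : 0 ≤ c := by positivity
  have h3 : |(qf A x).im + w.im| ≤ |(qf A x).im| + c * nrm x ^ 2 :=
    (abs_add_le _ _).trans (by linarith)
  have h4 : |(qf A x).im| * Real.cos α ≤ (qf A x).re * Real.sin α :=
    (mul_le_mul_of_nonneg_left hcos (abs_nonneg _)).trans
      (h2.trans (mul_le_mul_of_nonneg_left hsin h1))
  have h5 := mul_le_mul_of_nonneg_right h3 hc.le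
  have h6 : c * nrm x ^ 2 * Real.cos α ≤ c * nrm x ^ 2 * 1 :=
    mul_le_mul_of_nonneg_left (Real.cos_le_one α) (by positivity)
  have h7 : c * nrm x ^ 2 * Real.sin α ≤ c * nrm x ^ 2 * 1 :=
    mul_le_mul_of_nonneg_left (Real.sin_le_one α) (by positivity)
  have h8 := mul_lt_mul_of_pos_right ht hN
  have h9 := mul_le_mul_of_nonneg_right hre hs.le
  linarith

open scoped Matrix.Norms.L2Operator in
/-- Error of the rational approximation `p((1 + A)⁻¹) y` of `φ_k(-τ A) y`, for a sectorial
matrix `A`. -/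
theorem IsSectorial.nrm_phi_sub_aeval_le {k : ℕ} {τ θ θ' s B : ℝ} {p χ : ℂ[X]} {g : ℂ → ℂ}
    (h : IsInterpolation k τ θ' s B p χ g) (hB : 0 < B) (h0 : 0 ≤ θ) (hθ : θ < θ')
    (hθ' : θ' < Real.pi / 3) (hs : 0 < s) (hs1 : s < 1) {A : Matrix (Fin n) (Fin n) ℂ}
    (hA : IsSectorial θ A) (y : Fin n → ℂ) :
    nrm ((phi k ((-τ) • A) - aeval (1 + A)⁻¹ p) *ᵥ y) ≤ 4 * B * nrm (aeval (1 + A)⁻¹ χ *ᵥ y) := by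
  have hpi := Real.pi_pos
  obtain ⟨D, hD⟩ := exists_direction_diagonalizable A
  -- This α lies strictly between θ and θ' and satisfies θ' ≤ 3α/2 for every θ ≥ 0, as `norm_fc_le`
  -- requires.
  set α := (θ + 3 * θ') / 4 with hα
  have hs0 : 0 < Real.sin α := Real.sin_pos_of_pos_of_lt_pi (by linarith) (by linarith)
  have hev : ∀ᶠ t in 𝓝[≠] (0 : ℂ),
      nrm ((phi k ((-τ) • (A + t • D)) - aeval (1 + (A + t • D))⁻¹ p) *ᵥ y) ≤
      4 * B * nrm (aeval (1 + (A + t • D))⁻¹ χ *ᵥ y) := by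
    have hsmall : ∀ᶠ t in 𝓝[≠] (0 : ℂ), ‖t‖ * ‖D‖ * 2 < (1 - s) * Real.sin α := by
      have : Tendsto (fun t : ℂ => ‖t‖ * ‖D‖ * 2) (𝓝[≠] 0) (𝓝 (‖(0 : ℂ)‖ * ‖D‖ * 2)) :=
        (Continuous.tendsto (by fun_prop) 0).mono_left nhdsWithin_le_nhds
      refine this.eventually_lt_const ?_
      rw [norm_zero, zero_mul, zero_mul]
      exact mul_pos (by linarith) hs0
    filter_upwards [hD, hsmall] with t ⟨P, d, hP, hPd⟩ ht
    have hfc : A + t • D = fc P d id := hPd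
    have := nrm_phi_sub_aeval_fc_le h hB (by linarith : 0 < α) (by linarith) (by linarith) hθ' hs hP
      (d := d) (fun x hx => by
        rw [← hfc]
        exact hA.add_small_mem_wedge h0 (by linarith) (by linarith) (by linarith) ht hx) y
    rwa [← hfc] at this
  have hlin : Tendsto (fun t : ℂ => A + t • D) (𝓝[≠] 0) (𝓝 A) := by
    have : Tendsto (fun t : ℂ => A + t • D) (𝓝 0) (𝓝 (A + (0 : ℂ) • D)) :=
      Continuous.tendsto (by fun_prop) 0
    rw [zero_smul, add_zero] at this
    exact this.mono_left nhdsWithin_le_nhds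
  have hinv : Tendsto (fun t : ℂ => (1 + (A + t • D))⁻¹) (𝓝[≠] 0) (𝓝 (1 + A)⁻¹) :=
    (continuousAt_inv_of_isUnit_det hA.isUnit_det_one_add).tendsto.comp (hlin.const_add 1)
  have hpoly : ∀ q : ℂ[X], Tendsto (fun t : ℂ => aeval (1 + (A + t • D))⁻¹ q) (𝓝[≠] 0)
      (𝓝 (aeval (1 + A)⁻¹ q)) := fun q => ((q.continuous_aeval).tendsto _).comp hinv
  have hphi : Tendsto (fun t : ℂ => phi k ((-τ) • (A + t • D))) (𝓝[≠] 0) (𝓝 (phi k ((-τ) • A))) :=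
    ((continuous_phi_matrix k).tendsto _).comp (hlin.const_smul (-τ))
  have hmv : ∀ {F : ℂ → Matrix (Fin n) (Fin n) ℂ} {X}, Tendsto F (𝓝[≠] 0) (𝓝 X) →
      Tendsto (fun t => nrm (F t *ᵥ y)) (𝓝[≠] 0) (𝓝 (nrm (X *ᵥ y))) := fun {F X} hF =>
    ((continuous_nrm.comp (Continuous.matrix_mulVec continuous_id continuous_const)).tendsto X).comp
      hF
  exact le_of_tendsto_of_tendsto (hmv (hphi.sub (hpoly p))) ((hmv (hpoly χ)).const_mul _) hev

open scoped Matrix.Norms.L2Operator in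
theorem IsSectorial.nrm_phi_sub_aeval_le_of_isHermitian {k : ℕ} {τ θ θ' s B : ℝ} {p χ : ℂ[X]}
    {g : ℂ → ℂ} (h : IsInterpolation k τ θ' s B p χ g) (hB : 0 < B) (hθ : 0 < θ')
    (hθ' : θ' < Real.pi / 2) (hs : 0 < s) (hs1 : s < 1) {A : Matrix (Fin n) (Fin n) ℂ}
    (hA : IsSectorial θ A) (hH : A.IsHermitian) (y : Fin n → ℂ) :
    nrm ((phi k ((-τ) • A) - aeval (1 + A)⁻¹ p) *ᵥ y) ≤ B * nrm (aeval (1 + A)⁻¹ χ *ᵥ y) := by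
  set U : Matrix (Fin n) (Fin n) ℂ := hH.eigenvectorUnitary.1
  have hU : Uᴴ * U = 1 := (Matrix.mem_unitaryGroup_iff').mp hH.eigenvectorUnitary.2
  have hU' : U⁻¹ = Uᴴ := Matrix.inv_eq_left_inv hU
  have hP : IsUnit U.det := (Matrix.isUnit_iff_isUnit_det U).mp
    (IsUnit.of_mul_eq_one_right _ hU)
  set d : Fin n → ℂ := fun i => (hH.eigenvalues i : ℂ)
  have hfc : A = fc U d id := by
    rw [fc, hU']; exact hH.spectral_theorem
  have hs0 : 0 < Real.sin θ' := Real.sin_pos_of_pos_of_lt_pi hθ (by linarith)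
  have hd : ∀ i, d i + (1 - s : ℝ) ∈ wedge θ' := fun i => by
    obtain ⟨x, hx, hq⟩ := exists_eigenvector (d := d) hP i
    have h1 := (hA x).1
    rw [hfc, hq, mul_comm, Complex.re_ofReal_mul, Complex.ofReal_re] at h1
    have h2 : 0 ≤ hH.eigenvalues i := nonneg_of_mul_nonneg_right h1 (pow_pos (nrm_pos hx) 2)
    simp only [wedge, mem_ofPred_eq, d, Complex.add_im, Complex.add_re, Complex.ofReal_im,
      Complex.ofReal_re, add_zero, abs_zero, zero_mul]
    exact mul_pos (by linarith) hs0
  rw [hfc, phi_sub_aeval_fc h hθ hθ' hs hP hd, ← Matrix.mulVec_mulVec]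
  refine (nrm_mulVec_le _ _).trans (mul_le_mul_of_nonneg_right ?_ (nrm_nonneg _))
  have hUn : ‖U‖ ≤ 1 := norm_le_of_forall_nrm_le zero_le_one fun x => by
    rw [nrm_mulVec_isometry hU, one_mul]
  have hUn' : ‖U⁻¹‖ ≤ 1 := by rwa [hU', Matrix.l2_opNorm_conjTranspose]
  rw [fc]
  refine (norm_mul_le _ _).trans ((mul_le_of_le_one_right (norm_nonneg _) hUn').trans ?_)
  refine (norm_mul_le _ _).trans ((mul_le_of_le_one_left (norm_nonneg _) hUn).trans ?_)
  rw [Matrix.l2_opNorm_diagonal]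
  refine (pi_norm_le_iff_of_nonneg hB.le).mpr fun i => h.norm_le _ ?_
  rw [inv_mem_lens_iff (add_ne_zero_of_mem_wedge hθ hθ' hs (hd i)), add_sub_cancel_left]
  exact hd i

end RDArnoldi
end

/-! ### Assembly of the error bound. -/

noncomputable section
namespace RDArnoldi
open Set Filter Topology Polynomial

theorem differentiable_phi (k : ℕ) : Differentiable ℂ (phi k : ℂ → ℂ) := by
  induction k with
  | zero =>
    have : (phi 0 : ℂ → ℂ) = Complex.exp := by
      ext z; rw [phi_zero, Complex.exp_eq_exp_ℂ]
    rw [this]; exact Complex.differentiable_exp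
  | succ k ih =>
    rw [← differentiableOn_univ]
    refine (Complex.differentiableOn_compl_singleton_and_continuousAt_iff (c := 0) univ_mem).mp
      ⟨?_, (continuous_phi (k + 1)).continuousAt⟩
    have : DifferentiableOn ℂ (fun z : ℂ => (phi k z - 1 / (k ! : ℂ)) / z) (univ \ {0}) :=
      (ih.differentiableOn.sub_const _).div differentiableOn_id fun z hz => hz.2
    exact this.congr fun z hz => phi_succ_complex k z hz.2

theorem exists_isInterpolation {k m : ℕ} {τ θ θ' s : ℝ} (hτ : 0 < τ) (h0 : 0 ≤ θ) (hθ : θ < θ')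
    (hθ' : θ' < Real.pi / 3) (hs : 0 < s) (hs1 : s < 1) {H : Matrix (Fin (m + 1)) (Fin (m + 1)) ℂ}
    (hH : IsUnit H.det) (h : IsSectorial θ (H⁻¹ - 1)) :
    ∃ (p : ℂ[X]) (g : ℂ → ℂ), p.degree < (m + 1 : ℕ) ∧
      IsInterpolation k τ θ' s (lensBound k (m + 1) τ θ' s) p H.charpoly g := by
  have hpi := Real.pi_pos
  have hcos : 1 / 2 < Real.cos θ' := by
    rw [← Real.cos_pi_div_three]
    exact Real.cos_lt_cos_of_nonneg_of_le_pi (by linarith) (by linarith) hθ'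
  have hsin : 0 < Real.sin θ' := Real.sin_pos_of_pos_of_lt_pi (by linarith) (by linarith)
  have hmonic := H.charpoly_monic
  have hS : ∀ a ∈ H.charpoly.roots, a ∈ lens s θ' := fun a ha =>
    mem_lens_of_isRoot_charpoly h0 hθ (by linarith) hs1 hH h ((mem_roots hmonic.ne_zero).mp ha)
  have hsplit := IsAlgClosed.splits H.charpoly
  have hcard : H.charpoly.roots.card = m + 1 := by
    rw [splits_iff_card_roots.mp hsplit, Matrix.charpoly_natDegree_eq_dim, Fintype.card_fin]
  have hnodal : nodal H.charpoly.roots = H.charpoly := (hsplit.eq_prod_roots_of_monic hmonic).symm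
  have hf : DifferentiableOn ℂ (fun z : ℂ => phi k ((τ : ℂ) * (1 - z⁻¹))) (lens s θ') := by
    refine (differentiable_phi k).comp_differentiableOn ?_
    exact (DifferentiableOn.const_sub (differentiableOn_id.inv fun z hz => ne_zero_of_mem_lens hz) 1).const_mul _
  obtain ⟨p, g, hp, hg, heq⟩ := exists_newton_interpolation (isOpen_lens s θ') hf _ hS
  rw [hcard] at hp
  refine ⟨p, g, hp, hg, ?_, fun z _ => by rw [heq z, hnodal]⟩
  exact norm_divided_difference_le (by omega) hτ hs hs1 hcos hsin hS hcard hp hg fun z _ => heq z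

theorem IsInterpolation.mono {k : ℕ} {τ θ s B B' : ℝ} {p χ : ℂ[X]} {g : ℂ → ℂ}
    (h : IsInterpolation k τ θ s B p χ g) (hB : B ≤ B') : IsInterpolation k τ θ s B' p χ g :=
  ⟨h.differentiableOn, fun z hz => (h.norm_le z hz).trans hB, h.eq⟩

theorem IsInterpolation.phi_eq_aeval {m k : ℕ} {τ θ θ' s B : ℝ} {p : ℂ[X]} {g : ℂ → ℂ}
    {H : Matrix (Fin m) (Fin m) ℂ} (h : IsInterpolation k τ θ' s B p H.charpoly g) (hB : 0 < B)
    (h0 : 0 ≤ θ) (hθ : θ < θ') (hθ' : θ' < Real.pi / 3) (hs : 0 < s) (hs1 : s < 1)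
    (hH : IsUnit H.det) (hA : IsSectorial θ (H⁻¹ - 1)) : phi k (τ • (1 - H⁻¹)) = aeval H p := by
  -- Apply the error estimate to A = H⁻¹ - 1, for which (1 + A)⁻¹ = H. Its right side contains χ(H)
  -- = 0, so f(H) = p(H) also when H is not diagonalizable.
  have h1 : (1 + (H⁻¹ - 1))⁻¹ = H := by rw [add_sub_cancel, Matrix.nonsing_inv_nonsing_inv _ hH]
  rw [← sub_eq_zero]
  refine Matrix.ext_of_mulVec_single fun i => ?_
  have h2 := hA.nrm_phi_sub_aeval_le h hB h0 hθ hθ' hs hs1 (Pi.single i 1)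
  rw [h1, Matrix.aeval_self_charpoly, Matrix.zero_mulVec, nrm_eq_zero.mpr rfl, mul_zero,
    neg_smul, ← smul_neg, neg_sub] at h2
  rw [Matrix.zero_mulVec]
  exact nrm_eq_zero.mp (le_antisymm h2 (nrm_nonneg _))

theorem cx_inv {n : ℕ} {B : Matrix (Fin n) (Fin n) ℝ} (hB : IsUnit (cx B).det) :
    cx B⁻¹ = (cx B)⁻¹ := by
  have h1 : IsUnit B.det := by
    rw [isUnit_iff_ne_zero] at hB ⊢
    intro h
    refine hB ?_
    rw [cx, ← RingHom.mapMatrix_apply, ← RingHom.map_det, h, map_zero]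
  refine (Matrix.inv_eq_left_inv ?_).symm
  have := congrArg Complex.ofRealHom.mapMatrix (Matrix.nonsing_inv_mul B h1)
  rwa [map_mul, map_one] at this

section
variable {M k m : ℕ} {L : Matrix (Fin M) (Fin M) ℝ} {v : EuclideanSpace ℝ (Fin M)} {θ h δ : ℝ}

/-- The error bound on a slightly larger sector with a slightly smaller shift. -/
theorem norm_error_le (hv : ‖v‖ = 1) (h0 : 0 ≤ θ) (hh : 0 < h) (hδ : 0 < δ)
    (hL : numericalRange L ⊆ sector θ) (hbr : NoBreakdown (shiftInv δ L) v (m + 1)) {t : ℝ}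
    (ht : 0 < t) (ht1 : t < 1) (hθt : θ + t < Real.pi / 3) :
    ‖exactVec k h L v - approxVec k h δ L v (m + 1)‖ ≤
      4 * (|lensBound k (m + 1) (h / δ) (θ + t) (1 - t)| + t) * subdiagProd (shiftInv δ L) v (m + 1) ∧
    (L.IsSymm → ‖exactVec k h L v - approxVec k h δ L v (m + 1)‖ ≤
      (|lensBound k (m + 1) (h / δ) (θ + t) (1 - t)| + t) *
        subdiagProd (shiftInv δ L) v (m + 1)) := by
  have hpi := Real.pi_pos
  set Z := shiftInv δ L with hZ
  set τ := h / δ with hτ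
  have hτ0 : 0 < τ := div_pos hh hδ
  -- Absolute value and the summand t make B positive without any discussion of signs; both
  -- disappear as t → 0.
  set B := |lensBound k (m + 1) τ (θ + t) (1 - t)| + t
  have hB : 0 < B := by positivity
  set A := cx (-(δ • L)) with hA
  have hAs : IsSectorial θ A := isSectorial_of_numericalRange_subset h0 (by linarith) hδ hL
  have hA1 : cx (1 - δ • L) = 1 + A := by
    have : (1 - δ • L) = 1 + -(δ • L) := sub_eq_add_neg _ _
    rw [this, hA]
    have := map_add (Complex.ofRealHom.mapMatrix (m := Fin M)) 1 (-(δ • L))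
    rwa [map_one] at this
  have hZc : cx Z = (1 + A)⁻¹ := by
    rw [hZ, shiftInv, cx_inv (by rw [hA1]; exact hAs.isUnit_det_one_add), hA1]
  have horth := hbr.orthonormalUpTo hv
  set V := arnoldiV Z v (m + 1) with hV
  set H := arnoldiH Z v (m + 1) with hH
  have hVt : (cx V)ᴴ = cx Vᵀ := by ext i j; simp
  have hVV : (cx V)ᴴ * cx V = 1 := by
    rw [hVt, ← Matrix.map_mul, arnoldiV_transpose_mul_self horth]
    exact map_one (Complex.ofRealHom.mapMatrix (m := Fin (m + 1)))
  have hHc : cx H = (cx V)ᴴ * (1 + A)⁻¹ * cx V := by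
    rw [hVt, ← hZc, ← Matrix.map_mul, ← Matrix.map_mul, hH, arnoldiH_eq]
  obtain ⟨hHu, hHs⟩ := hAs.compression
    (Real.sin_nonneg_of_nonneg_of_le_pi h0 (by linarith)) hVV hHc
  obtain ⟨p, g, hp, hint⟩ := exists_isInterpolation (k := k) hτ0 h0 (by linarith : θ < θ + t) hθt
    (by linarith : 0 < 1 - t) (by linarith) hHu hHs
  have hint := hint.mono (B' := B) (by linarith [le_abs_self (lensBound k (m + 1) τ (θ + t) (1 - t))])
  have hphiH := hint.phi_eq_aeval hB h0 (by linarith) hθt (by linarith) (by linarith) hHu hHs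
  have hf : cx (fMat k τ H) = aeval (cx H) p := by
    rw [fMat, cx_phi, ← hphiH, ← cx_inv hHu]
    congr 1
    ext i j; simp [Matrix.one_apply, apply_ite]
  have hhL : cx (h • L) = (-τ) • A := by
    ext i j
    simp only [Matrix.map_apply, Matrix.smul_apply, Matrix.neg_apply, hA, smul_eq_mul,
      Complex.ofRealHom_eq_coe, Complex.real_smul]
    rw [← Complex.ofReal_mul, hτ]
    congr 1
    field_simp
  have hE : ‖exactVec k h L v - approxVec k h δ L v (m + 1)‖ =
      nrm ((phi k ((-τ) • A) - aeval (1 + A)⁻¹ p) *ᵥ cxv v.ofLp) := by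
    rw [← norm_cxv, nrm]
    congr 2
    have h1 : (exactVec k h L v - approxVec k h δ L v (m + 1)).ofLp =
        phi k (h • L) *ᵥ v.ofLp - V *ᵥ (fMat k τ H *ᵥ e₀ m) := rfl
    have h2 : ∀ x y : Fin M → ℝ, cxv (x - y) = cxv x - cxv y := fun x y =>
      funext fun i => Complex.ofReal_sub (x i) (y i)
    rw [h1, h2, cxv_mulVec, cxv_mulVec, cxv_mulVec, hf, cx_phi, hhL, Matrix.sub_mulVec, ← hZc,
      aeval_mulVec_eq horth hp]
  -- Only ‖v_{m+1}‖ ≤ 1 is needed, so the case where the last subdiagonal entry is zero is included.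
  have hχ : nrm (aeval (1 + A)⁻¹ (cx H).charpoly *ᵥ cxv v.ofLp) ≤ subdiagProd Z v (m + 1) := by
    rw [← hZc, charpoly_mulVec_eq horth, nrm, WithLp.toLp_smul, norm_smul, norm_cxv,
      Complex.norm_real, Real.norm_of_nonneg (subdiagProd_nonneg horth)]
    exact mul_le_of_le_one_right (subdiagProd_nonneg horth) (norm_arnoldiVec_succ_le _ _ _)
  rw [hE]
  constructor
  · refine (hAs.nrm_phi_sub_aeval_le hint hB h0 (by linarith) hθt (by linarith) (by linarith)
      _).trans ?_
    gcongr
  · intro hsymm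
    have hherm : A.IsHermitian := by
      ext i j
      have := congrFun (congrFun hsymm i) j
      simp only [Matrix.transpose_apply] at this
      simp [hA, this]
    refine (hAs.nrm_phi_sub_aeval_le_of_isHermitian hint hB (by linarith) (by linarith)
      (by linarith) (by linarith) hherm _).trans ?_
    gcongr

theorem cos_gt_half {θ : ℝ} (h0 : 0 ≤ θ) (hθ : θ < Real.pi / 3) : 1 / 2 < Real.cos θ := by
  rw [← Real.cos_pi_div_three]
  exact Real.cos_lt_cos_of_nonneg_of_le_pi h0 (by linarith [Real.pi_pos]) hθ

theorem bound₁_eq_mul (K τ θ P : ℝ) : bound₁ K k m τ θ P = K * bound₁ 1 k m τ θ P := by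
  unfold bound₁; ring

theorem cCoeff_pos (j : ℕ) (θ : ℝ) : 0 < cCoeff j θ := by unfold cCoeff; positivity

/-- Termwise |L_n^{(k)}(τ)| ≤ C(n + k, k) e^{τ/2}; this factor accounts for the change from cos θ -
1/2 to cos θ in the exponent. -/
theorem bigC_le {τ : ℝ} (hτ : 0 < τ) (θ : ℝ) : bigC k m τ θ ≤ Real.exp (τ / 2) * bigC' k m θ := by
  unfold bigC bigC'
  rw [mul_left_comm]
  refine mul_le_mul_of_nonneg_left ?_ (by positivity)
  rw [Finset.mul_sum]
  refine Finset.sum_le_sum fun j hj => ?_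
  rw [Finset.mem_range] at hj
  rw [← mul_assoc]
  refine mul_le_mul_of_nonneg_right ?_ (cCoeff_pos j θ).le
  have := abs_laguerre_le hτ (m - 1 - j) k
  rwa [mul_comm, show m - 1 - j + k = m + k - j - 1 by omega] at this

theorem bound₁_le_bound₂ {K τ θ P : ℝ} (hK : 0 ≤ K) (hτ : 0 < τ) (hθ : 1 / 2 < Real.cos θ)
    (hP : 0 ≤ P) : bound₁ K k m τ θ P ≤ bound₂ K k m τ θ P := by
  have hexp : Real.exp (τ * (Real.cos θ - 1 / 2) - m - k - 1) * Real.exp (τ / 2) =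
      Real.exp (τ * Real.cos θ - m - k - 1) := by rw [← Real.exp_add]; ring_nf
  have h1 : 0 < 2 * Real.cos θ - 1 := by linarith
  unfold bound₁ bound₂
  rw [← hexp]
  calc _ ≤ K * (Real.exp (τ * (Real.cos θ - 1 / 2) - m - k - 1) / τ ^ (m + k)) *
        (2 * (m + k + 1) / (2 * Real.cos θ - 1)) ^ (m + k + 1) *
        (Real.exp (τ / 2) * bigC' k m θ) * P := by
        gcongr
        exact bigC_le hτ θ
    _ = _ := by ring

theorem norm_error_le_bound₁ (hv : ‖v‖ = 1) (h0 : 0 ≤ θ) (hθ : θ < Real.pi / 3) (hh : 0 < h)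
    (hδ : 0 < δ) (hL : numericalRange L ⊆ sector θ)
    (hbr : NoBreakdown (shiftInv δ L) v (m + 1)) :
    ‖exactVec k h L v - approxVec k h δ L v (m + 1)‖ ≤
      4 * bound₁ 1 k (m + 1) (h / δ) θ (subdiagProd (shiftInv δ L) v (m + 1)) ∧
    (L.IsSymm → ‖exactVec k h L v - approxVec k h δ L v (m + 1)‖ ≤
      bound₁ 1 k (m + 1) (h / δ) θ (subdiagProd (shiftInv δ L) v (m + 1))) := by
  have hτ0 : 0 < h / δ := div_pos hh hδ
  set Q := subdiagProd (shiftInv δ L) v (m + 1)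
  have hev : ∀ᶠ t : ℝ in 𝓝[>] 0, 0 < t ∧ t < 1 ∧ θ + t < Real.pi / 3 := by
    have h1 : Ioo (0 : ℝ) (min 1 (Real.pi / 3 - θ)) ∈ 𝓝[>] (0 : ℝ) :=
      Ioo_mem_nhdsGT (lt_min one_pos (by linarith))
    filter_upwards [h1] with t ht
    exact ⟨ht.1, ht.2.trans_le (min_le_left _ _), by linarith [ht.2.trans_le (min_le_right _ _)]⟩
  have hnn : 0 ≤ lensBound k (m + 1) (h / δ) θ 1 := by
    have := cos_gt_half h0 hθ
    unfold lensBound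
    have hc := fun j => (cCoeff_pos j θ).le
    have h1 : 0 ≤ Real.cos θ - 1 / 2 := by linarith
    have h2 : 0 ≤ ∑ j ∈ Finset.range (m + 1), |laguerre (m + 1 - 1 - j) k (h / δ * 1)| * cCoeff j θ :=
      Finset.sum_nonneg fun j _ => mul_nonneg (abs_nonneg _) (hc j)
    positivity
  have hlim : Tendsto (fun t => (|lensBound k (m + 1) (h / δ) (θ + t) (1 - t)| + t) * Q) (𝓝[>] 0)
      (𝓝 (bound₁ 1 k (m + 1) (h / δ) θ Q)) := by
    have h1 := ((tendsto_lensBound k (m + 1) hτ0 (cos_gt_half h0 hθ)).abs.add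
      (tendsto_id (α := ℝ))).mul_const Q
    rw [abs_of_nonneg hnn, add_zero, lensBound_one hτ0] at h1
    exact h1.mono_left nhdsWithin_le_nhds
  constructor
  · refine ge_of_tendsto (hlim.const_mul 4) ?_
    filter_upwards [hev] with t ⟨ht, ht1, hθt⟩
    rw [← mul_assoc]
    exact (norm_error_le hv h0 hh hδ hL hbr ht ht1 hθt).1
  · intro hsymm
    refine ge_of_tendsto hlim ?_
    filter_upwards [hev] with t ⟨ht, ht1, hθt⟩
    exact (norm_error_le hv h0 hh hδ hL hbr ht ht1 hθt).2 hsymm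

end

end RDArnoldi
end

theorem theorem1 :
    ∃ K : ℝ, 2 ≤ K ∧ K ≤ 11.08 ∧
      ∀ (M : ℕ) (L : Matrix (Fin M) (Fin M) ℝ) (v : EuclideanSpace ℝ (Fin M))
        (θ h δ : ℝ) (k m : ℕ),
        ‖v‖ = 1 → 0 ≤ θ → θ < Real.pi / 3 → 0 < h → 0 < δ → 1 ≤ m →
        RDArnoldi.numericalRange L ⊆ RDArnoldi.sector θ →
        RDArnoldi.NoBreakdown (RDArnoldi.shiftInv δ L) v m →
        (‖RDArnoldi.exactVec k h L v - RDArnoldi.approxVec k h δ L v m‖ ≤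
            RDArnoldi.bound₁ K k m (h / δ) θ
              (RDArnoldi.subdiagProd (RDArnoldi.shiftInv δ L) v m) ∧
          RDArnoldi.bound₁ K k m (h / δ) θ
              (RDArnoldi.subdiagProd (RDArnoldi.shiftInv δ L) v m) ≤
            RDArnoldi.bound₂ K k m (h / δ) θ
              (RDArnoldi.subdiagProd (RDArnoldi.shiftInv δ L) v m)) ∧
        (L.IsSymm →
          ‖RDArnoldi.exactVec k h L v - RDArnoldi.approxVec k h δ L v m‖ ≤
            RDArnoldi.bound₁ 1 k m (h / δ) θ
              (RDArnoldi.subdiagProd (RDArnoldi.shiftInv δ L) v m) ∧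
          RDArnoldi.bound₁ 1 k m (h / δ) θ
              (RDArnoldi.subdiagProd (RDArnoldi.shiftInv δ L) v m) ≤
            RDArnoldi.bound₂ 1 k m (h / δ) θ
              (RDArnoldi.subdiagProd (RDArnoldi.shiftInv δ L) v m)) := by
  -- K = 4 is the spectral constant of `norm_fc_le`, which lies in the required interval.
  refine ⟨4, by norm_num, by norm_num, fun M L v θ h δ k m hv h0 hθ hh hδ hm hL hbr => ?_⟩
  obtain ⟨m, rfl⟩ : ∃ n, m = n + 1 := ⟨m - 1, by omega⟩
  have hP := RDArnoldi.subdiagProd_nonneg (hbr.orthonormalUpTo hv)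
  have hle : ∀ K : ℝ, 0 ≤ K → _ := fun K hK => RDArnoldi.bound₁_le_bound₂ (k := k) (m := m + 1) hK
    (div_pos hh hδ) (RDArnoldi.cos_gt_half h0 hθ) hP
  obtain ⟨h1, h2⟩ := RDArnoldi.norm_error_le_bound₁ (k := k) hv h0 hθ hh hδ hL hbr
  refine ⟨⟨?_, hle 4 (by norm_num)⟩, fun hsymm => ⟨h2 hsymm, hle 1 zero_le_one⟩⟩
  rw [RDArnoldi.bound₁_eq_mul]
  exact h1
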